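/- Let $p$ be a prime and $\mathbb{K}$ a field of characteristic zero. For finite groups $G,H$, a finite $(H,G)$-biset is $p$-bifree if the left and right stabilizers of all its points are $p'$-groups (groups of order not divisible by $p$). Let $B^\Delta(H,G)$ be the Grothendieck group, with respect to disjoint unions, of the category of $p$-bifree $(H,G)$-bisets, and let $\mathbb{K}\mathcal{C}^\Delta$ be the category whose objects are the finite groups, with $\mathrm{Hom}(G,H)=\mathbb{K}B^\Delta(H,G)=\mathbb{K}\otimes_{\mathbb{Z}}B^\Delta(H,G)$, composition induced by $(Y,X)\mapsto Y\times_H X$, and identities $[G]$. A $p$-bifree biset functor is a $\mathbb{K}$-linear functor from $\mathbb{K}\mathcal{C}^\Delta$ to $\mathbb{K}$-modules. The Burnside functor $\mathbb{K}B$ sends $G$ to $\mathbb{K}\otimes_{\mathbb{Z}} B(G)$, and a $p$-bifree $(H,G)$-biset $X$ acts on it by $U\mapsto X\times_G U$. For a finite group $G$ put $E_G=\mathbb{K}B^\Delta(G,G)$, and let $I_G\subseteq E_G$ be the ideal spanned by the endomorphisms that factor through a group of order smaller than $|G|$; then $E_G/I_G\cong\mathbb{K}\mathrm{Out}(G)$.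 For a $\mathbb{K}\mathrm{Out}(G)$-module $V$, regarded as an $E_G$-module, let $L_{G,V}(H)=\mathbb{K}B^\Delta(H,G)\otimes_{E_G}V$, let $J_{G,V}(H)$ be the set of $\sum_i x_i\otimes v_i\in L_{G,V}(H)$ with $\sum_i (yx_i)v_i=0$ for all $y\in\mathbb{K}B^\Delta(G,H)$, and put $S^\Delta_{G,V}=L_{G,V}/J_{G,V}$. Write $S^\Delta_{G,\mathbb{K}}$ for the case of the trivial module $V=\mathbb{K}$. Let $e^G_G\in\mathbb{K}B(G)$ be the primitive idempotent whose mark (number of fixed points, extended linearly) is $1$ at $G$ and $0$ at every proper subgroup of $G$, and let $\mathbf{e}^\Delta_G\subseteq\mathbb{K}B$ be the subfunctor generated by $e^G_G$. For $N\trianglelefteq G$ let $$m_{G,N}=\frac1{|G|}\sum_{X\le G,\;XN=G}|X|\,\mu(X,G),$$ where $\mu$ is the Möbius function of the poset of subgroups of $G$. A finite group $G$ is a $B^\Delta_p$-group if $m_{G,N}=0$ for every nontrivial normal $p'$-subgroup $N$ of $G$. Let $[B^\Delta_p\text{-gr}]$ be the set of isomorphism classes of $B^\Delta_p$-groups. Write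 $G\gg H$ if $H$ is isomorphic to a quotient of $G$ by a normal $p'$-subgroup, and call $\mathcal{M}\subseteq[B^\Delta_p\text{-gr}]$ closed if $H\in\mathcal{M}$ and $G\gg H$ imply $G\in\mathcal{M}$. For a $B^\Delta_p$-group $G$ put $$\mathbf{j}_G=\sum_{H\in[B^\Delta_p\text{-gr}],\;H\gg G,\;H\not\cong G}\mathbf{e}^\Delta_H .$$ Then the following hold. 1. The map $\Theta: F\mapsto\{H\in[B^\Delta_p\text{-gr}] : \mathbf{e}^\Delta_H\subseteq F\}$ is an isomorphism from the poset of subfunctors of $\mathbb{K}B$ to the poset of closed subsets of $[B^\Delta_p\text{-gr}]$ (both ordered by inclusion), with inverse $A\mapsto\sum_{H\in A}\mathbf{e}^\Delta_H$. 2. Let $G$ be a $B^\Delta_p$-group. Then $\mathbf{j}_G$ is a proper subfunctor of $\mathbf{e}^\Delta_G$ that contains every proper subfunctor of $\mathbf{e}^\Delta_G$ (in particular it is its unique maximal subfunctor), and $\mathbf{e}^\Delta_G/\mathbf{j}_G\cong S^\Delta_{G,\mathbb{K}}$. 3. Let $F\subset F'$ be subfunctors of $\mathbb{K}B$ such that $F'/F$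 is simple. Then there is a $B^\Delta_p$-group $G$, unique up to isomorphism, such that $\mathbf{e}^\Delta_G\subseteq F'$ and $\mathbf{e}^\Delta_G\not\subseteq F$. Moreover $\mathbf{e}^\Delta_G+F=F'$, $\mathbf{e}^\Delta_G\cap F=\mathbf{j}_G$ and $F'/F\cong S^\Delta_{G,\mathbb{K}}$. 4. The composition factors of $\mathbb{K}B$ (the simple $p$-bifree biset functors isomorphic to $F'/F$ for some subfunctors $F\subseteq F'\subseteq\mathbb{K}B$) are, up to isomorphism, exactly the functors $S^\Delta_{G,\mathbb{K}}$ for $G\in[B^\Delta_p\text{-gr}]$, and $S^\Delta_{G,\mathbb{K}}\cong S^\Delta_{H,\mathbb{K}}$ for $B^\Delta_p$-groups $G,H$ only if $G\cong H$. -/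

import Mathlib

universe u v w

open CategoryTheory MulOpposite
open scoped TensorProduct Pointwise

noncomputable section

namespace BifreeBiset

/-! ### Finite bisets -/

/-- A finite `(H, G)`-biset: a finite set with commuting left `H`-action and right `G`-action. -/
structure FinBiset (H G : Type v) [Group H] [Group G] where
  carrier : Type v
  [finite : Finite carrier]
  [left : MulAction H carrier]
  [right : MulAction Gᵐᵒᵖ carrier]
  [comm : SMulCommClass H Gᵐᵒᵖ carrier]

attribute [instance] FinBiset.finite FinBiset.left FinBiset.right FinBiset.comm

namespace FinBiset

variable {K H G F : Type v} [Group K] [Group H] [Group G] [Group F]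

instance : CoeSort (FinBiset H G) (Type v) := ⟨FinBiset.carrier⟩

/-- Isomorphisms of `(H, G)`-bisets. -/
structure Iso (X Y : FinBiset H G) extends X ≃ Y where
  map_left : ∀ (h : H) (x : X), toEquiv (h • x) = h • toEquiv x
  map_right : ∀ (g : G) (x : X), toEquiv (op g • x) = op g • toEquiv x

/-- The disjoint union of two bisets. -/
def sum (X Y : FinBiset H G) : FinBiset H G where
  carrier := X ⊕ Y

/-- The first inclusion into a disjoint union. -/
def inl {X Y : FinBiset H G} (x : X) : sum X Y := Sum.inl x

/-- The second inclusion into a disjoint union. -/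
def inr {X Y : FinBiset H G} (y : Y) : sum X Y := Sum.inr y

theorem sum_cases {X Y : FinBiset H G} (z : sum X Y) : (∃ x, z = inl x) ∨ ∃ y, z = inr y :=
  match z with
  | Sum.inl x => Or.inl ⟨x, rfl⟩
  | Sum.inr y => Or.inr ⟨y, rfl⟩

/-- Functions out of a disjoint union. -/
def selim {X Y : FinBiset H G} {A : Type*} (f : X → A) (g : Y → A) (z : sum X Y) : A :=
  Sum.elim f g z

/-- The relation `(x h, y) ∼ (x, h y)` on `X × Y`. -/
def tensorSetoid (X : FinBiset K H) (Y : FinBiset H G) : Setoid (X × Y) where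
  r a b := ∃ h : H, b.1 = op h • a.1 ∧ a.2 = h • b.2
  iseqv :=
    { refl := fun a => ⟨1, by simp⟩
      symm := by
        rintro a b ⟨h, h1, h2⟩
        exact ⟨h⁻¹, by rw [h1, smul_smul, ← op_mul]; simp, by rw [h2]; simp⟩
      trans := by
        rintro a b c ⟨h, h1, h2⟩ ⟨k, k1, k2⟩
        exact ⟨h * k, by rw [k1, h1, smul_smul, op_mul], by rw [h2, k2, smul_smul]⟩ }

instance tensorLeft (X : FinBiset K H) (Y : FinBiset H G) :
    MulAction K (Quotient (tensorSetoid X Y)) where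
  smul k := Quotient.map (fun a => (k • a.1, a.2)) (by
    rintro a b ⟨h, h1, h2⟩
    exact ⟨h, by simp only [h1]; exact smul_comm k (op h) a.1, h2⟩)
  one_smul := by
    rintro ⟨a⟩
    exact congrArg (Quotient.mk _) (Prod.ext (one_smul K a.1) rfl)
  mul_smul := by
    rintro k l ⟨a⟩
    exact congrArg (Quotient.mk _) (Prod.ext (mul_smul k l a.1) rfl)

instance tensorRight (X : FinBiset K H) (Y : FinBiset H G) :
    MulAction Gᵐᵒᵖ (Quotient (tensorSetoid X Y)) where
  smul g := Quotient.map (fun a => (a.1, g • a.2)) (by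
    rintro a b ⟨h, h1, h2⟩
    exact ⟨h, h1, by simp only [h2]; exact (smul_comm h g b.2).symm⟩)
  one_smul := by
    rintro ⟨a⟩
    exact congrArg (Quotient.mk _) (Prod.ext rfl (one_smul _ a.2))
  mul_smul := by
    rintro k l ⟨a⟩
    exact congrArg (Quotient.mk _) (Prod.ext rfl (mul_smul k l a.2))

/-- The composition `X ×_H Y` of bisets, with `k · [x, y] · g = [k x, y g]`. -/
def tensor (X : FinBiset K H) (Y : FinBiset H G) : FinBiset K G where
  carrier := Quotient (tensorSetoid X Y)
  comm := ⟨by rintro k g ⟨a⟩; rfl⟩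

/-- The class of `(x, y)` in `X ×_H Y`. -/
def tmk {X : FinBiset K H} {Y : FinBiset H G} (x : X) (y : Y) : tensor X Y :=
  Quotient.mk (tensorSetoid X Y) (x, y)

theorem tmk_eq_iff {X : FinBiset K H} {Y : FinBiset H G} {x x' : X} {y y' : Y} :
    (tmk x y : tensor X Y) = tmk x' y' ↔ ∃ h : H, x' = op h • x ∧ y = h • y' :=
  Quotient.eq (r := tensorSetoid X Y)

theorem tmk_smul {X : FinBiset K H} {Y : FinBiset H G} (x : X) (h : H) (y : Y) :
    (tmk (op h • x) y : tensor X Y) = tmk x (h • y) :=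
  (tmk_eq_iff.2 ⟨h, rfl, rfl⟩).symm

theorem smul_tmk {X : FinBiset K H} {Y : FinBiset H G} (k : K) (x : X) (y : Y) :
    k • (tmk x y : tensor X Y) = tmk (k • x) y := rfl

theorem op_smul_tmk {X : FinBiset K H} {Y : FinBiset H G} (g : Gᵐᵒᵖ) (x : X) (y : Y) :
    g • (tmk x y : tensor X Y) = tmk x (g • y) := rfl

theorem tmk_surj {X : FinBiset K H} {Y : FinBiset H G} (t : tensor X Y) :
    ∃ x y, tmk x y = t := by
  obtain ⟨⟨x, y⟩, rfl⟩ := Quotient.exists_rep t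
  exact ⟨x, y, rfl⟩

/-- Functions out of `X ×_H Y`. -/
def tlift {X : FinBiset K H} {Y : FinBiset H G} {A : Type*} (f : X → Y → A)
    (hf : ∀ x (h : H) y, f (op h • x) y = f x (h • y)) (t : tensor X Y) : A :=
  Quotient.lift (fun a : X × Y => f a.1 a.2) (by
    rintro ⟨x, y⟩ ⟨x', y'⟩ ⟨h, h1, h2⟩
    simp only at h1 h2
    subst h1 h2
    exact (hf x h y').symm) t

theorem tlift_tmk {X : FinBiset K H} {Y : FinBiset H G} {A : Type*} (f : X → Y → A)
    (hf : ∀ x (h : H) y, f (op h • x) y = f x (h • y)) (x : X) (y : Y) :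
    tlift f hf (tmk x y) = f x y := rfl

/-- Associativity of the composition of bisets. -/
def tensorAssoc (X : FinBiset F K) (Y : FinBiset K H) (Z : FinBiset H G) :
    Iso (tensor (tensor X Y) Z) (tensor X (tensor Y Z)) where
  toFun := tlift (fun t z => tlift (fun x y => tmk x (tmk y z))
      (by intro x h y; rw [tmk_smul]; rfl) t)
    (by
      intro t h z
      obtain ⟨x, y, rfl⟩ := tmk_surj t
      rw [op_smul_tmk, tlift_tmk, tlift_tmk, tmk_smul])
  invFun := tlift (fun x t => tlift (fun y z => tmk (tmk x y) z)
      (by intro y h z; rw [← tmk_smul]; rfl) t)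
    (by
      intro x h t
      obtain ⟨y, z, rfl⟩ := tmk_surj t
      rw [smul_tmk, tlift_tmk, tlift_tmk, tmk_smul])
  left_inv := by
    intro t
    obtain ⟨t, z, rfl⟩ := tmk_surj t
    obtain ⟨x, y, rfl⟩ := tmk_surj t
    rfl
  right_inv := by
    intro t
    obtain ⟨x, t, rfl⟩ := tmk_surj t
    obtain ⟨y, z, rfl⟩ := tmk_surj t
    rfl
  map_left := by
    intro k t
    obtain ⟨t, z, rfl⟩ := tmk_surj t
    obtain ⟨x, y, rfl⟩ := tmk_surj t
    rfl
  map_right := by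
    intro k t
    obtain ⟨t, z, rfl⟩ := tmk_surj t
    obtain ⟨x, y, rfl⟩ := tmk_surj t
    rfl

/-- The `(G, G)`-biset `Iso(θ)` of an automorphism `θ`: the set `G` with `h · x · g = h x θ(g)`. -/
def ofAut (θ : MulAut G) [Finite G] : FinBiset G G where
  carrier := G
  right :=
    { smul := fun g x => x * θ g.unop
      one_smul := fun x => by change x * θ 1 = x; simp
      mul_smul := fun a b x => by
        change x * θ (b.unop * a.unop) = x * θ b.unop * θ a.unop
        simp [mul_assoc] }
  comm :=
    letI : MulAction Gᵐᵒᵖ G :=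
      { smul := fun g x => x * θ g.unop
        one_smul := fun x => by change x * θ 1 = x; simp
        mul_smul := fun a b x => by
          change x * θ (b.unop * a.unop) = x * θ b.unop * θ a.unop
          simp [mul_assoc] }
    @SMulCommClass.mk _ _ _ _ _ (fun a b x => (mul_assoc a x (θ b.unop)).symm)

/-- The identity biset: `G` acting on itself by left and right multiplication. -/
def refl (G : Type v) [Group G] [Finite G] : FinBiset G G where
  carrier := G

/-- `G ×_G Y ≅ Y`. -/
def reflTensor [Finite H] (Y : FinBiset H G) : Iso (tensor (refl H) Y) Y where
  toFun := tlift (fun (h : H) y => h • y) (fun (x : H) h y => mul_smul x h y)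
  invFun y := tmk (X := refl H) (1 : H) y
  left_inv := by
    intro t
    obtain ⟨x, y, rfl⟩ := tmk_surj t
    refine (tmk_smul (X := refl H) (1 : H) x y).symm.trans ?_
    exact congrArg (fun z => tmk (X := refl H) z y) (one_mul (M := H) x)
  right_inv y := one_smul H y
  map_left := by
    intro k t
    obtain ⟨x, y, rfl⟩ := tmk_surj t
    exact mul_smul (α := H) k x y
  map_right := by
    intro k t
    obtain ⟨x, y, rfl⟩ := tmk_surj t
    exact smul_comm (M := H) x (op k) y

/-- `X ×_H H ≅ X`. -/
def tensorRefl [Finite H] (X : FinBiset K H) : Iso (tensor X (refl H)) X where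
  toFun := tlift (fun x (h : H) => op h • x) (fun x h (y : H) => by
    change op y • op h • x = op (h * y) • x
    rw [op_mul, mul_smul])
  invFun x := tmk (Y := refl H) x (1 : H)
  left_inv := by
    intro t
    obtain ⟨x, y, rfl⟩ := tmk_surj t
    refine (tmk_smul (Y := refl H) x y (1 : H)).trans ?_
    exact congrArg (fun z => tmk (Y := refl H) x z) (mul_one (M := H) y)
  right_inv x := one_smul Hᵐᵒᵖ x
  map_left := by
    intro k t
    obtain ⟨x, y, rfl⟩ := tmk_surj t
    exact (smul_comm (N := Hᵐᵒᵖ) k (op y) x).symm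
  map_right := by
    intro k t
    obtain ⟨x, y, rfl⟩ := tmk_surj t
    exact mul_smul (α := Hᵐᵒᵖ) (op k) (op y) x

/-- `X ×_H -` preserves disjoint unions. -/
def tensorSum (X : FinBiset K H) {Y Y' Z : FinBiset H G} (e : Iso Z (sum Y Y')) :
    Iso (tensor X Z) (sum (tensor X Y) (tensor X Y')) where
  toFun := tlift (fun x z => selim (fun y => inl (tmk x y)) (fun y => inr (tmk x y)) (e.toEquiv z))
    (by
      intro x h z
      rw [e.map_left]
      obtain ⟨y, hy⟩ | ⟨y, hy⟩ := sum_cases (e.toEquiv z) <;> rw [hy]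
      · exact congrArg inl (tmk_smul x h y)
      · exact congrArg inr (tmk_smul x h y))
  invFun := selim
    (tlift (fun x y => tmk x (e.toEquiv.symm (inl y))) (by
      intro x h y
      rw [tmk_smul]
      refine congrArg (tmk x) (e.toEquiv.injective ?_)
      rw [e.map_left, Equiv.apply_symm_apply, Equiv.apply_symm_apply]
      rfl))
    (tlift (fun x y => tmk x (e.toEquiv.symm (inr y))) (by
      intro x h y
      rw [tmk_smul]
      refine congrArg (tmk x) (e.toEquiv.injective ?_)
      rw [e.map_left, Equiv.apply_symm_apply, Equiv.apply_symm_apply]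
      rfl))
  left_inv := by
    intro t
    obtain ⟨x, z, rfl⟩ := tmk_surj t
    obtain ⟨y, rfl⟩ := e.toEquiv.symm.surjective z
    rw [tlift_tmk, Equiv.apply_symm_apply]
    obtain ⟨y, rfl⟩ | ⟨y, rfl⟩ := sum_cases y <;> rfl
  right_inv := by
    intro t
    obtain ⟨t, rfl⟩ | ⟨t, rfl⟩ := sum_cases t <;> obtain ⟨x, y, rfl⟩ := tmk_surj t
    · change selim _ _ (e.toEquiv (e.toEquiv.symm (inl y))) = _
      rw [Equiv.apply_symm_apply]; rfl
    · change selim _ _ (e.toEquiv (e.toEquiv.symm (inr y))) = _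
      rw [Equiv.apply_symm_apply]; rfl
  map_left := by
    intro k t
    obtain ⟨x, z, rfl⟩ := tmk_surj t
    change selim _ _ (e.toEquiv z) = k • selim _ _ (e.toEquiv z)
    obtain ⟨y, hy⟩ | ⟨y, hy⟩ := sum_cases (e.toEquiv z) <;> rw [hy] <;> rfl
  map_right := by
    intro k t
    obtain ⟨x, z, rfl⟩ := tmk_surj t
    change selim _ _ (e.toEquiv (op k • z)) = op k • selim _ _ (e.toEquiv z)
    rw [e.map_right]
    obtain ⟨y, hy⟩ | ⟨y, hy⟩ := sum_cases (e.toEquiv z) <;> rw [hy] <;> rfl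

/-- `- ×_H Y` preserves disjoint unions. -/
def sumTensor {X X' Z : FinBiset K H} (e : Iso Z (sum X X')) (Y : FinBiset H G) :
    Iso (tensor Z Y) (sum (tensor X Y) (tensor X' Y)) where
  toFun := tlift (fun z y => selim (fun x => inl (tmk x y)) (fun x => inr (tmk x y)) (e.toEquiv z))
    (by
      intro z h y
      rw [e.map_right]
      obtain ⟨x, hx⟩ | ⟨x, hx⟩ := sum_cases (e.toEquiv z) <;> rw [hx]
      · exact congrArg inl (tmk_smul x h y)
      · exact congrArg inr (tmk_smul x h y))
  invFun := selim
    (tlift (fun x y => tmk (e.toEquiv.symm (inl x)) y) (by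
      intro x h y
      rw [← tmk_smul]
      refine congrArg (tmk · y) (e.toEquiv.injective ?_)
      rw [e.map_right, Equiv.apply_symm_apply, Equiv.apply_symm_apply]
      rfl))
    (tlift (fun x y => tmk (e.toEquiv.symm (inr x)) y) (by
      intro x h y
      rw [← tmk_smul]
      refine congrArg (tmk · y) (e.toEquiv.injective ?_)
      rw [e.map_right, Equiv.apply_symm_apply, Equiv.apply_symm_apply]
      rfl))
  left_inv := by
    intro t
    obtain ⟨z, y, rfl⟩ := tmk_surj t
    obtain ⟨x, rfl⟩ := e.toEquiv.symm.surjective z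
    rw [tlift_tmk, Equiv.apply_symm_apply]
    obtain ⟨x, rfl⟩ | ⟨x, rfl⟩ := sum_cases x <;> rfl
  right_inv := by
    intro t
    obtain ⟨t, rfl⟩ | ⟨t, rfl⟩ := sum_cases t <;> obtain ⟨x, y, rfl⟩ := tmk_surj t
    · change selim _ _ (e.toEquiv (e.toEquiv.symm (inl x))) = _
      rw [Equiv.apply_symm_apply]; rfl
    · change selim _ _ (e.toEquiv (e.toEquiv.symm (inr x))) = _
      rw [Equiv.apply_symm_apply]; rfl
  map_left := by
    intro k t
    obtain ⟨z, y, rfl⟩ := tmk_surj t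
    change selim _ _ (e.toEquiv (k • z)) = k • selim _ _ (e.toEquiv z)
    rw [e.map_left]
    obtain ⟨x, hx⟩ | ⟨x, hx⟩ := sum_cases (e.toEquiv z) <;> rw [hx] <;> rfl
  map_right := by
    intro k t
    obtain ⟨z, y, rfl⟩ := tmk_surj t
    change selim _ _ (e.toEquiv z) = op k • selim _ _ (e.toEquiv z)
    obtain ⟨x, hx⟩ | ⟨x, hx⟩ := sum_cases (e.toEquiv z) <;> rw [hx] <;> rfl

end FinBiset

/-! ### `p`-bifree bisets -/

/-- A finite group is a `p'`-group if `p` does not divide its order. -/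
def IsPPrimeGroup (p : ℕ) (G : Type*) [Group G] : Prop := ¬ p ∣ Nat.card G

/-- A biset is `p`-bifree if all left and right stabilizers of its points are `p'`-groups. -/
def FinBiset.IsBifree (p : ℕ) {H G : Type v} [Group H] [Group G] (X : FinBiset H G) : Prop :=
  ∀ x : X, IsPPrimeGroup p (MulAction.stabilizer H x) ∧
    IsPPrimeGroup p (MulAction.stabilizer Gᵐᵒᵖ x)

namespace FinBiset

variable {p : ℕ} [hp : Fact p.Prime] {K H G : Type v} [Group K] [Group H] [Group G]

theorem pow_smul_eq_of_comm {A B X : Type*} [Group A] [Group B] [MulAction A X] [MulAction B X]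
    [SMulCommClass A B X] {a : A} {b : B} {x : X} (h : a • x = b • x) (n : ℕ) :
    a ^ n • x = b ^ n • x := by
  induction n with
  | zero => simp
  | succ n ih => rw [pow_succ, mul_smul, h, smul_comm, ih, smul_smul, ← pow_succ']

theorem isPPrimeGroup_stabilizer_of {A B X Y : Type*} [Group A] [Finite A] [Group B]
    [MulAction A X] [MulAction B X] [SMulCommClass A B X] [MulAction A Y] (x : X) (y : Y)
    (S : Subgroup B) (hS : IsPPrimeGroup p S) (hx : IsPPrimeGroup p (MulAction.stabilizer A x))
    (h : ∀ a : A, a • y = y → ∃ b ∈ S, a • x = b • x) :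
    IsPPrimeGroup p (MulAction.stabilizer A y) := by
  intro hdvd
  obtain ⟨⟨a, ha⟩, hord⟩ := exists_prime_orderOf_dvd_card' p hdvd
  obtain ⟨b, hb, hab⟩ := h a ha
  have hbn : b ^ Nat.card S = 1 :=
    congrArg Subtype.val (pow_card_eq_one' (x := (⟨b, hb⟩ : S)))
  have h1 : a ^ Nat.card S ∈ MulAction.stabilizer A x := by
    rw [MulAction.mem_stabilizer_iff, pow_smul_eq_of_comm hab, hbn, one_smul]
  have h2 : (a ^ Nat.card S) ^ Nat.card (MulAction.stabilizer A x) = 1 :=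
    congrArg Subtype.val (pow_card_eq_one' (x := (⟨_, h1⟩ : MulAction.stabilizer A x)))
  rw [← pow_mul] at h2
  have h3 : orderOf a = p := by rw [← hord, Subgroup.orderOf_mk]
  have h4 := orderOf_dvd_of_pow_eq_one h2
  rw [h3] at h4
  exact (hp.out.dvd_mul.1 h4).elim hS hx

theorem IsBifree.tensor [Finite K] [Finite G] {X : FinBiset K H} {Y : FinBiset H G}
    (hX : X.IsBifree p) (hY : Y.IsBifree p) : (X.tensor Y).IsBifree p := by
  intro t
  obtain ⟨x, y, rfl⟩ := tmk_surj t
  have : Finite Gᵐᵒᵖ := Finite.of_equiv G opEquiv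
  constructor
  · refine isPPrimeGroup_stabilizer_of (B := Hᵐᵒᵖ) x _ ((MulAction.stabilizer H y).op) ?_ (hX x).1 ?_
    · unfold IsPPrimeGroup
      rw [Nat.card_congr (Subgroup.equivOp _).symm]
      exact (hY y).1
    · intro a ha
      rw [smul_tmk, tmk_eq_iff] at ha
      obtain ⟨h, h1, h2⟩ := ha
      refine ⟨(op h)⁻¹, ?_, ?_⟩
      · rw [inv_mem_iff, Subgroup.mem_op, MulAction.mem_stabilizer_iff, unop_op]
        exact h2.symm
      · rw [eq_inv_smul_iff]
        exact h1.symm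
  · have := SMulCommClass.symm H Gᵐᵒᵖ Y
    refine isPPrimeGroup_stabilizer_of (B := H) y _ ((MulAction.stabilizer Hᵐᵒᵖ x).unop) ?_
      (hY y).2 ?_
    · unfold IsPPrimeGroup
      rw [Nat.card_congr (Subgroup.equivOp _)]
      exact (hX x).2
    · intro a ha
      rw [op_smul_tmk, tmk_eq_iff] at ha
      obtain ⟨h, h1, h2⟩ := ha
      refine ⟨h, ?_, h2⟩
      rw [Subgroup.mem_unop, MulAction.mem_stabilizer_iff]
      exact h1.symm

theorem isPPrimeGroup_of_eq_bot {A : Type*} [Group A] {S : Subgroup A} (h : S = ⊥) :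
    IsPPrimeGroup p S := by
  subst h
  simpa [IsPPrimeGroup] using hp.out.one_lt.ne'

theorem isBifree_ofAut [Finite G] (θ : MulAut G) : (ofAut θ).IsBifree p := by
  intro x
  constructor <;> apply isPPrimeGroup_of_eq_bot <;> rw [eq_bot_iff] <;> intro g hg
  · exact (mul_eq_right (M := G)).1 hg
  · have h : θ g.unop = 1 := (mul_eq_left (M := G)).1 hg
    rw [Subgroup.mem_bot, ← unop_eq_one_iff]
    simpa using h

theorem isBifree_refl [Finite G] : (refl G).IsBifree p := by
  intro x
  constructor <;> apply isPPrimeGroup_of_eq_bot <;> rw [eq_bot_iff] <;> intro g hg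
  · exact (mul_eq_right (M := G)).1 hg
  · have h : g.unop = 1 := (mul_eq_left (M := G)).1 hg
    rw [Subgroup.mem_bot, ← unop_eq_one_iff]
    exact h

end FinBiset

/-! ### Grothendieck groups of bisets, with coefficients -/

section Groth

variable (R : Type u) [CommRing R] {K H G F : Type v} [Group K] [Group H] [Group G] [Group F]

/-- The relations `[Z] = [X] + [Y]` for `Z ≅ X ⊔ Y`. -/
def grothRel (P : FinBiset H G → Prop) : Submodule R ({X : FinBiset H G // P X} →₀ R) :=
  Submodule.span R {d | ∃ X Y Z : {X : FinBiset H G // P X},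
    Nonempty (FinBiset.Iso Z.1 (X.1.sum Y.1)) ∧
      d = Finsupp.single Z 1 - Finsupp.single X 1 - Finsupp.single Y 1}

/-- `R ⊗ B_P(H, G)`, where `B_P(H, G)` is the Grothendieck group, for disjoint unions, of the
category of finite `(H, G)`-bisets that satisfy `P`: the `R`-module with one generator `[X]` for
every such biset `X` and the relations `[Z] = [X] + [Y]` whenever `Z ≅ X ⊔ Y`. (With `Y` empty
this gives `[Z] = [X]` for `Z ≅ X`.) -/
def Groth (P : FinBiset H G → Prop) : Type (max u (v + 1)) :=
  ({X : FinBiset H G // P X} →₀ R) ⧸ grothRel R P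

instance (P : FinBiset H G → Prop) : AddCommGroup (Groth R P) :=
  inferInstanceAs (AddCommGroup (({X : FinBiset H G // P X} →₀ R) ⧸ grothRel R P))

instance (P : FinBiset H G → Prop) : Module R (Groth R P) :=
  inferInstanceAs (Module R (({X : FinBiset H G // P X} →₀ R) ⧸ grothRel R P))

namespace Groth

variable {P : FinBiset H G → Prop}

/-- The class `[X]` of a biset. -/
def mk (X : FinBiset H G) (hX : P X) : Groth R P :=
  (grothRel R P).mkQ (Finsupp.single ⟨X, hX⟩ 1)

theorem mk_sum {X Y Z : FinBiset H G} (hX : P X) (hY : P Y) (hZ : P Z)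
    (e : FinBiset.Iso Z (X.sum Y)) : mk R Z hZ = mk R X hX + mk R Y hY := by
  rw [← sub_eq_zero, ← sub_sub]
  refine (Submodule.Quotient.mk_eq_zero (grothRel R P)).2
    (Submodule.subset_span ⟨⟨X, hX⟩, ⟨Y, hY⟩, ⟨Z, hZ⟩, ⟨e⟩, rfl⟩)

variable {R} {M : Type*} [AddCommGroup M] [Module R M]

/-- Linear maps out of a Grothendieck group, from additive invariants of bisets. -/
def lift (f : ∀ X : FinBiset H G, P X → M)
    (hf : ∀ (X Y Z : FinBiset H G) (hX : P X) (hY : P Y) (hZ : P Z),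
      FinBiset.Iso Z (X.sum Y) → f Z hZ = f X hX + f Y hY) : Groth R P →ₗ[R] M :=
  (grothRel R P).liftQ (Finsupp.lift M R _ (fun X => f X.1 X.2)) (by
    refine Submodule.span_le.2 ?_
    rintro _ ⟨X, Y, Z, ⟨e⟩, rfl⟩
    rw [SetLike.mem_coe, LinearMap.mem_ker, map_sub, map_sub]
    simp [Finsupp.lift_apply, hf X.1 Y.1 Z.1 X.2 Y.2 Z.2 e])

theorem lift_mk (f : ∀ X : FinBiset H G, P X → M)
    (hf : ∀ (X Y Z : FinBiset H G) (hX : P X) (hY : P Y) (hZ : P Z),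
      FinBiset.Iso Z (X.sum Y) → f Z hZ = f X hX + f Y hY) (X : FinBiset H G) (hX : P X) :
    lift (R := R) f hf (mk R X hX) = f X hX := by
  refine ((grothRel R P).liftQ_apply _ _).trans ?_
  simp [Finsupp.lift_apply]

theorem hom_ext {f g : Groth R P →ₗ[R] M}
    (h : ∀ X hX, f (mk R X hX) = g (mk R X hX)) : f = g := by
  refine Submodule.linearMap_qext _ (Finsupp.lhom_ext' fun X => LinearMap.ext_ring ?_)
  exact h X.1 X.2

theorem induction {C : Groth R P → Prop} (h0 : C 0) (hmk : ∀ X hX, C (mk R X hX))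
    (hadd : ∀ a b, C a → C b → C (a + b)) (hsmul : ∀ (r : R) a, C a → C (r • a))
    (a : Groth R P) : C a := by
  obtain ⟨a, rfl⟩ := Submodule.mkQ_surjective (grothRel R P) a
  induction a using Finsupp.induction_linear with
  | zero => rw [map_zero]; exact h0
  | add f g hf hg => rw [map_add]; exact hadd _ _ hf hg
  | single X r =>
    rw [← mul_one r, ← smul_eq_mul, ← Finsupp.smul_single, map_smul]
    exact hsmul _ _ (hmk X.1 X.2)

instance emptyMulAction (H : Type*) [Group H] : MulAction H PEmpty.{v + 1} where
  smul _ x := x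
  one_smul _ := rfl
  mul_smul _ _ x := x.elim

/-- The empty biset. -/
def _root_.BifreeBiset.FinBiset.empty (H G : Type v) [Group H] [Group G] : FinBiset H G where
  carrier := PEmpty
  comm := ⟨fun _ _ x => x.elim⟩

/-- `X ⊔ ∅ ≅ X`. -/
def _root_.BifreeBiset.FinBiset.sumEmpty {X Y : FinBiset H G} (e : FinBiset.Iso X Y) :
    FinBiset.Iso X (Y.sum (FinBiset.empty H G)) where
  toEquiv := e.toEquiv.trans (Equiv.sumEmpty Y PEmpty).symm
  map_left h x := congrArg Sum.inl (e.map_left h x)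
  map_right h x := congrArg Sum.inl (e.map_right h x)

theorem mk_iso (h0 : P (FinBiset.empty H G)) {X Y : FinBiset H G} (hX : P X) (hY : P Y)
    (e : FinBiset.Iso X Y) : mk R X hX = mk R Y hY := by
  have h1 := mk_sum R hX h0 hX (FinBiset.sumEmpty ⟨Equiv.refl X, fun _ _ => rfl, fun _ _ => rfl⟩)
  have h2 := mk_sum R hY h0 hX (FinBiset.sumEmpty e)
  rw [left_eq_add] at h1
  rw [h2, h1, add_zero]

/-- The bilinear map induced by the composition of bisets. -/
def comp {P₁ : FinBiset K H → Prop} {P₂ : FinBiset H G → Prop} {P₃ : FinBiset K G → Prop}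
    (hP : ∀ X Y, P₁ X → P₂ Y → P₃ (X.tensor Y)) :
    Groth R P₁ →ₗ[R] Groth R P₂ →ₗ[R] Groth R P₃ :=
  lift (fun X hX => lift (fun Y hY => mk R (X.tensor Y) (hP X Y hX hY))
      (fun Y Y' Z hY hY' hZ e => mk_sum R _ _ _ (X.tensorSum e)))
    (fun X X' Z hX hX' hZ e => hom_ext fun Y hY => by
      rw [LinearMap.add_apply, lift_mk, lift_mk, lift_mk]
      exact mk_sum R _ _ _ (FinBiset.sumTensor e Y))

theorem comp_mk {P₁ : FinBiset K H → Prop} {P₂ : FinBiset H G → Prop} {P₃ : FinBiset K G → Prop}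
    (hP : ∀ X Y, P₁ X → P₂ Y → P₃ (X.tensor Y)) (X Y) (hX : P₁ X) (hY : P₂ Y) :
    comp (R := R) hP (mk R X hX) (mk R Y hY) = mk R (X.tensor Y) (hP X Y hX hY) := by
  rw [comp, lift_mk, lift_mk]

theorem comp_assoc {P₁ : FinBiset F K → Prop} {P₂ : FinBiset K H → Prop} {P₃ : FinBiset H G → Prop}
    {P₁₂ : FinBiset F H → Prop} {P₂₃ : FinBiset K G → Prop} {Q : FinBiset F G → Prop}
    (h₁₂ : ∀ X Y, P₁ X → P₂ Y → P₁₂ (X.tensor Y)) (h₂₃ : ∀ X Y, P₂ X → P₃ Y → P₂₃ (X.tensor Y))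
    (h : ∀ X Y, P₁₂ X → P₃ Y → Q (X.tensor Y)) (h' : ∀ X Y, P₁ X → P₂₃ Y → Q (X.tensor Y))
    (h0 : Q (FinBiset.empty F G)) (a : Groth R P₁) (b : Groth R P₂) (c : Groth R P₃) :
    comp h (comp h₁₂ a b) c = comp h' a (comp h₂₃ b c) := by
  induction a using induction with
  | h0 => simp
  | hadd x y hx hy => simp only [map_add, LinearMap.add_apply, hx, hy]
  | hsmul r x hx => simp only [map_smul, LinearMap.smul_apply, hx]
  | hmk X hX =>
    induction b using induction with
    | h0 => simp
    | hadd x y hx hy => simp only [map_add, LinearMap.add_apply, hx, hy]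
    | hsmul r x hx => simp only [map_smul, LinearMap.smul_apply, hx]
    | hmk Y hY =>
      induction c using induction with
      | h0 => simp
      | hadd x y hx hy => simp only [map_add, hx, hy]
      | hsmul r x hx => simp only [map_smul, hx]
      | hmk Z hZ =>
        simp only [comp_mk]
        exact mk_iso h0 _ _ (FinBiset.tensorAssoc X Y Z)

theorem refl_comp [Finite H] {P₁ : FinBiset H H → Prop} {P₂ : FinBiset H G → Prop}
    (hP : ∀ X Y, P₁ X → P₂ Y → P₂ (X.tensor Y)) (h0 : P₂ (FinBiset.empty H G))
    (h1 : P₁ (FinBiset.refl H)) (a : Groth R P₂) :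
    comp hP (mk R (FinBiset.refl H) h1) a = a := by
  induction a using induction with
  | h0 => simp
  | hadd x y hx hy => rw [map_add, hx, hy]
  | hsmul r x hx => rw [map_smul, hx]
  | hmk Y hY =>
    rw [comp_mk]
    exact mk_iso h0 _ _ (FinBiset.reflTensor Y)

theorem comp_refl [Finite H] {P₁ : FinBiset K H → Prop} {P₂ : FinBiset H H → Prop}
    (hP : ∀ X Y, P₁ X → P₂ Y → P₁ (X.tensor Y)) (h0 : P₁ (FinBiset.empty K H))
    (h1 : P₂ (FinBiset.refl H)) (a : Groth R P₁) :
    comp hP a (mk R (FinBiset.refl H) h1) = a := by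
  induction a using induction with
  | h0 => simp
  | hadd x y hx hy => rw [map_add, LinearMap.add_apply, hx, hy]
  | hsmul r x hx => rw [map_smul, LinearMap.smul_apply, hx]
  | hmk X hX =>
    rw [comp_mk]
    exact mk_iso h0 _ _ (FinBiset.tensorRefl X)

end Groth

end Groth

/-! ### The category of `p`-bifree bisets -/

/-- `R B^Δ(H, G)`: the Grothendieck group of `p`-bifree `(H, G)`-bisets, over `R`. -/
abbrev BDelta (p : ℕ) (R : Type u) [CommRing R] (H G : Type v) [Group H] [Group G] :
    Type (max u (v + 1)) :=
  Groth R (fun X : FinBiset H G => X.IsBifree p)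

theorem isBifree_empty (p : ℕ) (H G : Type v) [Group H] [Group G] :
    (FinBiset.empty H G).IsBifree p := fun x => PEmpty.elim x

/-- The product `B^Δ(K, H) × B^Δ(H, G) → B^Δ(K, G)` induced by the composition of bisets. -/
def BDelta.comp {p : ℕ} [Fact p.Prime] {R : Type u} [CommRing R] {K H G : Type v}
    [Group K] [Group H] [Group G] [Finite K] [Finite G] :
    BDelta p R K H →ₗ[R] BDelta p R H G →ₗ[R] BDelta p R K G :=
  Groth.comp (fun _ _ => FinBiset.IsBifree.tensor)

/-- The objects of the category `R C^Δ`: finite groups. -/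
structure BifreeCat (p : ℕ) (R : Type u) : Type (v + 1) where
  grp : FiniteGrp.{v}

section Category

variable (p : ℕ) [hp : Fact p.Prime] (R : Type u) [CommRing R]

/-- The category `R C^Δ`: `Hom(G, H) = R B^Δ(H, G)`, the composite of `f : G ⟶ H` and
`g : H ⟶ K` is `g ·_H f`, and the identity of `G` is the class of the biset `G`. -/
instance bifreeCategory : Category (BifreeCat.{u, v} p R) where
  Hom G H := BDelta p R H.grp G.grp
  id G := Groth.mk R (FinBiset.refl G.grp) FinBiset.isBifree_refl
  comp f g := BDelta.comp g f
  id_comp f := Groth.comp_refl _ (isBifree_empty _ _ _) _ f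
  comp_id f := Groth.refl_comp _ (isBifree_empty _ _ _) _ f
  assoc f g h := (Groth.comp_assoc _ _ _ _ (isBifree_empty _ _ _) h g f).symm

instance : Preadditive (BifreeCat.{u, v} p R) where
  homGroup G H := inferInstanceAs (AddCommGroup (BDelta p R H.grp G.grp))
  add_comp _ _ _ f f' g := (BDelta.comp g).map_add f f'
  comp_add _ _ _ f g g' := BDelta.comp.map_add₂ g g' f

instance : Linear R (BifreeCat.{u, v} p R) where
  homModule G H := inferInstanceAs (Module R (BDelta p R H.grp G.grp))
  smul_comp _ _ _ r f g := (BDelta.comp g).map_smul r f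
  comp_smul _ _ _ f r g := BDelta.comp.map_smul₂ r g f

variable {p R}

/-- The object of `R C^Δ` given by a finite group. -/
def BifreeCat.of (G : FiniteGrp.{v}) : BifreeCat.{u, v} p R := ⟨G⟩

/-- The endomorphism `[Iso(θ)]` of `G` given by an automorphism `θ` of the group `G`. -/
def BifreeCat.isoAut {G : BifreeCat.{u, v} p R} (θ : MulAut G.grp) : G ⟶ G :=
  Groth.mk R (FinBiset.ofAut θ) (FinBiset.isBifree_ofAut θ)

/-- The ideal `I_G` of `End(G)` spanned by the endomorphisms that factor through a group of
smaller order. -/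
def BifreeCat.smallIdeal (G : BifreeCat.{u, v} p R) : Submodule R (G ⟶ G) :=
  Submodule.span R {f | ∃ (H : BifreeCat.{u, v} p R) (a : G ⟶ H) (b : H ⟶ G),
    Nat.card H.grp < Nat.card G.grp ∧ f = a ≫ b}

end Category

/-! ### Subfunctors, quotients, simple functors, composition factors

A `p`-bifree biset functor over `R` is an `R`-linear functor from `R C^Δ` to `R`-modules, that is,
`F : BifreeCat p R ⥤ ModuleCat R` with `F.Linear R`. -/

section Functors

variable {p : ℕ} [hp : Fact p.Prime] {R : Type u} [CommRing R]

/-- A subfunctor: a family of submodules that is stable under the action of all morphisms. -/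
@[ext]
structure SubFun (F : BifreeCat.{u, v} p R ⥤ ModuleCat.{w} R) where
  obj : ∀ G, Submodule R (F.obj G)
  map_mem : ∀ {G H} (f : G ⟶ H) (x : F.obj G), x ∈ obj G → (F.map f).hom x ∈ obj H

namespace SubFun

variable {F : BifreeCat.{u, v} p R ⥤ ModuleCat.{w} R}

instance : LE (SubFun F) := ⟨fun A B => A.obj ≤ B.obj⟩
instance : LT (SubFun F) := ⟨fun A B => A.obj < B.obj⟩
instance : Top (SubFun F) := ⟨⟨fun _ => ⊤, fun _ _ _ => trivial⟩⟩
instance : Bot (SubFun F) := ⟨⟨fun _ => ⊥, fun f x hx => by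
  rw [Submodule.mem_bot] at hx ⊢; rw [hx, map_zero]⟩⟩
instance : Min (SubFun F) := ⟨fun A B => ⟨fun G => A.obj G ⊓ B.obj G, fun f x hx =>
  ⟨A.map_mem f x hx.1, B.map_mem f x hx.2⟩⟩⟩
instance : Max (SubFun F) := ⟨fun A B => ⟨fun G => A.obj G ⊔ B.obj G, fun {G H} f x hx => by
  have h : A.obj G ⊔ B.obj G ≤ (A.obj H ⊔ B.obj H).comap (F.map f).hom :=
    sup_le (fun y hy => Submodule.mem_sup_left (A.map_mem f y hy))
      (fun y hy => Submodule.mem_sup_right (B.map_mem f y hy))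
  exact h hx⟩⟩
instance : InfSet (SubFun F) := ⟨fun s => ⟨fun G => ⨅ A ∈ s, A.obj G, fun f x hx => by
  simp only [Submodule.mem_iInf] at hx ⊢
  exact fun A hA => A.map_mem f x (hx A hA)⟩⟩
instance : SupSet (SubFun F) := ⟨fun s => ⟨fun G => ⨆ A ∈ s, A.obj G, fun {G H} f x hx => by
  have h : (⨆ A ∈ s, A.obj G) ≤ (⨆ A ∈ s, A.obj H).comap (F.map f).hom :=
    iSup₂_le fun A hA y hy => Submodule.mem_iSup_of_mem A
      (Submodule.mem_iSup_of_mem hA (A.map_mem f y hy))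
  exact h hx⟩⟩

/-- Subfunctors of `F` ordered by inclusion; suprema are sums and infima are intersections,
computed group by group. -/
instance : CompleteLattice (SubFun F) :=
  Function.Injective.completeLattice SubFun.obj (fun _ _ h => SubFun.ext h) Iff.rfl Iff.rfl
    (fun _ _ => rfl) (fun _ _ => rfl)
    (fun s => by funext G; simp only [iSup_apply]; rfl)
    (fun s => by funext G; simp only [iInf_apply]; rfl) rfl rfl

/-- The subfunctor generated by an element `x` of `F(G)`. -/
def generate (G : BifreeCat.{u, v} p R) (x : F.obj G) : SubFun F := sInf {A | x ∈ A.obj G}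

/-- A subfunctor as a functor. -/
@[simps]
def toFunctor (A : SubFun F) : BifreeCat.{u, v} p R ⥤ ModuleCat.{w} R where
  obj G := ModuleCat.of R (A.obj G)
  map f := ModuleCat.ofHom ((F.map f).hom.restrict (A.map_mem f))
  map_id G := by ext x; simp
  map_comp f g := by ext x; simp

/-- The quotient functor `F / A`. -/
@[simps]
def quotient (A : SubFun F) : BifreeCat.{u, v} p R ⥤ ModuleCat.{w} R where
  obj G := ModuleCat.of R (F.obj G ⧸ A.obj G)
  map {G H} f := ModuleCat.ofHom ((A.obj G).mapQ (A.obj H) (F.map f).hom (A.map_mem f))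
  map_id G := by ext x; simp
  map_comp f g := by ext x; simp

instance (A : SubFun F) [F.Additive] : A.toFunctor.Additive where
  map_add {_ _ f g} := by
    refine ModuleCat.hom_ext (LinearMap.ext fun x => Subtype.ext ?_)
    exact congrArg (fun l => l.hom x.1) (F.map_add (f := f) (g := g))

instance (A : SubFun F) [F.Linear R] : A.toFunctor.Linear R where
  map_smul f r := by
    refine ModuleCat.hom_ext (LinearMap.ext fun x => Subtype.ext ?_)
    exact congrArg (fun l => l.hom x.1) (F.map_smul r f)

instance (A : SubFun F) [F.Additive] : A.quotient.Additive where
  map_add {G H f g} := by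
    refine ModuleCat.hom_ext (Submodule.linearMap_qext _ (LinearMap.ext fun x => ?_))
    exact congrArg (fun l => (A.obj H).mkQ (l.hom x)) (F.map_add (f := f) (g := g))

instance (A : SubFun F) [F.Linear R] : A.quotient.Linear R where
  map_smul {G H} f r := by
    refine ModuleCat.hom_ext (Submodule.linearMap_qext _ (LinearMap.ext fun x => ?_))
    exact congrArg (fun l => (A.obj H).mkQ (l.hom x)) (F.map_smul r f)

/-- `A ∩ B` as a subfunctor of `B`. -/
def restrict (A B : SubFun F) : SubFun B.toFunctor where
  obj G := (A.obj G).comap (B.obj G).subtype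
  map_mem f x hx := A.map_mem f x.1 hx

/-- The subquotient `B / A` of `F`, for `A ≤ B`. -/
def subquotient (A B : SubFun F) : BifreeCat.{u, v} p R ⥤ ModuleCat.{w} R :=
  (A.restrict B).quotient

end SubFun

/-- A functor is simple if it is nonzero and has no subfunctors other than `0` and itself. -/
def IsSimpleFunctor (F : BifreeCat.{u, v} p R ⥤ ModuleCat.{w} R) : Prop :=
  IsSimpleOrder (SubFun F)

/-- `S` is a composition factor of `F` if `S` is simple and isomorphic to `B / A` for some
subfunctors `A ≤ B` of `F`. -/
def IsCompositionFactor (S F : BifreeCat.{u, v} p R ⥤ ModuleCat.{w} R) : Prop :=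
  IsSimpleFunctor S ∧ ∃ A B : SubFun F, A ≤ B ∧ Nonempty (A.subquotient B ≅ S)

end Functors

/-! ### The simple functors `S^Δ_{G,V}` -/

/-- The group `Inn(G)` of inner automorphisms. -/
def Inn (G : Type*) [Group G] : Subgroup (MulAut G) := (MulAut.conj : G →* MulAut G).range

instance innNormal (G : Type*) [Group G] : (Inn G).Normal := ⟨by
  rintro _ ⟨g, rfl⟩ θ
  exact ⟨θ g, by ext x; simp⟩⟩

/-- The group `Out(G) = Aut(G) / Inn(G)` of outer automorphisms. -/
abbrev Out (G : Type*) [Group G] : Type _ := MulAut G ⧸ Inn G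

section Simple

variable {p : ℕ} [hp : Fact p.Prime] {R : Type u} [CommRing R]
variable (G : BifreeCat.{u, v} p R) {V : Type u} [AddCommGroup V] [Module R V]

/-- The functor `H ↦ R B^Δ(H, G) ⊗_R V`. -/
def homTensor (V : Type u) [AddCommGroup V] [Module R V] :
    BifreeCat.{u, v} p R ⥤ ModuleCat.{max u (v + 1)} R where
  obj H := ModuleCat.of R ((G ⟶ H) ⊗[R] V)
  map f := ModuleCat.ofHom (LinearMap.rTensor V (Linear.rightComp R G f))
  map_id H := by
    refine ModuleCat.hom_ext (TensorProduct.ext' fun f v => ?_)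
    exact congrArg (· ⊗ₜ[R] v) (Category.comp_id f)
  map_comp g h := by
    refine ModuleCat.hom_ext (TensorProduct.ext' fun f v => ?_)
    exact congrArg (· ⊗ₜ[R] v) (Category.assoc f g h).symm

theorem homTensor_map_tmul {H H' : BifreeCat.{u, v} p R} (g : H ⟶ H') (f : G ⟶ H) (v : V) :
    ((homTensor G V).map g).hom (f ⊗ₜ[R] v) = (f ≫ g) ⊗ₜ[R] v := rfl

instance : (homTensor G V).Additive where
  map_add {H H' g h} := by
    refine ModuleCat.hom_ext (TensorProduct.ext' fun f v => ?_)
    exact (congrArg (· ⊗ₜ[R] v) (Preadditive.comp_add _ _ _ f g h)).trans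
      (TensorProduct.add_tmul _ _ v)

instance : (homTensor G V).Linear R where
  map_smul {H H'} g r := by
    refine ModuleCat.hom_ext (TensorProduct.ext' fun f v => ?_)
    exact congrArg (· ⊗ₜ[R] v) (Linear.comp_smul _ _ _ f r g)

/-- The relations that define `R B^Δ(H, G) ⊗_{E_G} V` as a quotient of `R B^Δ(H, G) ⊗_R V`. Here
`E_G = End(G)` is spanned by the `[Iso(θ)]` and by `I_G`, and it acts on the `R Out(G)`-module `V`
through `E_G / I_G ≅ R Out(G)`: `[Iso(θ)]` acts as the class of `θ`, and `I_G` acts as `0`. -/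
def tensorRel (ρ : Representation R (Out G.grp) V) : SubFun (homTensor G V) where
  obj H := Submodule.span R
    ({t | ∃ (f : G ⟶ H) (θ : MulAut G.grp) (v : V),
        t = (BifreeCat.isoAut θ ≫ f) ⊗ₜ[R] v - f ⊗ₜ[R] ρ (QuotientGroup.mk θ) v} ∪
      {t | ∃ (f : G ⟶ H) (a : G ⟶ G) (v : V), a ∈ G.smallIdeal ∧ t = (a ≫ f) ⊗ₜ[R] v})
  map_mem {H H'} g x hx := by
    refine Submodule.mem_comap.1 (Submodule.span_le.2 ?_ hx)
    rintro _ (⟨f, θ, v, rfl⟩ | ⟨f, a, v, ha, rfl⟩)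
    · refine Submodule.subset_span (Or.inl ⟨f ≫ g, θ, v, ?_⟩)
      refine (map_sub ((homTensor G V).map g).hom _ _).trans ?_
      rw [homTensor_map_tmul, homTensor_map_tmul, Category.assoc]
      rfl
    · refine Submodule.subset_span (Or.inr ⟨f ≫ g, a, v, ha, ?_⟩)
      exact (homTensor_map_tmul G g (a ≫ f) v).trans (by rw [Category.assoc])

/-- The functor `L_{G,V}`, `H ↦ R B^Δ(H, G) ⊗_{E_G} V`. -/
def functorL (ρ : Representation R (Out G.grp) V) :
    BifreeCat.{u, v} p R ⥤ ModuleCat.{max u (v + 1)} R :=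
  (tensorRel G ρ).quotient

/-- The subfunctor `J_{G,V}` of `L_{G,V}`: the elements of `L_{G,V}(H)` that are killed by all
morphisms from `H` to `G`. (The module `L_{G,V}(G) = E_G ⊗_{E_G} V` is `V`.) -/
def functorJ (ρ : Representation R (Out G.grp) V) : SubFun (functorL G ρ) where
  obj H := ⨅ y : H ⟶ G, LinearMap.ker ((functorL G ρ).map y).hom
  map_mem f x hx := by
    simp only [Submodule.mem_iInf, LinearMap.mem_ker] at hx ⊢
    intro y
    have := hx (f ≫ y)
    rwa [Functor.map_comp, ModuleCat.hom_comp, LinearMap.comp_apply] at this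

/-- The functor `S^Δ_{G,V} = L_{G,V} / J_{G,V}`, for an `R Out(G)`-module `V`. -/
def functorS (ρ : Representation R (Out G.grp) V) :
    BifreeCat.{u, v} p R ⥤ ModuleCat.{max u (v + 1)} R :=
  (functorJ G ρ).quotient

instance (ρ : Representation R (Out G.grp) V) : (functorL G ρ).Additive :=
  inferInstanceAs (tensorRel G ρ).quotient.Additive

instance (ρ : Representation R (Out G.grp) V) : (functorL G ρ).Linear R :=
  inferInstanceAs ((tensorRel G ρ).quotient.Linear R)

instance (ρ : Representation R (Out G.grp) V) : (functorS G ρ).Additive :=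
  inferInstanceAs (functorJ G ρ).quotient.Additive

instance (ρ : Representation R (Out G.grp) V) : (functorS G ρ).Linear R :=
  inferInstanceAs ((functorJ G ρ).quotient.Linear R)

/-- The functor `S^Δ_{G,R}`, for the trivial module `R` of `Out(G)`. -/
def functorSTriv : BifreeCat.{u, v} p R ⥤ ModuleCat.{max u (v + 1)} R :=
  functorS G (Representation.trivial R (Out G.grp) R)

end Simple

/-! ### The Burnside functor -/

section Burnside

/-- A finite `G`-set as a `(G, 1)`-biset. -/
def FinBiset.ofGSet (G : Type v) [Group G] (X : Type v) [Finite X] [MulAction G X] :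
    FinBiset G PUnit.{v + 1} where
  carrier := X
  right := { smul := fun _ x => x, one_smul := fun _ => rfl, mul_smul := fun _ _ _ => rfl }
  comm :=
    letI : MulAction PUnit.{v + 1}ᵐᵒᵖ X :=
      { smul := fun _ x => x, one_smul := fun _ => rfl, mul_smul := fun _ _ _ => rfl }
    @SMulCommClass.mk _ _ _ _ _ (fun _ _ _ => rfl)

/-- The Burnside group `R B(G) = R ⊗ B(G)`: the Grothendieck group of all finite `G`-sets, that is,
of all finite `(G, 1)`-bisets, over `R`. -/
abbrev Burn (R : Type u) [CommRing R] (G : Type v) [Group G] : Type (max u (v + 1)) :=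
  Groth R (fun _ : FinBiset G PUnit.{v + 1} => True)

/-- The action `B^Δ(H, G) × B(G) → B(H)`, `(X, U) ↦ X ×_G U`. -/
def Burn.act {p : ℕ} {R : Type u} [CommRing R] {H G : Type v} [Group H] [Group G] :
    BDelta p R H G →ₗ[R] Burn R G →ₗ[R] Burn R H :=
  Groth.comp (fun _ _ _ _ => trivial)

theorem Burn.act_refl {p : ℕ} [Fact p.Prime] {R : Type u} [CommRing R] {G : Type v} [Group G]
    [Finite G] (x : Burn R G) :
    Burn.act (Groth.mk R (FinBiset.refl G) (FinBiset.isBifree_refl (p := p))) x = x :=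
  Groth.refl_comp _ trivial _ x

theorem Burn.act_act {p : ℕ} [Fact p.Prime] {R : Type u} [CommRing R] {K H G : Type v} [Group K]
    [Group H] [Group G] [Finite K] [Finite G] (a : BDelta p R K H) (b : BDelta p R H G)
    (x : Burn R G) : Burn.act (BDelta.comp a b) x = Burn.act a (Burn.act b x) :=
  Groth.comp_assoc _ _ _ _ trivial a b x

variable (p : ℕ) [hp : Fact p.Prime] (R : Type u) [CommRing R]

/-- The Burnside functor `R B` as a `p`-bifree biset functor: a `p`-bifree `(H, G)`-biset `X` sends
a `G`-set `U` to the `H`-set `X ×_G U`. -/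
def burnside : BifreeCat.{u, v} p R ⥤ ModuleCat.{max u (v + 1)} R where
  obj G := ModuleCat.of R (Burn R G.grp)
  map f := ModuleCat.ofHom (Burn.act f)
  map_id G := by
    refine ModuleCat.hom_ext (LinearMap.ext fun x => ?_)
    exact Burn.act_refl x
  map_comp f g := by
    refine ModuleCat.hom_ext (LinearMap.ext fun x => ?_)
    exact Burn.act_act g f x

instance : (burnside.{u, v} p R).Additive where
  map_add {_ _ f g} := ModuleCat.hom_ext (Burn.act.map_add f g)

instance : (burnside.{u, v} p R).Linear R where
  map_smul f r := ModuleCat.hom_ext (Burn.act.map_smul r f)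

end Burnside

/-! ### Möbius function, deflation numbers, `B^Δ_p`-groups -/

section BGroups

open Classical in
/-- The value `μ(X, G)` of the Möbius function of the poset of subgroups of `G`. -/
def moebiusTop {G : Type*} [Group G] [Finite G] (X : Subgroup G) : ℤ :=
  letI : Fintype (Subgroup G) := Fintype.ofFinite _
  letI : LocallyFiniteOrder (Subgroup G) := Fintype.toLocallyFiniteOrder
  IncidenceAlgebra.mu ℤ X ⊤

open Classical in
/-- The deflation number `m_{G,N} = |G|⁻¹ ∑_{X N = G} |X| μ(X, G)`, the sum over the subgroups `X`
of `G` with `X N = G`. -/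
def deflationNumber {G : Type*} [Group G] [Finite G] (N : Subgroup G) : ℚ :=
  letI : Fintype (Subgroup G) := Fintype.ofFinite _
  (Nat.card G : ℚ)⁻¹ *
    ∑ X ∈ {X : Subgroup G | (X : Set G) * (N : Set G) = Set.univ}.toFinset,
      (Nat.card X : ℚ) * moebiusTop X

/-- `G` is a `B^Δ_p`-group if `m_{G,N} = 0` for every nontrivial normal `p'`-subgroup `N`. -/
def IsBGroup (p : ℕ) (G : Type*) [Group G] [Finite G] : Prop :=
  ∀ N : Subgroup G, N.Normal → N ≠ ⊥ → IsPPrimeGroup p N → deflationNumber N = 0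

/-- `G ≫ H`: the group `H` is isomorphic to the quotient of `G` by a normal `p'`-subgroup. -/
def Dominates (p : ℕ) (G H : Type*) [Group G] [Group H] : Prop :=
  ∃ (N : Subgroup G) (_ : N.Normal), IsPPrimeGroup p N ∧ Nonempty (G ⧸ N ≃* H)

/-- Finite `B^Δ_p`-groups. -/
def BGroup (p : ℕ) : Type (v + 1) := {G : FiniteGrp.{v} // IsBGroup p G}

instance isoSetoid (p : ℕ) : Setoid (BGroup.{v} p) where
  r G H := Nonempty (G.1 ≃* H.1)
  iseqv := ⟨fun _ => ⟨MulEquiv.refl _⟩, fun ⟨e⟩ => ⟨e.symm⟩, fun ⟨e⟩ ⟨f⟩ => ⟨e.trans f⟩⟩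

/-- The set `[B^Δ_p-gr]` of isomorphism classes of `B^Δ_p`-groups. -/
def BGroupClass (p : ℕ) : Type (v + 1) := Quotient (isoSetoid.{v} p)

/-- The isomorphism class of a `B^Δ_p`-group. -/
def BGroup.cls {p : ℕ} (G : BGroup.{v} p) : BGroupClass.{v} p := Quotient.mk _ G

/-- A set of isomorphism classes of `B^Δ_p`-groups is closed if it contains the class of `G`
whenever it contains the class of `H` and `G ≫ H`. -/
def IsClosedClass {p : ℕ} (A : Set (BGroupClass.{v} p)) : Prop :=
  ∀ G H : BGroup.{v} p, H.cls ∈ A → Dominates p G.1 H.1 → G.cls ∈ A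

end BGroups

/-! ### The idempotents `e^G_G` and the subfunctors they generate -/

section Idempotents

/-- The class `[G/X]` in `R B(G)`. -/
def Burn.coset (R : Type u) [CommRing R] {G : Type v} [Group G] [Finite G] (X : Subgroup G) :
    Burn R G :=
  Groth.mk R (FinBiset.ofGSet G (G ⧸ X)) trivial

/-- The mark at a subgroup `L`: the linear form on `R B(G)` that sends a `G`-set to the number of
its `L`-fixed points. -/
def Burn.mark (R : Type u) [CommRing R] {G : Type v} [Group G] (L : Subgroup G) :
    Burn R G →ₗ[R] R :=
  Groth.lift (fun X _ => (Nat.card {x : X // ∀ l ∈ L, l • x = x} : R)) (by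
    intro X Y Z _ _ _ e
    rw [← Nat.cast_add, ← Nat.card_sum]
    congr 1
    refine Nat.card_congr ((Equiv.subtypeEquiv (q := fun z : X.sum Y => ∀ l ∈ L, l • z = z)
      e.toEquiv ?_).trans ((Equiv.subtypeSum).trans (Equiv.sumCongr ?_ ?_)))
    · intro z
      refine forall₂_congr fun l _ => ?_
      rw [← e.map_left, e.toEquiv.apply_eq_iff_eq]
    · exact Equiv.subtypeEquivRight fun x => forall₂_congr fun l _ => Sum.inl_injective.eq_iff
    · exact Equiv.subtypeEquivRight fun x => forall₂_congr fun l _ => Sum.inr_injective.eq_iff)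

variable (K : Type u) [Field K]

/-- The primitive idempotent `e^G_G` of `K B(G)`, by Gluck's formula
`e^G_G = |G|⁻¹ ∑_{X ≤ G} |X| μ(X, G) [G/X]`. See `mark_idem`. -/
def Burn.idem (G : Type v) [Group G] [Finite G] : Burn K G :=
  letI : Fintype (Subgroup G) := Fintype.ofFinite _
  (Nat.card G : K)⁻¹ • ∑ X : Subgroup G, ((Nat.card X : K) * (moebiusTop X : K)) • Burn.coset K X

theorem card_mul_fixed {G : Type v} [Group G] [Finite G] (X L : Subgroup G) :
    Nat.card X * Nat.card {x : G ⧸ X // ∀ l ∈ L, l • x = x} =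
      Nat.card {g : G // L.map (MulAut.conj g⁻¹).toMonoidHom ≤ X} := by
  have := QuotientGroup.card_preimage_mk X {x : G ⧸ X | ∀ l ∈ L, l • x = x}
  refine this.symm.trans (Nat.card_congr (Equiv.subtypeEquivRight fun g => ?_))
  rw [Subgroup.map_le_iff_le_comap]
  change (∀ l ∈ L, l • (g : G ⧸ X) = g) ↔ ∀ l ∈ L, MulAut.conj g⁻¹ l ∈ X
  refine forall₂_congr fun l hl => ?_
  rw [MulAction.Quotient.smul_mk, eq_comm, QuotientGroup.eq]
  simp [mul_assoc]

theorem sum_moebiusTop {G : Type v} [Group G] [Finite G] [Fintype (Subgroup G)]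
    [DecidableEq (Subgroup G)] [DecidableLE (Subgroup G)] (L : Subgroup G) :
    ∑ X : Subgroup G, (if L ≤ X then moebiusTop X else 0) = if L = ⊤ then 1 else 0 := by
  classical
  let : LocallyFiniteOrder (Subgroup G) := Fintype.toLocallyFiniteOrder
  rw [← IncidenceAlgebra.sum_Icc_mu_left (𝕜 := ℤ) L ⊤, ← Finset.sum_filter]
  refine Finset.sum_congr ?_ fun X _ => ?_
  · ext X
    simp
  · unfold moebiusTop
    congr!

/-- The marks of `e^G_G` are `1` at `G` and `0` at every proper subgroup. -/
theorem mark_idem [CharZero K] (G : Type v) [Group G] [Finite G] (L : Subgroup G) [Decidable (L = ⊤)] :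
    Burn.mark K L (Burn.idem K G) = if L = ⊤ then 1 else 0 := by
  classical
  let : Fintype (Subgroup G) := Fintype.ofFinite _
  let : Fintype G := Fintype.ofFinite _
  have hG : (Nat.card G : K) ≠ 0 := Nat.cast_ne_zero.2 Nat.card_pos.ne'
  have hmark : ∀ X : Subgroup G, Burn.mark K L (Burn.coset K X) =
      (Nat.card {x : G ⧸ X // ∀ l ∈ L, l • x = x} : K) := fun X => Groth.lift_mk _ _ _ _
  have h1 : ∀ X : Subgroup G, (Nat.card X : K) * (moebiusTop X : K) *
      (Nat.card {x : G ⧸ X // ∀ l ∈ L, l • x = x} : K) =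
      ∑ g : G, (((if L.map (MulAut.conj g⁻¹).toMonoidHom ≤ X then moebiusTop X else 0 : ℤ)) : K) := by
    intro X
    rw [mul_right_comm, ← Nat.cast_mul, card_mul_fixed, Nat.card_eq_fintype_card,
      Fintype.card_subtype, ← Int.cast_sum, ← Finset.sum_filter, Finset.sum_const, nsmul_eq_mul]
    push_cast
    rfl
  have h2 : ∀ g : G, L.map (MulAut.conj g⁻¹).toMonoidHom = ⊤ ↔ L = ⊤ := by
    intro g
    rw [← (Subgroup.map_injective (f := (MulAut.conj g⁻¹).toMonoidHom)
      (MulAut.conj g⁻¹).injective).eq_iff (a := L) (b := ⊤),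
      Subgroup.map_top_of_surjective _ (MulAut.conj g⁻¹).surjective]
  unfold Burn.idem
  rw [map_smul, map_sum]
  simp only [map_smul, hmark, smul_eq_mul, h1]
  rw [Finset.sum_comm]
  simp only [← Int.cast_sum, sum_moebiusTop, h2]
  by_cases hL : L = ⊤ <;> simp [hL]

variable (p : ℕ) [hp : Fact p.Prime]

/-- The subfunctor `e^Δ_G` of `K B` generated by `e^G_G ∈ K B(G)`. -/
def eSub (G : FiniteGrp.{v}) : SubFun (burnside.{u, v} p K) :=
  SubFun.generate (BifreeCat.of G) (Burn.idem K G : Burn K G)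

/-- The subfunctor `j_G`: the sum of the `e^Δ_H` over the `B^Δ_p`-groups `H` with `H ≫ G` and
`H ≇ G`. -/
def jSub (G : FiniteGrp.{v}) : SubFun (burnside.{u, v} p K) :=
  ⨆ (H : BGroup.{v} p) (_ : Dominates p H.1 G) (_ : ¬ Nonempty (H.1 ≃* G)), eSub K p H.1

end Idempotents

end BifreeBiset

end

open BifreeBiset

/-!
Marks separate the elements of `K B(G)`. A homomorphism `φ : H → G` whose kernel is a `p'`-group
yields a morphism from `G` to `H` that sends `x` to `mark_{im φ}(x) • e_H`, where `e_H = e^H_H`, so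
a subfunctor is determined by the groups `G` with `e_G ∈ F(G)`, and every `e^Δ_G` is join-prime:
`e^Δ_G ≤ ⨆ F_i` implies `e^Δ_G ≤ F_i` for some `i`.

Conversely, the mark at `G` of `X ×_H e_H` is a sum of deflation numbers `m_{H,N}` of the right
stabilizers `N` of the points of `X` that link `G` to `H`. If `H` is a `B^Δ_p`-group, it therefore
vanishes unless `G ≫ H`, whereas `m_{G,N} ≠ 0` implies `e^Δ_{G/N} = e^Δ_G`, so that every `e^Δ_G`
comes from a `B^Δ_p`-group. Thus the lattice of subfunctors is the lattice of closed sets.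

Modulo the morphisms that factor through smaller groups, `End(G)` is spanned by the automorphisms of
`G`. Hence a simple functor with a nonzero vector at `G` that is fixed by the automorphisms and
killed by the morphisms to smaller groups is isomorphic to `S^Δ_{G,K}`, and the class of `e_G` in
`e^Δ_G / j_G` is such a vector.
-/

noncomputable section

namespace BifreeBiset

/-! ### Orbits of bisets -/

namespace FinBiset

variable {H G : Type v} [Group H] [Group G]

/-- The inverse of an isomorphism of bisets. -/
def Iso.symm {X Y : FinBiset H G} (e : Iso X Y) : Iso Y X where
  toEquiv := e.toEquiv.symm
  map_left h y := by rw [Equiv.symm_apply_eq, e.map_left, Equiv.apply_symm_apply]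
  map_right g y := by rw [Equiv.symm_apply_eq, e.map_right, Equiv.apply_symm_apply]

theorem Iso.stabilizer_eq {X Y : FinBiset H G} (e : Iso X Y) (x : X) :
    MulAction.stabilizer H (e.toEquiv x) = MulAction.stabilizer H x := by
  ext h
  rw [MulAction.mem_stabilizer_iff, MulAction.mem_stabilizer_iff, ← e.map_left,
    e.toEquiv.apply_eq_iff_eq]

/-- The action of a group on a stable subset, as an action on the subtype. -/
abbrev restrictAction {A X : Type*} [Group A] [MulAction A X] (S : Set X)
    (h : ∀ a : A, ∀ x ∈ S, a • x ∈ S) : MulAction A S :=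
  inferInstanceAs (MulAction A (⟨S, fun a _ => h a _⟩ : SubMulAction A X))

/-- The sub-biset carried by a subset that is stable on both sides. -/
def sub (X : FinBiset H G) (S : Set X) (hl : ∀ (h : H), ∀ x ∈ S, h • x ∈ S)
    (hr : ∀ (g : Gᵐᵒᵖ), ∀ x ∈ S, g • x ∈ S) : FinBiset H G where
  carrier := S
  left := restrictAction S hl
  right := restrictAction S hr
  comm := @SMulCommClass.mk _ _ _ (restrictAction S hl).toSMul (restrictAction S hr).toSMul
    fun h g x => Subtype.ext (smul_comm h g x.1)

theorem smul_mem_compl {A X : Type*} [Group A] [MulAction A X] {S : Set X}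
    (h : ∀ a : A, ∀ x ∈ S, a • x ∈ S) (a : A) (x : X) (hx : x ∈ Sᶜ) : a • x ∈ Sᶜ :=
  fun hax => hx (by simpa using h a⁻¹ _ hax)

open Classical in
/-- A biset is the disjoint union of a stable subset and its complement. -/
def isoSumSubCompl (X : FinBiset H G) (S : Set X) (hl : ∀ (h : H), ∀ x ∈ S, h • x ∈ S)
    (hr : ∀ (g : Gᵐᵒᵖ), ∀ x ∈ S, g • x ∈ S) :
    Iso X ((X.sub S hl hr).sum (X.sub Sᶜ (smul_mem_compl hl) (smul_mem_compl hr))) :=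
  Iso.symm
    { toEquiv := Equiv.Set.sumCompl S
      map_left := by rintro h (z | z) <;> rfl
      map_right := by rintro g (z | z) <;> rfl }

/-- The biset `X` is transitive: it is the two-sided orbit of its point `x`. -/
def IsOrbitOf (X : FinBiset H G) (x : X) : Prop := ∀ y : X, ∃ (h : H) (g : G), y = h • op g • x

theorem orbit_induction {C : FinBiset H G → Prop}
    (empty : ∀ X : FinBiset H G, IsEmpty X → C X)
    (sum : ∀ X Y Z : FinBiset H G, Iso Z (X.sum Y) → C X → C Y → C Z)
    (orbit : ∀ (X : FinBiset H G) (x : X), X.IsOrbitOf x → C X) (X : FinBiset H G) : C X := by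
  induction hn : Nat.card X using Nat.strong_induction_on generalizing X with
  | _ n ih =>
    rcases isEmpty_or_nonempty X with he | ⟨⟨x⟩⟩
    · exact empty X he
    let S : Set X := {y | ∃ (h : H) (g : G), y = h • op g • x}
    have hl : ∀ (h : H), ∀ y ∈ S, h • y ∈ S := by
      rintro h _ ⟨k, g, rfl⟩
      exact ⟨h * k, g, smul_smul _ _ _⟩
    have hr : ∀ (g : Gᵐᵒᵖ), ∀ y ∈ S, g • y ∈ S := by
      rintro g _ ⟨k, g', rfl⟩
      exact ⟨k, g' * g.unop, by rw [← smul_comm k g, smul_smul, op_mul, op_unop]⟩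
    have hxS : x ∈ S := ⟨1, 1, by simp⟩
    refine sum _ _ _ (X.isoSumSubCompl S hl hr) (orbit _ ⟨x, hxS⟩ ?_) (ih _ ?_ _ rfl)
    · rintro ⟨_, h, g, rfl⟩
      exact ⟨h, g, rfl⟩
    · rw [← hn]
      exact Set.ncard_lt_card (s := Sᶜ) fun h => (h ▸ Set.mem_univ x : x ∈ Sᶜ) hxS

end FinBiset

namespace Groth

variable {R : Type u} [CommRing R] {H G : Type v} [Group H] [Group G] {P : FinBiset H G → Prop}

theorem mk_eq_zero (X : FinBiset H G) (hX : P X) [IsEmpty X] : mk R X hX = 0 :=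
  left_eq_add.1 (mk_sum R hX hX hX
    ⟨(Equiv.sumEmpty X X).symm, fun _ x => isEmptyElim x, fun _ x => isEmptyElim x⟩)

theorem eq_top_of_orbits_mem
    (hP : ∀ X Y Z : FinBiset H G, FinBiset.Iso Z (X.sum Y) → P Z → P X ∧ P Y)
    {S : Submodule R (Groth R P)}
    (hS : ∀ (X : FinBiset H G) (x : X) (hX : P X), X.IsOrbitOf x → mk R X hX ∈ S) : S = ⊤ := by
  refine Submodule.eq_top_iff'.2 fun a => ?_
  induction a using induction with
  | h0 => exact S.zero_mem
  | hadd a b ha hb => exact S.add_mem ha hb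
  | hsmul r a ha => exact S.smul_mem r ha
  | hmk X hX =>
    induction X using FinBiset.orbit_induction with
    | empty X he => exact mk_eq_zero (R := R) X hX ▸ S.zero_mem
    | sum X Y Z e ihX ihY =>
      obtain ⟨hX', hY'⟩ := hP X Y Z e hX
      exact mk_sum R hX' hY' hX e ▸ S.add_mem (ihX hX') (ihY hY')
    | orbit X x hx => exact hS X x hX hx

end Groth

/-! ### Stabilizer sums on Burnside groups -/

open Classical in
theorem exists_moebius_inverse {α M : Type*} [Fintype α] [PartialOrder α] [AddCommGroup M]
    (f : α → M) : ∃ g : α → M, ∀ z, f z = ∑ x with x ≤ z, g x := by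
  let : LocallyFiniteOrder α := Fintype.toLocallyFiniteOrder
  refine ⟨fun x => ∑ y, IncidenceAlgebra.mu ℤ y x • f y, fun z => ?_⟩
  have sum_mu (y : α) : ∑ x with x ≤ z, IncidenceAlgebra.mu ℤ y x = if y = z then 1 else 0 := by
    rw [← IncidenceAlgebra.sum_Icc_mu_right y z]
    refine (Finset.sum_subset (fun x hx => by simp_all) fun x hxz hx => ?_).symm
    exact IncidenceAlgebra.apply_eq_zero_of_not_le (fun hyx => hx (by simp_all)) _
  rw [Finset.sum_comm]
  simp [← Finset.sum_smul, sum_mu]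

section StabSum

variable {R : Type u} [CommRing R] {G : Type v} [Group G]

theorem op_punit_smul {U : FinBiset G PUnit.{v + 1}} (a : PUnit.{v + 1}ᵐᵒᵖ) (u : U) : a • u = u :=
  one_smul PUnit.{v + 1}ᵐᵒᵖ u

/-- Isomorphisms of `G`-sets as isomorphisms of `(G, 1)`-bisets. -/
def FinBiset.isoOfLeft {X Y : FinBiset G PUnit.{v + 1}} (e : X ≃ Y)
    (h : ∀ (g : G) (x : X), e (g • x) = g • e x) : FinBiset.Iso X Y where
  toEquiv := e
  map_left := h
  map_right g x := by rw [op_punit_smul, op_punit_smul]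

theorem Burn.mark_mk (L : Subgroup G) (U : FinBiset G PUnit.{v + 1}) :
    Burn.mark R L (Groth.mk R U trivial) = (Nat.card {u : U // ∀ l ∈ L, l • u = u} : R) :=
  Groth.lift_mk _ _ _ _

variable {M : Type*} [AddCommGroup M] [Module R M]

variable (R) in
/-- The linear map on `R B(G)` that sends a `G`-set `U` to `∑ u, f (stabilizer of u)`. Marks are
the case where `f` is the indicator function of the subgroups that contain a given one. -/
def Burn.stabSum (f : Subgroup G → M) : Burn R G →ₗ[R] M :=
  Groth.lift (fun U _ => ∑ᶠ u : U, f (MulAction.stabilizer G u)) (by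
    intro X Y Z _ _ _ e
    have := Fintype.ofFinite X
    have := Fintype.ofFinite Y
    let : Fintype (X.sum Y) := inferInstanceAs (Fintype (X.carrier ⊕ Y.carrier))
    have := Fintype.ofFinite Z
    rw [finsum_eq_sum_of_fintype, finsum_eq_sum_of_fintype, finsum_eq_sum_of_fintype,
      Fintype.sum_equiv e.toEquiv (fun z => f (MulAction.stabilizer G z))
        (fun z => f (MulAction.stabilizer G z)) (fun z => by rw [e.stabilizer_eq])]
    refine (Fintype.sum_sum_type (fun z : X.carrier ⊕ Y.carrier =>
      f (MulAction.stabilizer G (α := X.sum Y) z))).trans ?_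
    congr 1 <;> refine Finset.sum_congr rfl fun x _ => congrArg f ?_ <;> ext g
    · exact Sum.inl_injective.eq_iff
    · exact Sum.inr_injective.eq_iff)

theorem Burn.stabSum_mk (f : Subgroup G → M) (U : FinBiset G PUnit.{v + 1}) [Fintype U] :
    Burn.stabSum R f (Groth.mk R U trivial) = ∑ u : U, f (MulAction.stabilizer G u) := by
  rw [Burn.stabSum, Groth.lift_mk, finsum_eq_sum_of_fintype]

open Classical in
theorem Burn.stabSum_eq_sum_mark [Fintype (Subgroup G)] {f g : Subgroup G → M}
    (hfg : ∀ Z, f Z = ∑ T with T ≤ Z, g T) (x : Burn R G) :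
    Burn.stabSum R f x = ∑ T, Burn.mark R T x • g T := by
  suffices Burn.stabSum R f = ∑ T, (Burn.mark R T).smulRight (g T) by simp [this]
  refine Groth.hom_ext fun U _ => ?_
  have := Fintype.ofFinite U
  have card_fixed (T : Subgroup G) : Nat.card {u : U // ∀ l ∈ T, l • u = u} =
      Finset.card {u : U | T ≤ MulAction.stabilizer G u} := by
    rw [Nat.card_eq_fintype_card, Fintype.card_subtype]
    rfl
  calc Burn.stabSum R f (Groth.mk R U trivial)
    _ = ∑ u : U, ∑ T with T ≤ MulAction.stabilizer G u, g T := by simp only [stabSum_mk, hfg]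
    _ = ∑ T, ∑ u : U with T ≤ MulAction.stabilizer G u, g T := by
      simp only [Finset.sum_filter]
      exact Finset.sum_comm
    _ = (∑ T, (Burn.mark R T).smulRight (g T)) (Groth.mk R U trivial) := by
      simp only [LinearMap.sum_apply, LinearMap.smulRight_apply, mark_mk, card_fixed,
        Nat.cast_smul_eq_nsmul, Finset.sum_const]

variable {K : Type u} [Field K] [CharZero K] [Module K M] [Finite G]

open Classical in
theorem Burn.stabSum_idem_eq_top [Fintype (Subgroup G)] {f g : Subgroup G → M}
    (hfg : ∀ Z, f Z = ∑ T with T ≤ Z, g T) : Burn.stabSum K f (Burn.idem K G) = g ⊤ := by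
  simp [Burn.stabSum_eq_sum_mark hfg, mark_idem]

theorem Burn.stabSum_idem [Fintype (Subgroup G)] (f : Subgroup G → M) :
    Burn.stabSum K f (Burn.idem K G) = ∑ S : Subgroup G, moebiusTop S • f S := by
  classical
  obtain ⟨g, hg⟩ := exists_moebius_inverse f
  have sum_moebius (T : Subgroup G) :
      ∑ S with T ≤ S, moebiusTop S = if T = ⊤ then 1 else 0 := by
    rw [Finset.sum_filter, sum_moebiusTop]
  symm
  calc ∑ S : Subgroup G, moebiusTop S • f S
    _ = ∑ S : Subgroup G, ∑ T with T ≤ S, moebiusTop S • g T := by simp only [hg, Finset.smul_sum]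
    _ = ∑ T, (∑ S with T ≤ S, moebiusTop S) • g T := by
      simp only [Finset.sum_smul, Finset.sum_filter, ite_smul, zero_smul]
      exact Finset.sum_comm
    _ = g ⊤ := by simp only [sum_moebius, ite_smul, one_smul, zero_smul, Finset.sum_ite_eq',
      Finset.mem_univ, if_true]
    _ = Burn.stabSum K f (Burn.idem K G) := (stabSum_idem_eq_top hg).symm

theorem Burn.stabSum_idem_eq_zero {f : Subgroup G → M} {Q : Subgroup G} (hQ : Q ≠ ⊤)
    (hf : ∀ S, f S = f (S ⊓ Q)) : Burn.stabSum K f (Burn.idem K G) = 0 := by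
  classical
  have := Fintype.ofFinite (Subgroup G)
  obtain ⟨g, hg⟩ := exists_moebius_inverse f
  have hgQ (Z : Subgroup G) : f Z = ∑ T with T ≤ Z, if T ≤ Q then g T else 0 := by
    rw [hf, hg, ← Finset.sum_filter, Finset.filter_filter]
    simp only [le_inf_iff]
  rw [stabSum_idem_eq_top hgQ, if_neg (by rwa [top_le_iff])]

end StabSum

/-! ### Bisets attached to group homomorphisms -/

section PPrime

variable {p : ℕ} {A B : Type*} [Group A] [Group B]

theorem IsPPrimeGroup.of_injective (hB : IsPPrimeGroup p B) (f : A →* B)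
    (hf : Function.Injective f) : IsPPrimeGroup p A :=
  fun h => hB (h.trans (Subgroup.card_dvd_of_injective f hf))

theorem IsPPrimeGroup.of_le {S T : Subgroup A} (hT : IsPPrimeGroup p T) (h : S ≤ T) :
    IsPPrimeGroup p S :=
  fun hS => hT (hS.trans (Subgroup.card_dvd_of_le h))

theorem IsPPrimeGroup.op {S : Subgroup A} (hS : IsPPrimeGroup p S) : IsPPrimeGroup p S.op := by
  rwa [IsPPrimeGroup, Nat.card_congr (Subgroup.equivOp S).symm]

theorem IsPPrimeGroup.unop {S : Subgroup Aᵐᵒᵖ} (hS : IsPPrimeGroup p S) :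
    IsPPrimeGroup p S.unop := by
  rwa [IsPPrimeGroup, Nat.card_congr (Subgroup.equivOp S.unop)]

theorem isPPrimeGroup_ker_of_injective [Fact p.Prime] {f : A →* B} (hf : Function.Injective f) :
    IsPPrimeGroup p f.ker :=
  FinBiset.isPPrimeGroup_of_eq_bot ((MonoidHom.ker_eq_bot_iff f).2 hf)

end PPrime

namespace FinBiset

variable {H G : Type v} [Group H] [Group G]

/-- For a homomorphism `φ : G → H`, the `(H, G)`-biset `H` with `h · x · g = h x φ(g)`. -/
def viaHom (φ : G →* H) [Finite H] : FinBiset H G :=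
  letI : MulAction Gᵐᵒᵖ H := MulAction.compHom H (MonoidHom.op φ)
  { carrier := H
    comm := @SMulCommClass.mk _ _ _ _ _ fun h g x => (mul_assoc h x (φ g.unop)).symm }

/-- For a homomorphism `φ : H → G` and an `H`-set `W`, the `(H, G)`-biset `W × G` with
`h · (w, g) · g' = (h w, φ(h) g g')`. -/
def twist [Finite G] (φ : H →* G) (W : FinBiset H PUnit.{v + 1}) : FinBiset H G :=
  letI : MulAction H G := MulAction.compHom G φ
  letI : MulAction Gᵐᵒᵖ (W × G) :=
    { smul := fun g a => (a.1, a.2 * g.unop)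
      one_smul := fun a => Prod.ext rfl (mul_one a.2)
      mul_smul := fun g k a => Prod.ext rfl (mul_assoc a.2 k.unop g.unop).symm }
  { carrier := W × G
    comm := @SMulCommClass.mk _ _ _ _ _ fun h g a =>
      Prod.ext rfl (mul_assoc (φ h) a.2 g.unop).symm }

/-- The `H`-set `W × U`, for an `H`-set `W` and a `G`-set `U` on which `H` acts through `φ`. -/
def prodRes (φ : H →* G) (W : FinBiset H PUnit.{v + 1}) (U : FinBiset G PUnit.{v + 1}) :
    FinBiset H PUnit.{v + 1} :=
  letI := MulAction.compHom U φ
  ofGSet H (W × U)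

/-- `(W × G) ×_G U ≅ W × U`. -/
def twistTensor [Finite G] (φ : H →* G) (W : FinBiset H PUnit.{v + 1})
    (U : FinBiset G PUnit.{v + 1}) : Iso ((twist φ W).tensor U) (prodRes φ W U) :=
  isoOfLeft
    { toFun := tlift (fun (a : W × G) u => ((a.1, a.2 • u) : W × U))
        (fun a g u => Prod.ext rfl (mul_smul (α := G) a.2 g u))
      invFun := fun b => tmk (X := twist φ W) ((b.1, 1) : W × G) b.2
      left_inv := by
        intro t
        obtain ⟨⟨w, g⟩, u, rfl⟩ := tmk_surj t
        refine (tmk_smul (X := twist φ W) ((w, 1) : W × G) g u).symm.trans ?_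
        exact congrArg (fun z : G => tmk (X := twist φ W) ((w, z) : W × G) u) (one_mul g)
      right_inv := fun b => Prod.ext rfl (one_smul G b.2) }
    (by
      intro h t
      obtain ⟨⟨w, g⟩, u, rfl⟩ := tmk_surj t
      exact Prod.ext rfl (mul_smul (α := G) (φ h) g u))

/-- The biset `twist φ W` is additive in `W`. -/
def twistSum [Finite G] (φ : H →* G) {W W' Z : FinBiset H PUnit.{v + 1}} (e : Iso Z (W.sum W')) :
    Iso (twist φ Z) ((twist φ W).sum (twist φ W')) where
  toEquiv := (e.toEquiv.prodCongr (Equiv.refl G)).trans (Equiv.sumProdDistrib W W' G)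
  map_left h := by
    rintro ⟨z, g⟩
    refine (congrArg (fun y => Equiv.sumProdDistrib W W' G (y, φ h * g)) (e.map_left h z)).trans ?_
    change _ = h • (show (twist φ W).sum (twist φ W') from
      Equiv.sumProdDistrib W W' G (e.toEquiv z, g))
    obtain ⟨w, hw⟩ | ⟨w, hw⟩ := sum_cases (e.toEquiv z) <;> rw [hw] <;> rfl
  map_right k := by
    rintro ⟨z, g⟩
    change Equiv.sumProdDistrib W W' G (e.toEquiv z, g * k) =
      op k • (show (twist φ W).sum (twist φ W') from Equiv.sumProdDistrib W W' G (e.toEquiv z, g))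
    obtain ⟨w, hw⟩ | ⟨w, hw⟩ := sum_cases (e.toEquiv z) <;> rw [hw] <;> rfl

variable {p : ℕ} [Fact p.Prime]

theorem isBifree_viaHom [Finite H] [Finite G] {φ : G →* H} (hφ : IsPPrimeGroup p φ.ker) :
    (viaHom φ).IsBifree p := by
  refine fun x => ⟨isPPrimeGroup_of_eq_bot (eq_bot_iff.2 fun h hh => ?_),
    hφ.op.of_le fun g hg => ?_⟩
  · exact (mul_eq_right (M := H)).1 hh
  · exact (mul_eq_left (M := H)).1 hg

theorem isBifree_twist [Finite H] [Finite G] {φ : H →* G} (hφ : IsPPrimeGroup p φ.ker)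
    (W : FinBiset H PUnit.{v + 1}) : (twist φ W).IsBifree p := by
  rintro ⟨w, g⟩
  refine ⟨hφ.of_le fun h hh => ?_, isPPrimeGroup_of_eq_bot (eq_bot_iff.2 fun k hk => ?_)⟩
  · exact mul_eq_right.1 (congrArg Prod.snd hh : φ h * g = g)
  · exact unop_injective (mul_eq_left.1 (congrArg Prod.snd hk : g * k.unop = g))

end FinBiset

/-- The linear map `R B(H) → R B^Δ(H, G)` with `[W] ↦ [twist φ W]`, for a homomorphism `φ : H → G`
whose kernel is a `p'`-group. -/
def Burn.twist {p : ℕ} [Fact p.Prime] {R : Type u} [CommRing R] {H G : Type v} [Group H] [Group G]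
    [Finite H] [Finite G] {φ : H →* G} (hφ : IsPPrimeGroup p φ.ker) :
    Burn R H →ₗ[R] BDelta p R H G :=
  Groth.lift (fun W _ => Groth.mk R (FinBiset.twist φ W) (FinBiset.isBifree_twist hφ W))
    fun _ _ _ _ _ _ e => Groth.mk_sum R _ _ _ (FinBiset.twistSum φ e)

/-! ### Marks determine the elements of the Burnside group -/

section Marks

variable {R : Type u} [CommRing R] {G H : Type v} [Group G] [Group H]

theorem Burn.mk_iso {U V : FinBiset G PUnit.{v + 1}} (e : FinBiset.Iso U V) :
    (Groth.mk R U trivial : Burn R G) = Groth.mk R V trivial :=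
  Groth.mk_iso trivial trivial trivial e

theorem Burn.mk_eq_coset [Finite G] (U : FinBiset G PUnit.{v + 1}) [MulAction.IsPretransitive G U]
    (u : U) : (Groth.mk R U trivial : Burn R G) = Burn.coset R (MulAction.stabilizer G u) := by
  let f : G ⧸ MulAction.stabilizer G u → U := MulAction.ofQuotientStabilizer G u
  have hf : Function.Bijective f := by
    refine ⟨MulAction.injective_ofQuotientStabilizer G u, fun y => ?_⟩
    obtain ⟨g, rfl⟩ := MulAction.exists_smul_eq G u y
    exact ⟨(g : G ⧸ MulAction.stabilizer G u), rfl⟩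
  exact (Burn.mk_iso (FinBiset.isoOfLeft
    (X := FinBiset.ofGSet G (G ⧸ MulAction.stabilizer G u)) (Equiv.ofBijective f hf)
    fun g c => MulAction.ofQuotientStabilizer_smul G u g c)).symm

theorem Burn.act_mk {p : ℕ} {X : FinBiset H G} (hX : X.IsBifree p)
    (U : FinBiset G PUnit.{v + 1}) :
    Burn.act (Groth.mk R X hX) (Groth.mk R U trivial : Burn R G) =
      Groth.mk R (X.tensor U) trivial :=
  Groth.comp_mk _ _ _ _ _

theorem Burn.map_stabSum {M N : Type*} [AddCommGroup M] [Module R M] [AddCommGroup N] [Module R N]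
    (l : M →ₗ[R] N) (f : Subgroup G → M) (x : Burn R G) :
    l (Burn.stabSum R f x) = Burn.stabSum R (fun S => l (f S)) x := by
  suffices l ∘ₗ Burn.stabSum R f = Burn.stabSum R (fun S => l (f S)) from
    LinearMap.congr_fun this x
  refine Groth.hom_ext fun U _ => ?_
  have := Fintype.ofFinite U
  rw [LinearMap.comp_apply, Burn.stabSum_mk, Burn.stabSum_mk, map_sum]

theorem Burn.mark_prodRes (φ : H →* G) (W : FinBiset H PUnit.{v + 1}) (U : FinBiset G PUnit.{v + 1})
    (T : Subgroup H) : Burn.mark R T (Groth.mk R (FinBiset.prodRes φ W U) trivial) =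
      Burn.mark R T (Groth.mk R W trivial) * Burn.mark R (T.map φ) (Groth.mk R U trivial) := by
  rw [Burn.mark_mk, Burn.mark_mk, Burn.mark_mk, ← Nat.cast_mul, ← Nat.card_prod]
  congr 1
  refine Nat.card_congr (Equiv.trans (Equiv.subtypeEquivRight ?_) (Equiv.subtypeProdEquivProd
    (p := fun w : W => ∀ l ∈ T, l • w = w) (q := fun u : U => ∀ g ∈ T.map φ, g • u = u)))
  rintro ⟨w, u⟩
  have smul_eq_iff (l : H) : l • (show FinBiset.prodRes φ W U from (w, u)) = (w, u) ↔
      l • w = w ∧ φ l • u = u := Prod.mk_inj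
  simp only [smul_eq_iff, Subgroup.mem_map, forall_exists_index, and_imp, forall_apply_eq_imp_iff₂,
    ← forall₂_and]

theorem Burn.mark_act_twist {p : ℕ} [Fact p.Prime] [Finite H] [Finite G] {φ : H →* G}
    (hφ : IsPPrimeGroup p φ.ker) (w : Burn R H) (x : Burn R G) (T : Subgroup H) :
    Burn.mark R T (Burn.act (Burn.twist hφ w) x) = Burn.mark R T w * Burn.mark R (T.map φ) x := by
  induction w using Groth.induction with
  | h0 => simp
  | hadd w w' hw hw' => simp only [map_add, LinearMap.add_apply, hw, hw', add_mul]
  | hsmul r w hw => simp only [map_smul, LinearMap.smul_apply, hw, smul_eq_mul, mul_assoc]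
  | hmk W hW =>
    induction x using Groth.induction with
    | h0 => simp
    | hadd x x' hx hx' => simp only [map_add, hx, hx', mul_add]
    | hsmul r x hx => simp only [map_smul, hx, smul_eq_mul, mul_left_comm]
    | hmk U hU =>
      rw [Burn.twist, Groth.lift_mk, Burn.act_mk, Burn.mk_iso (FinBiset.twistTensor φ W U),
        Burn.mark_prodRes]

theorem FinBiset.IsOrbitOf.isPretransitive {U : FinBiset G PUnit.{v + 1}} {u : U}
    (hu : U.IsOrbitOf u) : MulAction.IsPretransitive G U := by
  refine (MulAction.isPretransitive_iff_base u).2 fun y => ?_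
  obtain ⟨g, k, rfl⟩ := hu y
  exact ⟨g, by rw [op_punit_smul]⟩

variable [Finite G]

theorem Burn.card_smul_eq_stabSum (x : Burn R G) :
    (Nat.card G : R) • x = Burn.stabSum R (fun S => (Nat.card S : R) • Burn.coset R S) x := by
  suffices LinearMap.eqLocus ((Nat.card G : R) • LinearMap.id)
      (Burn.stabSum R fun S => (Nat.card S : R) • Burn.coset R S) = ⊤ from
    LinearMap.congr_fun (LinearMap.eqLocus_eq_top.1 this) x
  refine Groth.eq_top_of_orbits_mem (fun _ _ _ _ _ => ⟨trivial, trivial⟩) fun U u _ hu => ?_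
  have := hu.isPretransitive
  have := Fintype.ofFinite U
  have card_mul (y : U) : Nat.card U * Nat.card (MulAction.stabilizer G y) = Nat.card G := by
    rw [← MulAction.index_stabilizer_of_transitive G y, Subgroup.index_mul_card]
  have sum_card : ∑ y : U, (Nat.card (MulAction.stabilizer G y) : R) = Nat.card G := by
    rw [← card_mul u, Finset.sum_congr rfl fun y _ => congrArg Nat.cast
      (Nat.eq_of_mul_eq_mul_left (Nat.card_pos_iff.2 ⟨⟨u⟩, inferInstance⟩)
        ((card_mul y).trans (card_mul u).symm))]
    simp
  rw [LinearMap.mem_eqLocus, Burn.stabSum_mk]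
  simp only [← Burn.mk_eq_coset U, ← Finset.sum_smul, sum_card]
  rfl

variable {p : ℕ} [Fact p.Prime]

/-- Induction from the subgroup `L`, as an element of `R B^Δ(G, L)`. -/
def BDelta.ind (p : ℕ) [Fact p.Prime] (R : Type u) [CommRing R] (L : Subgroup G) : BDelta p R G L :=
  Groth.mk R (FinBiset.viaHom L.subtype)
    (FinBiset.isBifree_viaHom (isPPrimeGroup_ker_of_injective L.subtype_injective))

theorem Burn.act_ind_coset (L : Subgroup G) (T : Subgroup L) :
    Burn.act (BDelta.ind p R L) (Burn.coset R T) = Burn.coset R (T.map L.subtype) := by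
  let X := FinBiset.viaHom L.subtype
  let U := FinBiset.ofGSet L (L ⧸ T)
  let t : X.tensor U := FinBiset.tmk (X := X) (Y := U) (1 : G) ((1 : L) : L ⧸ T)
  have isPretransitive : MulAction.IsPretransitive G (X.tensor U) := by
    refine (MulAction.isPretransitive_iff_base t).2 fun y => ?_
    obtain ⟨g, u, rfl⟩ := FinBiset.tmk_surj y
    obtain ⟨l, rfl⟩ := QuotientGroup.mk_surjective (s := T) u
    refine ⟨(show G from g) * l, (FinBiset.tmk_eq_iff.2 ⟨l, ?_, ?_⟩).symm⟩
    · exact mul_one (M := G) _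
    · exact congrArg (QuotientGroup.mk (s := T)) (mul_one l).symm
  have mem_iff (l : L) : ((1 : L) : L ⧸ T) = l • ((1 : L) : L ⧸ T) ↔ l ∈ T := by
    rw [MulAction.Quotient.smul_mk, QuotientGroup.eq, smul_eq_mul, inv_one, one_mul, mul_one]
  have stabilizer_eq : MulAction.stabilizer G t = T.map L.subtype := by
    ext g
    have smul_eq_iff : g • t = t ↔ ∃ l : L, (1 : G) = g * 1 * l ∧
        ((1 : L) : L ⧸ T) = l • ((1 : L) : L ⧸ T) := FinBiset.tmk_eq_iff
    simp only [MulAction.mem_stabilizer_iff, smul_eq_iff, mem_iff, mul_one, Subgroup.mem_map]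
    constructor
    · rintro ⟨l, hl, hT⟩
      exact ⟨l⁻¹, inv_mem hT, (eq_inv_of_mul_eq_one_left hl.symm).symm⟩
    · rintro ⟨l, hT, rfl⟩
      exact ⟨l⁻¹, (mul_inv_cancel (l : G)).symm, inv_mem hT⟩
  exact (Burn.act_mk _ U).trans ((Burn.mk_eq_coset (X.tensor U) t).trans (by rw [stabilizer_eq]))

open Classical in
theorem sum_le_map_subtype {M : Type*} [AddCommMonoid M] {A : Type*} [Group A]
    [Fintype (Subgroup A)] (L : Subgroup A) [Fintype (Subgroup L)] (g : Subgroup A → M)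
    (Z : Subgroup L) :
    ∑ T with T ≤ Z.map L.subtype, g T = ∑ T with T ≤ Z, g (T.map L.subtype) := by
  have map_injective := Subgroup.map_injective L.subtype_injective
  rw [← Finset.sum_image (s := {T | T ≤ Z}) (f := g) map_injective.injOn]
  refine Finset.sum_congr (Finset.ext fun T => ?_) fun _ _ => rfl
  simp only [Finset.mem_filter, Finset.mem_univ, true_and, Finset.mem_image]
  constructor
  · intro hT
    refine ⟨T.subgroupOf L, ?_, Subgroup.map_subgroupOf_eq_of_le
      (hT.trans (Subgroup.map_subtype_le Z))⟩
    rw [← Subgroup.comap_map_eq_self_of_injective L.subtype_injective Z]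
    exact Subgroup.comap_mono hT
  · rintro ⟨S, hS, rfl⟩
    exact Subgroup.map_mono hS

variable {K : Type u} [Field K] [CharZero K]

theorem Burn.ext_mark {x y : Burn K G} (h : ∀ L : Subgroup G, Burn.mark K L x = Burn.mark K L y) :
    x = y := by
  classical
  have := Fintype.ofFinite (Subgroup G)
  have card_ne_zero : (Nat.card G : K) ≠ 0 := Nat.cast_ne_zero.2 Nat.card_pos.ne'
  obtain ⟨g, hg⟩ := exists_moebius_inverse
    (fun S : Subgroup G => (Nat.card S : K) • Burn.coset K S)
  refine smul_right_injective _ card_ne_zero ?_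
  simp only [Burn.card_smul_eq_stabSum, Burn.stabSum_eq_sum_mark hg, h]

open Classical in
theorem Burn.card_smul_act_ind_idem [Fintype (Subgroup G)] {g : Subgroup G → Burn K G}
    (hg : ∀ S : Subgroup G, (Nat.card S : K) • Burn.coset K S = ∑ T with T ≤ S, g T)
    (L : Subgroup G) :
    (Nat.card L : K) • Burn.act (BDelta.ind p K L) (Burn.idem K L) = g L := by
  have := Fintype.ofFinite (Subgroup L)
  rw [← map_smul, Burn.card_smul_eq_stabSum, Burn.map_stabSum]
  have act_smul_coset (Z : Subgroup L) :
      Burn.act (BDelta.ind p K L) ((Nat.card Z : K) • Burn.coset K Z) =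
        ∑ T with T ≤ Z, g (T.map L.subtype) := by
    rw [map_smul, Burn.act_ind_coset, ← sum_le_map_subtype, ← hg,
      Subgroup.card_map_of_injective L.subtype_injective]
  rw [Burn.stabSum_idem_eq_top act_smul_coset, ← MonoidHom.range_eq_map, Subgroup.range_subtype]

variable (p) in
theorem Burn.card_smul_eq_sum_mark [Fintype (Subgroup G)] (x : Burn K G) :
    (Nat.card G : K) • x = ∑ L : Subgroup G, (Burn.mark K L x * Nat.card L) •
      Burn.act (BDelta.ind p K L) (Burn.idem K L) := by
  classical
  obtain ⟨g, hg⟩ := exists_moebius_inverse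
    (fun S : Subgroup G => (Nat.card S : K) • Burn.coset K S)
  simp only [Burn.card_smul_eq_stabSum, Burn.stabSum_eq_sum_mark hg, mul_smul,
    Burn.card_smul_act_ind_idem hg]

theorem Burn.act_twist_idem [Finite H] {φ : H →* G} (hφ : IsPPrimeGroup p φ.ker) (x : Burn K G) :
    Burn.act (Burn.twist hφ (Burn.idem K H)) x = Burn.mark K φ.range x • Burn.idem K H := by
  classical
  refine Burn.ext_mark fun T => ?_
  rw [Burn.mark_act_twist, map_smul, smul_eq_mul, mark_idem]
  split_ifs with hT
  · rw [hT, ← MonoidHom.range_eq_map, one_mul, mul_one]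
  · rw [zero_mul, mul_zero]

end Marks

/-! ### Linked points of bisets -/

section

variable {A B X : Type*} [Group A] [Group B] [MulAction A X] [MulAction B X] [SMulCommClass A B X]

variable (A B) in
/-- For commuting actions of `A` and `B`, the subgroup of the elements of `A` that move `x` inside
its `B`-orbit. -/
def link (x : X) : Subgroup A where
  carrier := {a | ∃ b : B, a • x = b • x}
  one_mem' := ⟨1, by rw [one_smul, one_smul]⟩
  mul_mem' := by
    rintro a c ⟨b, hb⟩ ⟨d, hd⟩
    exact ⟨d * b, by rw [mul_smul, hd, smul_comm, hb, mul_smul]⟩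
  inv_mem' := by
    rintro a ⟨b, hb⟩
    exact ⟨b⁻¹, by rw [inv_smul_eq_iff, smul_comm, hb, inv_smul_smul]⟩

end

open Classical in
theorem sum_card_stabilizer_mul {A Y T R : Type*} [Group A] [MulAction A Y] [Fintype Y]
    [Fintype T] [CommSemiring R] {q : Y → T} (hq : Function.Surjective q)
    (orbit : ∀ a b, q a = q b ↔ a ∈ MulAction.orbit A b) (f : T → R) :
    ∑ y, (Nat.card (MulAction.stabilizer A y) : R) * f (q y) = Nat.card A * ∑ t, f t := by
  rw [← Finset.sum_fiberwise _ q, Finset.mul_sum]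
  refine Finset.sum_congr rfl fun t _ => ?_
  obtain ⟨b, rfl⟩ := hq t
  have card_stabilizer (y : Y) (hy : q y = q b) :
      Nat.card (MulAction.stabilizer A y) = Nat.card (MulAction.stabilizer A b) :=
    Nat.card_congr (MulAction.stabilizerEquivStabilizerOfOrbitRel ((orbit y b).1 hy)).toEquiv
  have card_fiber : Finset.card {y | q y = q b} = (MulAction.stabilizer A b).index := by
    rw [MulAction.index_stabilizer, ← Set.ncard_coe_finset]
    congr 1
    ext y
    simp [orbit]
  calc ∑ y with q y = q b, (Nat.card (MulAction.stabilizer A y) : R) * f (q y)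
    _ = ∑ y with q y = q b, (Nat.card (MulAction.stabilizer A b) : R) * f (q b) :=
      Finset.sum_congr rfl fun y hy => by
        rw [(Finset.mem_filter.1 hy).2, card_stabilizer y (Finset.mem_filter.1 hy).2]
    _ = Nat.card A * f (q b) := by
      rw [Finset.sum_const, card_fiber, nsmul_eq_mul, ← mul_assoc, ← Nat.cast_mul,
        Subgroup.index_mul_card]

namespace FinBiset

variable {G H : Type v} [Group G] [Group H] {X : FinBiset G H}

/-- The subgroup of the `g` in `G` such that `g x` lies in the right orbit of `x`. -/
def leftLink (x : X) : Subgroup G := link G Hᵐᵒᵖ x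

/-- The subgroup of the `h` in `H` such that `x h` lies in the left orbit of `x`. -/
def rightLink (x : X) : Subgroup H :=
  letI := SMulCommClass.symm G Hᵐᵒᵖ X
  (link Hᵐᵒᵖ G x).unop

/-- The right stabilizer of a point, as a subgroup of `H`. -/
def rightStab (x : X) : Subgroup H := (MulAction.stabilizer Hᵐᵒᵖ x).unop

/-- The left and the right orbit of the point `x` coincide. -/
def IsLinked (x : X) : Prop := leftLink x = ⊤ ∧ rightLink x = ⊤

theorem mem_leftLink {x : X} {g : G} : g ∈ leftLink x ↔ ∃ h : H, g • x = op h • x :=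
  op_surjective.exists

theorem mem_rightLink {x : X} {h : H} : h ∈ rightLink x ↔ ∃ g : G, op h • x = g • x := Iff.rfl

theorem mem_rightStab {x : X} {h : H} : h ∈ rightStab x ↔ op h • x = x := Iff.rfl

theorem exists_of_leftLink_eq_top {x : X} (hx : leftLink x = ⊤) (g : G) :
    ∃ h : H, g • x = op h • x :=
  mem_leftLink.1 (hx ▸ Subgroup.mem_top g)

theorem exists_of_rightLink_eq_top {x : X} (hx : rightLink x = ⊤) (h : H) :
    ∃ g : G, op h • x = g • x :=
  mem_rightLink.1 (hx ▸ Subgroup.mem_top h)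

theorem rightStab_le_rightLink (x : X) : rightStab x ≤ rightLink x :=
  fun _ hh => ⟨1, hh.trans (one_smul G x).symm⟩

theorem rightStab_normal {x : X} (hx : rightLink x = ⊤) : (rightStab x).Normal := by
  refine ⟨fun h hh k => ?_⟩
  obtain ⟨g, hg⟩ := exists_of_rightLink_eq_top hx k
  rw [mem_rightStab] at hh ⊢
  rw [op_mul, op_mul, mul_smul, mul_smul, hg, ← smul_comm g (op h), hh, ← hg, smul_smul, ← op_mul,
    mul_inv_cancel, op_one, one_smul]

theorem op_smul_eq_op_smul_iff {x : X} (hx : rightStab x = ⊥) {a b : H} :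
    op a • x = op b • x ↔ a = b := by
  refine ⟨fun hab => ?_, fun hab => hab ▸ rfl⟩
  have : a * b⁻¹ ∈ rightStab x := by
    rw [mem_rightStab, op_mul, mul_smul, hab, smul_smul, ← op_mul, mul_inv_cancel, op_one, one_smul]
  rwa [hx, Subgroup.mem_bot, mul_inv_eq_one] at this

theorem exists_hom_of_rightStab_eq_bot {x : X} (hl : leftLink x = ⊤) (hx : rightStab x = ⊥) :
    ∃ φ : G →* H, ∀ g, g • x = op (φ g) • x := by
  choose f hf using exists_of_leftLink_eq_top hl
  refine ⟨MonoidHom.mk' f fun a b => (op_smul_eq_op_smul_iff hx).1 ?_, hf⟩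
  rw [← hf, mul_smul, hf b, op_mul, mul_smul, smul_comm, hf a]

end FinBiset

/-! ### The mark at the whole group of `X ×_H e^H_H` -/

namespace FinBiset

variable {G H : Type v} [Group G] [Group H]

/-- The action of `H` on `X × U` by `h · (x, u) = (x h⁻¹, h u)`, whose orbits are the points of
`X ×_H U`. -/
abbrev tensorAction (X : FinBiset G H) (U : FinBiset H PUnit.{v + 1}) : MulAction H (X × U) where
  smul h a := (op h⁻¹ • a.1, h • a.2)
  one_smul a := Prod.ext (by change op (1 : H)⁻¹ • a.1 = a.1; simp) (one_smul H a.2)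
  mul_smul h k a := Prod.ext
    (by change op (h * k)⁻¹ • a.1 = op h⁻¹ • op k⁻¹ • a.1; simp [mul_smul]) (mul_smul h k a.2)

open Classical in
/-- The contribution of a point `x` of `X` and of a point of the `H`-set `U` with stabilizer `S` to
`|H|` times the number of `G`-fixed points of `X ×_H U`. -/
def fixWeight {X : FinBiset G H} (x : X) (S : Subgroup H) : ℕ :=
  if ∀ g : G, ∃ h ∈ S, op h • g • x = x then Nat.card (rightStab x ⊓ S : Subgroup H) else 0

theorem sum_fixWeight [Finite H] (X : FinBiset G H) (U : FinBiset H PUnit.{v + 1}) [Fintype X]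
    [Fintype U] : ∑ x : X, ∑ u : U, fixWeight x (MulAction.stabilizer H u) =
      Nat.card H * Nat.card {t : X.tensor U // ∀ g ∈ (⊤ : Subgroup G), g • t = t} := by
  classical
  have := Fintype.ofFinite (X.tensor U)
  let : MulAction H (X × U) := tensorAction X U
  have stabilizer_eq (x : X) (u : U) :
      MulAction.stabilizer H (x, u) = rightStab x ⊓ MulAction.stabilizer H u := by
    ext h
    refine Prod.mk_inj.trans (and_congr_left' ?_)
    rw [MulOpposite.op_inv, inv_smul_eq_iff, eq_comm]
    rfl
  have fixed_iff (x : X) (u : U) : (∀ g ∈ (⊤ : Subgroup G), g • (tmk x u : X.tensor U) = tmk x u) ↔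
      ∀ g : G, ∃ h ∈ MulAction.stabilizer H u, op h • g • x = x := by
    simp only [Subgroup.mem_top, true_imp_iff, MulAction.mem_stabilizer_iff, smul_tmk]
    refine forall_congr' fun g => tmk_eq_iff.trans (exists_congr fun h => ?_)
    rw [and_comm, eq_comm, eq_comm (a := x)]
  have tmk_eq_iff_mem_orbit (a b : X × U) :
      (tmk a.1 a.2 : X.tensor U) = tmk b.1 b.2 ↔ a ∈ MulAction.orbit H b := by
    rw [tmk_eq_iff]
    refine exists_congr fun h => ?_
    change _ ↔ ((op h⁻¹ • b.1, h • b.2) : X × U) = a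
    rw [Prod.ext_iff, MulOpposite.op_inv]
    exact and_congr inv_smul_eq_iff.symm eq_comm
  have := sum_card_stabilizer_mul (R := ℕ) (q := fun a : X × U => (tmk a.1 a.2 : X.tensor U))
    (fun t => by obtain ⟨x, u, rfl⟩ := tmk_surj t; exact ⟨(x, u), rfl⟩) tmk_eq_iff_mem_orbit
    (fun t => if ∀ g ∈ (⊤ : Subgroup G), g • t = t then 1 else 0)
  rw [Fintype.sum_prod_type, Finset.sum_boole, ← Fintype.card_subtype,
    ← Nat.card_eq_fintype_card] at this
  simpa only [fixWeight, stabilizer_eq, fixed_iff, mul_ite, mul_one, mul_zero, Nat.cast_id]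
    using this

variable {X : FinBiset G H} {x : X}

open Classical in
theorem fixWeight_inf_rightLink (x : X) (S : Subgroup H) :
    fixWeight x (S ⊓ rightLink x) = fixWeight x S := by
  have inf_eq : rightStab x ⊓ (S ⊓ rightLink x) = rightStab x ⊓ S := by
    rw [inf_left_comm, inf_eq_left.2 (rightStab_le_rightLink x), inf_comm]
  have mem_rightLink_of_eq (g : G) (h : H) (hx : op h • g • x = x) : h ∈ rightLink x :=
    ⟨g⁻¹, by rw [eq_inv_smul_iff, smul_comm, hx]⟩
  have exists_iff (g : G) : (∃ h ∈ S ⊓ rightLink x, op h • g • x = x) ↔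
      ∃ h ∈ S, op h • g • x = x :=
    exists_congr fun h => and_congr_left fun hx => and_iff_left (mem_rightLink_of_eq g h hx)
  rw [fixWeight, fixWeight, inf_eq]
  exact ite_congr (propext (forall_congr' exists_iff)) (fun _ => rfl) fun _ => rfl

theorem fixWeight_eq_zero (hx : leftLink x ≠ ⊤) (S : Subgroup H) : fixWeight x S = 0 := by
  refine if_neg fun hS => hx (eq_top_iff.2 fun g _ => ?_)
  obtain ⟨h, -, hh⟩ := hS g
  exact mem_leftLink.2 ⟨h⁻¹, by rw [MulOpposite.op_inv, eq_inv_smul_iff, hh]⟩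

theorem forall_exists_smul_eq_iff (hx : IsLinked x) (S : Subgroup H) :
    (∀ g : G, ∃ h ∈ S, op h • g • x = x) ↔ (S : Set H) * (rightStab x : Set H) = Set.univ := by
  have smul_eq_iff (g : G) (k h : H) (hg : g • x = op k • x) :
      op h • g • x = x ↔ h⁻¹ * k⁻¹ ∈ rightStab x := by
    rw [hg, smul_smul, ← op_mul, ← mul_inv_rev, inv_mem_iff, mem_rightStab]
  simp only [Set.eq_univ_iff_forall, Set.mem_mul, SetLike.mem_coe]
  constructor
  · intro hS k
    obtain ⟨g, hg⟩ := exists_of_rightLink_eq_top hx.2 k⁻¹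
    obtain ⟨s, hs, hsx⟩ := hS g
    exact ⟨s, hs, s⁻¹ * k, inv_inv k ▸ (smul_eq_iff g k⁻¹ s hg.symm).1 hsx,
      mul_inv_cancel_left s k⟩
  · intro hS g
    obtain ⟨k, hk⟩ := exists_of_leftLink_eq_top hx.1 g
    obtain ⟨s, hs, r, hr, hsr⟩ := hS k⁻¹
    exact ⟨s, hs, (smul_eq_iff g k s hk).2 (by rwa [← hsr, inv_mul_cancel_left])⟩

end FinBiset

open FinBiset

section

theorem card_inf_mul_card {A : Type*} [Group A] {S N : Subgroup A} [N.Normal]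
    (h : (S : Set A) * (N : Set A) = Set.univ) :
    Nat.card (N ⊓ S : Subgroup A) * Nat.card A = Nat.card N * Nat.card S := by
  have sup_eq_top : S ⊔ N = ⊤ := SetLike.coe_injective (by rw [Subgroup.mul_normal, h]; rfl)
  have relIndex_eq : (N ⊓ S).relIndex S = N.index := by
    rw [Subgroup.inf_relIndex_right, ← Subgroup.relIndex_sup_right, sup_eq_top,
      Subgroup.relIndex_top_right]
  have card_eq := Subgroup.relIndex_mul_relIndex ⊥ (N ⊓ S) S bot_le inf_le_right
  rw [Subgroup.relIndex_bot_left, Subgroup.relIndex_bot_left] at card_eq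
  rw [← Subgroup.card_mul_index N, ← relIndex_eq, ← card_eq]
  ring

open Classical in
theorem card_mul_deflationNumber {A : Type*} [Group A] [Finite A] [Fintype (Subgroup A)]
    (N : Subgroup A) : Nat.card A * deflationNumber N =
      ∑ S : Subgroup A, if (S : Set A) * (N : Set A) = Set.univ then
        (Nat.card S : ℚ) * moebiusTop S else 0 := by
  rw [deflationNumber, mul_inv_cancel_left₀ (Nat.cast_ne_zero.2 Nat.card_pos.ne'),
    Set.toFinset_ofPred, Finset.sum_filter]

variable {G H : Type v} [Group G] [Group H]

open Classical in
theorem fixWeight_mul_card {X : FinBiset G H} {x : X} (hx : IsLinked x) (S : Subgroup H) :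
    fixWeight x S * Nat.card H = if (S : Set H) * (rightStab x : Set H) = Set.univ then
      Nat.card (rightStab x) * Nat.card S else 0 := by
  have := rightStab_normal hx.2
  simp only [fixWeight, forall_exists_smul_eq_iff hx, ite_mul, zero_mul]
  exact ite_congr rfl card_inf_mul_card fun _ => rfl

variable [Finite H]

theorem Burn.card_mul_mark_top_act {p : ℕ} {R : Type u} [CommRing R] {X : FinBiset G H}
    (hX : X.IsBifree p) [Fintype X] (y : Burn R H) :
    Nat.card H * Burn.mark R ⊤ (Burn.act (Groth.mk R X hX) y) =
      ∑ x : X, Burn.stabSum R (fun S => (fixWeight x S : R)) y := by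
  induction y using Groth.induction with
  | h0 => simp
  | hadd x y hx hy => simp only [map_add, mul_add, hx, hy, Finset.sum_add_distrib]
  | hsmul r x hx => simp only [map_smul, smul_eq_mul, mul_left_comm, hx, Finset.mul_sum]
  | hmk U hU =>
    have := Fintype.ofFinite U
    rw [Burn.act_mk, Burn.mark_mk, ← Nat.cast_mul, ← sum_fixWeight]
    simp only [Burn.stabSum_mk, Nat.cast_sum]

variable {K : Type u} [Field K] [CharZero K]

theorem Burn.stabSum_fixWeight_idem_of_isLinked {X : FinBiset G H} {x : X} (hx : IsLinked x) :
    Burn.stabSum K (fun S => (fixWeight x S : K)) (Burn.idem K H) =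
      Nat.card (rightStab x) * (deflationNumber (rightStab x) : ℚ) := by
  classical
  have := Fintype.ofFinite (Subgroup H)
  have card_ne_zero : (Nat.card H : K) ≠ 0 := Nat.cast_ne_zero.2 Nat.card_pos.ne'
  have card_mul_weight (S : Subgroup H) : (Nat.card H : K) * moebiusTop S • (fixWeight x S : K) =
      Nat.card (rightStab x) * if (S : Set H) * (rightStab x : Set H) = Set.univ then
        (Nat.card S : K) * moebiusTop S else 0 := by
    rw [zsmul_eq_mul, mul_left_comm, mul_comm (Nat.card H : K), ← Nat.cast_mul,
      fixWeight_mul_card hx]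
    split_ifs <;> push_cast <;> ring
  have card_mul_deflation := congrArg (Rat.cast (K := K)) (card_mul_deflationNumber (rightStab x))
  push_cast at card_mul_deflation
  refine mul_left_cancel₀ card_ne_zero ?_
  rw [Burn.stabSum_idem, Finset.mul_sum, mul_left_comm, card_mul_deflation, Finset.mul_sum]
  simp only [card_mul_weight, apply_ite (Rat.cast (K := K))]
  push_cast
  rfl

open Classical in
theorem Burn.stabSum_fixWeight_idem {X : FinBiset G H} (x : X) :
    Burn.stabSum K (fun S => (fixWeight x S : K)) (Burn.idem K H) =
      if IsLinked x then (Nat.card (rightStab x) : K) * (deflationNumber (rightStab x) : ℚ)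
      else 0 := by
  by_cases hl : leftLink x = ⊤
  · by_cases hr : rightLink x = ⊤
    · rw [if_pos ⟨hl, hr⟩, stabSum_fixWeight_idem_of_isLinked ⟨hl, hr⟩]
    · rw [if_neg fun hx => hr hx.2]
      exact stabSum_idem_eq_zero hr fun S => by rw [fixWeight_inf_rightLink]
  · rw [if_neg fun hx => hl hx.1]
    have := Fintype.ofFinite (Subgroup H)
    simp only [stabSum_idem, fixWeight_eq_zero hl, Nat.cast_zero, smul_zero, Finset.sum_const_zero]

open Classical in
theorem Burn.card_mul_mark_top_act_idem {p : ℕ} {X : FinBiset G H} (hX : X.IsBifree p)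
    [Fintype X] : Nat.card H * Burn.mark K ⊤ (Burn.act (Groth.mk K X hX) (Burn.idem K H)) =
      ∑ x : X, if IsLinked x then
        (Nat.card (rightStab x) : K) * (deflationNumber (rightStab x) : ℚ) else 0 := by
  simp only [Burn.card_mul_mark_top_act, Burn.stabSum_fixWeight_idem]

end

/-! ### Domination of groups -/

section Dominates

variable {p : ℕ}

section

variable {G H : Type*} [Group G] [Group H]

theorem dominates_of_surjective {φ : G →* H} (hs : Function.Surjective φ)
    (hφ : IsPPrimeGroup p φ.ker) : Dominates p G H :=
  ⟨φ.ker, inferInstance, hφ, ⟨QuotientGroup.quotientKerEquivOfSurjective φ hs⟩⟩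

theorem Dominates.exists_hom (h : Dominates p G H) :
    ∃ φ : G →* H, Function.Surjective φ ∧ IsPPrimeGroup p φ.ker := by
  obtain ⟨N, hN, hp, ⟨e⟩⟩ := h
  refine ⟨e.toMonoidHom.comp (QuotientGroup.mk' N),
    e.surjective.comp (QuotientGroup.mk'_surjective N), ?_⟩
  have ker_eq : (e.toMonoidHom.comp (QuotientGroup.mk' N)).ker = N := by
    ext g
    simp
  rwa [ker_eq]

theorem dominates_of_mulEquiv [Fact p.Prime] (e : G ≃* H) : Dominates p G H :=
  dominates_of_surjective (φ := e.toMonoidHom) e.surjective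
    (isPPrimeGroup_ker_of_injective e.injective)

theorem Dominates.card_le [Finite G] (h : Dominates p G H) : Nat.card H ≤ Nat.card G := by
  obtain ⟨φ, hs, -⟩ := h.exists_hom
  exact Nat.card_le_card_of_surjective φ hs

theorem Dominates.nonempty_mulEquiv [Finite G] (h : Dominates p G H)
    (hc : Nat.card G ≤ Nat.card H) : Nonempty (G ≃* H) := by
  obtain ⟨φ, hs, -⟩ := h.exists_hom
  have := Finite.of_surjective φ hs
  exact ⟨MulEquiv.ofBijective φ
    ((Nat.bijective_iff_surjective_and_card φ).2 ⟨hs, le_antisymm hc h.card_le⟩)⟩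

end

theorem dominates_of_isLinked {G H : Type v} [Group G] [Group H] {X : FinBiset G H}
    (hX : X.IsBifree p) {x : X} (hx : IsLinked x) (hR : rightStab x = ⊥) : Dominates p G H := by
  obtain ⟨φ, hφ⟩ := exists_hom_of_rightStab_eq_bot hx.1 hR
  have ker_eq : φ.ker = MulAction.stabilizer G x := by
    ext g
    rw [MonoidHom.mem_ker, MulAction.mem_stabilizer_iff, hφ, ← op_smul_eq_op_smul_iff hR, op_one,
      one_smul]
  refine dominates_of_surjective (fun h => ?_) (ker_eq ▸ (hX x).1)
  obtain ⟨g, hg⟩ := exists_of_rightLink_eq_top hx.2 h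
  exact ⟨g, (op_smul_eq_op_smul_iff hR).1 ((hφ g).symm.trans hg.symm)⟩

end Dominates

/-! ### Subfunctors -/

section

variable {p : ℕ} [Fact p.Prime] {R : Type u} [CommRing R]
  {F : BifreeCat.{u, v} p R ⥤ ModuleCat.{w} R} {G H : BifreeCat.{u, v} p R}

/-- Evaluation of morphisms at an element `x` of `F(G)`; as `H` varies this is the morphism from
the representable functor of `G` to `F` that corresponds to `x` by the Yoneda lemma. -/
def evalAt [F.Additive] [F.Linear R] (x : F.obj G) (H : BifreeCat.{u, v} p R) :
    (G ⟶ H) →ₗ[R] F.obj H :=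
  LinearMap.applyₗ x ∘ₗ (ModuleCat.homLinearEquiv (S := R)).toLinearMap ∘ₗ F.mapLinearMap R

theorem evalAt_apply [F.Additive] [F.Linear R] (x : F.obj G) (f : G ⟶ H) :
    evalAt x H f = (F.map f).hom x := rfl

theorem evalAt_id [F.Additive] [F.Linear R] (x : F.obj G) : evalAt x G (𝟙 G) = x := by
  rw [evalAt_apply, F.map_id, ModuleCat.hom_id, LinearMap.id_apply]

theorem evalAt_comp [F.Additive] [F.Linear R] (x : F.obj G) {H' : BifreeCat.{u, v} p R}
    (f : G ⟶ H) (g : H ⟶ H') : evalAt x H' (f ≫ g) = (F.map g).hom (evalAt x H f) := by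
  simp only [evalAt_apply, F.map_comp, ModuleCat.hom_comp, LinearMap.comp_apply]

namespace SubFun

theorem generate_le {x : F.obj G} {A : SubFun F} (h : x ∈ A.obj G) : generate G x ≤ A :=
  sInf_le (α := SubFun F) (Set.mem_ofPred_eq ▸ h)

theorem self_mem_generate {x : F.obj G} : x ∈ (generate G x).obj G := by
  change x ∈ (⨅ A ∈ {A : SubFun F | x ∈ A.obj G}, A.obj G)
  simp only [Submodule.mem_iInf, Set.mem_ofPred_eq]
  exact fun _ h => h

/-- The subfunctor of `F` formed by the values of the morphisms from `G` at `x`. -/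
def rangeEvalAt [F.Additive] [F.Linear R] (x : F.obj G) : SubFun F where
  obj H := LinearMap.range (evalAt x H)
  map_mem f := by
    rintro _ ⟨g, rfl⟩
    exact ⟨g ≫ f, evalAt_comp x g f⟩

theorem generate_eq_rangeEvalAt [F.Additive] [F.Linear R] (x : F.obj G) :
    generate G x = rangeEvalAt x := by
  refine le_antisymm (generate_le ⟨𝟙 G, evalAt_id x⟩) ?_
  rintro H _ ⟨f, rfl⟩
  exact (generate G x).map_mem f x self_mem_generate

end SubFun

end

namespace SubFun

/-- The value of a subfunctor of `R B` at a finite group. -/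
def eval {p : ℕ} [Fact p.Prime] {R : Type u} [CommRing R] (F : SubFun (burnside.{u, v} p R))
    (G : Type v) [Group G] [Finite G] : Submodule R (Burn R G) :=
  F.obj (BifreeCat.of (FiniteGrp.of G))

theorem act_mem {p : ℕ} [Fact p.Prime] {R : Type u} [CommRing R]
    (F : SubFun (burnside.{u, v} p R)) {G H : Type v} [Group G] [Finite G] [Group H] [Finite H]
    (a : BDelta p R H G) {x : Burn R G} (hx : x ∈ F.eval G) : Burn.act a x ∈ F.eval H :=
  F.map_mem (G := BifreeCat.of (FiniteGrp.of G)) (H := BifreeCat.of (FiniteGrp.of H)) a x hx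

variable {p : ℕ} [Fact p.Prime] {K : Type u} [Field K] [CharZero K]
  (F : SubFun (burnside.{u, v} p K)) {G H : Type v} [Group G] [Finite G] [Group H] [Finite H]

theorem mark_range_smul_idem_mem {φ : H →* G} (hφ : IsPPrimeGroup p φ.ker) {x : Burn K G}
    (hx : x ∈ F.eval G) : Burn.mark K φ.range x • Burn.idem K H ∈ F.eval H := by
  rw [← Burn.act_twist_idem hφ]
  exact F.act_mem _ hx

theorem idem_mem_of_mark_ne_zero {x : Burn K G} (hx : x ∈ F.eval G) {L : Subgroup G}
    (hL : Burn.mark K L x ≠ 0) : Burn.idem K L ∈ F.eval L := by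
  have := F.mark_range_smul_idem_mem (isPPrimeGroup_ker_of_injective L.subtype_injective) hx
  rw [Subgroup.range_subtype] at this
  exact (Submodule.smul_mem_iff _ hL).1 this

theorem idem_mem_of_mark_top_ne_zero {x : Burn K G} (hx : x ∈ F.eval G)
    (h : Burn.mark K ⊤ x ≠ 0) : Burn.idem K G ∈ F.eval G := by
  have := F.mark_range_smul_idem_mem (φ := MonoidHom.id G)
    (isPPrimeGroup_ker_of_injective Function.injective_id) hx
  rw [MonoidHom.range_eq_top.2 Function.surjective_id] at this
  exact (Submodule.smul_mem_iff _ h).1 this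

theorem mem_of_idem_mem {x : Burn K G}
    (h : ∀ L : Subgroup G, Burn.mark K L x ≠ 0 → Burn.idem K L ∈ F.eval L) : x ∈ F.eval G := by
  have := Fintype.ofFinite (Subgroup G)
  have card_ne_zero : (Nat.card G : K) ≠ 0 := Nat.cast_ne_zero.2 Nat.card_pos.ne'
  rw [← Submodule.smul_mem_iff _ card_ne_zero, Burn.card_smul_eq_sum_mark p x]
  refine Submodule.sum_mem _ fun L _ => ?_
  by_cases hL : Burn.mark K L x = 0
  · rw [hL, zero_mul, zero_smul]
    exact zero_mem _
  · exact Submodule.smul_mem _ _ (F.act_mem _ (h L hL))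

end SubFun

/-! ### The subfunctors `e^Δ_G` -/

theorem mark_top_idem {K : Type u} [Field K] [CharZero K] (G : Type v) [Group G] [Finite G] :
    Burn.mark K ⊤ (Burn.idem K G) = 1 := by
  classical
  rw [mark_idem, if_pos rfl]

section Deflation

open FinBiset

variable {p : ℕ} {K : Type u} [Field K] [CharZero K] {G H : Type v} [Group G] [Group H]

theorem dominates_of_mark_top_ne_zero [Finite H] (hH : IsBGroup p H) (f : BDelta p K G H)
    (hf : Burn.mark K ⊤ (Burn.act f (Burn.idem K H)) ≠ 0) : Dominates p G H := by
  classical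
  induction f using Groth.induction with
  | h0 => simp only [map_zero, LinearMap.zero_apply, ne_eq, not_true_eq_false] at hf
  | hadd a b ha hb =>
    rw [map_add, LinearMap.add_apply, map_add] at hf
    by_cases h : Burn.mark K ⊤ (Burn.act a (Burn.idem K H)) = 0
    · exact hb (by rwa [h, zero_add] at hf)
    · exact ha h
  | hsmul r a ha =>
    rw [map_smul, LinearMap.smul_apply, map_smul] at hf
    exact ha (right_ne_zero_of_smul hf)
  | hmk X hX =>
    have := Fintype.ofFinite X
    have card_ne_zero : (Nat.card H : K) ≠ 0 := Nat.cast_ne_zero.2 Nat.card_pos.ne'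
    have sum_ne_zero := mul_ne_zero card_ne_zero hf
    rw [Burn.card_mul_mark_top_act_idem] at sum_ne_zero
    obtain ⟨x, -, hx⟩ := Finset.exists_ne_zero_of_sum_ne_zero sum_ne_zero
    obtain ⟨hlink, hm⟩ := ite_ne_right_iff.1 hx
    have deflation_ne_zero := Rat.cast_ne_zero.1 (right_ne_zero_of_mul hm)
    refine dominates_of_isLinked hX hlink ?_
    by_contra hR
    exact deflation_ne_zero (hH _ (rightStab_normal hlink.2) hR ((hX x).2.unop))

theorem rightStab_viaHom [Finite H] (φ : G →* H) (x : viaHom φ) : rightStab x = φ.ker := by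
  ext g
  exact mul_eq_left (M := H)

theorem isLinked_viaHom [Finite H] {φ : G →* H} (hs : Function.Surjective φ) (x : viaHom φ) :
    IsLinked x := by
  change H at x
  constructor
  · refine eq_top_iff.2 fun c _ => ?_
    obtain ⟨g, hg⟩ := hs (x⁻¹ * c * x)
    refine mem_leftLink.2 ⟨g, ?_⟩
    change c * x = x * φ g
    rw [hg]
    group
  · refine eq_top_iff.2 fun g _ => mem_rightLink.2 ⟨x * φ g * x⁻¹, ?_⟩
    exact (inv_mul_cancel_right (x * φ g) x).symm

theorem Burn.mark_top_act_viaHom_idem [Fact p.Prime] [Finite G] [Finite H] {φ : G →* H}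
    (hs : Function.Surjective φ) (hφ : IsPPrimeGroup p φ.ker) :
    Burn.mark K ⊤ (Burn.act (Groth.mk K (viaHom φ) (isBifree_viaHom hφ)) (Burn.idem K G)) =
      (deflationNumber φ.ker : ℚ) := by
  have := Fintype.ofFinite (viaHom φ)
  have card_eq : Nat.card G = Nat.card H * Nat.card φ.ker := by
    rw [Subgroup.card_eq_card_quotient_mul_card_subgroup φ.ker,
      Nat.card_congr (QuotientGroup.quotientKerEquivOfSurjective φ hs).toEquiv]
  have card_viaHom : Fintype.card (viaHom φ) = Nat.card H := Nat.card_eq_fintype_card.symm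
  refine mul_left_cancel₀ (Nat.cast_ne_zero.2 (Nat.card_pos (α := G)).ne') ?_
  rw [Burn.card_mul_mark_top_act_idem]
  simp only [isLinked_viaHom hs, rightStab_viaHom, if_true, Finset.sum_const, Finset.card_univ,
    card_viaHom, nsmul_eq_mul]
  rw [card_eq, Nat.cast_mul, mul_assoc]

theorem SubFun.idem_mem_of_surjective [Fact p.Prime] [Finite G] [Finite H]
    (F : SubFun (burnside.{u, v} p K)) {φ : G →* H} (hs : Function.Surjective φ)
    (hφ : IsPPrimeGroup p φ.ker) (hm : deflationNumber φ.ker ≠ 0)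
    (h : Burn.idem K G ∈ F.eval G) : Burn.idem K H ∈ F.eval H := by
  refine F.idem_mem_of_mark_top_ne_zero
    (F.act_mem (Groth.mk K (viaHom φ) (isBifree_viaHom hφ)) h) ?_
  rw [Burn.mark_top_act_viaHom_idem hs hφ]
  exact Rat.cast_ne_zero.2 hm

end Deflation

theorem BGroup.cls_eq_cls_iff {p : ℕ} {G H : BGroup.{v} p} :
    G.cls = H.cls ↔ Nonempty (G.1 ≃* H.1) :=
  Quotient.eq (r := isoSetoid p)

section ESub

variable {p : ℕ} [Fact p.Prime] {K : Type u} [Field K] {G H : FiniteGrp.{v}}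

theorem eSub_le_iff {F : SubFun (burnside.{u, v} p K)} :
    eSub K p G ≤ F ↔ Burn.idem K G ∈ F.eval G :=
  ⟨fun h => h _ SubFun.self_mem_generate, fun h => SubFun.generate_le h⟩

theorem idem_mem_eSub (G : FiniteGrp.{v}) : Burn.idem K G ∈ (eSub K p G).eval G :=
  eSub_le_iff.1 le_rfl

theorem mem_eSub_iff {x : Burn K H} :
    x ∈ (eSub K p G).eval H ↔ ∃ f : BDelta p K H G, Burn.act f (Burn.idem K G) = x :=
  SetLike.ext_iff.1 (congrFun (congrArg SubFun.obj (SubFun.generate_eq_rangeEvalAt _)) _) x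

theorem jSub_le_iff {F : SubFun (burnside.{u, v} p K)} :
    jSub K p G ≤ F ↔
      ∀ H : BGroup.{v} p, Dominates p H.1 G → ¬ Nonempty (H.1 ≃* G) → eSub K p H.1 ≤ F := by
  simp only [jSub, iSup_le_iff]

variable [CharZero K]

theorem eSub_le_of_dominates (h : Dominates p G H) : eSub K p G ≤ eSub K p H := by
  obtain ⟨φ, hs, hφ⟩ := h.exists_hom
  rw [eSub_le_iff]
  have := (eSub K p H).mark_range_smul_idem_mem hφ (idem_mem_eSub H)
  rwa [MonoidHom.range_eq_top.2 hs, mark_top_idem, one_smul] at this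

variable (K) in
theorem eSub_eq_of_mulEquiv (e : G ≃* H) : eSub K p G = eSub K p H :=
  le_antisymm (eSub_le_of_dominates (dominates_of_mulEquiv e))
    (eSub_le_of_dominates (dominates_of_mulEquiv e.symm))

variable (K) in
theorem eSub_eq_of_cls_eq {G H : BGroup.{v} p} (h : G.cls = H.cls) :
    eSub K p G.1 = eSub K p H.1 :=
  eSub_eq_of_mulEquiv K (BGroup.cls_eq_cls_iff.1 h).some

theorem eSub_quotient_eq (N : Subgroup G) [N.Normal] (hN : IsPPrimeGroup p N)
    (hm : deflationNumber N ≠ 0) : eSub K p (FiniteGrp.of (G ⧸ N)) = eSub K p G := by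
  refine le_antisymm (eSub_le_iff.2 ?_) (eSub_le_of_dominates ⟨N, ‹_›, hN, ⟨MulEquiv.refl _⟩⟩)
  rw [← QuotientGroup.ker_mk' N] at hN hm
  exact (eSub K p G).idem_mem_of_surjective (QuotientGroup.mk'_surjective N) hN hm (idem_mem_eSub G)

variable (p K) in
theorem exists_bGroup_eSub_eq (G : FiniteGrp.{v}) :
    ∃ H : BGroup.{v} p, eSub K p G = eSub K p H.1 := by
  induction hn : Nat.card G using Nat.strong_induction_on generalizing G with
  | _ n ih =>
    by_cases hG : IsBGroup p G
    · exact ⟨⟨G, hG⟩, rfl⟩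
    unfold IsBGroup at hG
    push Not at hG
    obtain ⟨N, hN, hbot, hp, hm⟩ := hG
    have card_lt : Nat.card (FiniteGrp.of (G ⧸ N)) < n := by
      rw [← hn, Subgroup.card_eq_card_quotient_mul_card_subgroup N]
      exact lt_mul_of_one_lt_right Nat.card_pos (N.one_lt_card_iff_ne_bot.2 hbot)
    rw [← eSub_quotient_eq N hp hm]
    exact ih _ card_lt _ rfl

variable (K) in
theorem dominates_of_eSub_le {H : BGroup.{v} p} (h : eSub K p G ≤ eSub K p H.1) :
    Dominates p G H.1 := by
  obtain ⟨f, hf⟩ := mem_eSub_iff.1 (eSub_le_iff.1 h)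
  refine dominates_of_mark_top_ne_zero (K := K) H.2 f ?_
  rw [hf, mark_top_idem]
  exact one_ne_zero

theorem exists_eSub_le_of_mem {F : SubFun (burnside.{u, v} p K)} {x : Burn K G}
    (hx : x ∈ F.eval G) (h0 : x ≠ 0) :
    ∃ L : Subgroup G, eSub K p (FiniteGrp.of L) ≤ F := by
  contrapose! h0
  refine Burn.ext_mark fun L => ?_
  rw [map_zero]
  by_contra hL
  exact h0 L (eSub_le_iff.2 (F.idem_mem_of_mark_ne_zero hx hL))

theorem card_le_of_mem_eSub {H : BGroup.{v} p} {x : Burn K G} (hx : x ∈ (eSub K p H.1).eval G)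
    (h0 : x ≠ 0) : Nat.card H.1 ≤ Nat.card G := by
  obtain ⟨L, hL⟩ := exists_eSub_le_of_mem hx h0
  exact (dominates_of_eSub_le K hL).card_le.trans (Subgroup.card_le_card_group L)

theorem le_of_forall_eSub_le {F F' : SubFun (burnside.{u, v} p K)}
    (h : ∀ H : BGroup.{v} p, eSub K p H.1 ≤ F → eSub K p H.1 ≤ F') : F ≤ F' := by
  intro G x hx
  refine F'.mem_of_idem_mem (G := G.grp) (x := x) fun L hL => ?_
  obtain ⟨H, hH⟩ := exists_bGroup_eSub_eq p K (FiniteGrp.of L)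
  have := h H (hH ▸ eSub_le_iff.2 (F.idem_mem_of_mark_ne_zero hx hL))
  exact eSub_le_iff.1 (hH ▸ this)

theorem exists_eSub_le_of_le_sSup {s : Set (SubFun (burnside.{u, v} p K))}
    (h : eSub K p G ≤ sSup s) : ∃ F ∈ s, eSub K p G ≤ F := by
  by_contra! hs
  have sSup_le_ker : (sSup s).eval G ≤ LinearMap.ker (Burn.mark K (⊤ : Subgroup G)) := by
    change (⨆ F ∈ s, F.eval G) ≤ _
    refine iSup₂_le fun F hF x hx => ?_
    by_contra hx'
    exact hs F hF (eSub_le_iff.2 (F.idem_mem_of_mark_top_ne_zero hx hx'))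
  have mark_eq_zero := LinearMap.mem_ker.1 (sSup_le_ker (eSub_le_iff.1 h))
  rw [mark_top_idem] at mark_eq_zero
  exact one_ne_zero mark_eq_zero

theorem exists_eSub_le_of_le_iSup {ι : Sort*} {F : ι → SubFun (burnside.{u, v} p K)}
    (h : eSub K p G ≤ ⨆ i, F i) : ∃ i, eSub K p G ≤ F i :=
  Set.exists_range_iff.1 (exists_eSub_le_of_le_sSup h)

theorem eSub_le_sup {F F' : SubFun (burnside.{u, v} p K)} (h : eSub K p G ≤ F ⊔ F') :
    eSub K p G ≤ F ∨ eSub K p G ≤ F' := by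
  rw [← sSup_pair] at h
  obtain ⟨A, rfl | rfl, hA⟩ := exists_eSub_le_of_le_sSup h
  · exact Or.inl hA
  · exact Or.inr hA

theorem eSub_le_iSup_cls_iff {A : Set (BGroupClass.{v} p)} (hA : IsClosedClass A)
    {G : BGroup.{v} p} :
    eSub K p G.1 ≤ ⨆ (H : BGroup.{v} p) (_ : H.cls ∈ A), eSub K p H.1 ↔ G.cls ∈ A := by
  refine ⟨fun h => ?_, fun h => le_iSup₂_of_le G h le_rfl⟩
  obtain ⟨H, h⟩ := exists_eSub_le_of_le_iSup h
  obtain ⟨hH, h⟩ := exists_eSub_le_of_le_iSup h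
  exact hA G H hH (dominates_of_eSub_le K h)

/-- The set of the classes of the `B^Δ_p`-groups `H` with `e^Δ_H ⊆ F`. -/
def bGroupClasses (F : SubFun (burnside.{u, v} p K)) :
    {A : Set (BGroupClass.{v} p) // IsClosedClass A} :=
  ⟨{c | ∃ H : BGroup.{v} p, H.cls = c ∧ eSub K p H.1 ≤ F}, fun G _ ⟨_, hc, hF⟩ hGH =>
    ⟨G, rfl, (eSub_le_of_dominates hGH).trans (eSub_eq_of_cls_eq K hc ▸ hF)⟩⟩

theorem cls_mem_bGroupClasses {F : SubFun (burnside.{u, v} p K)} {G : BGroup.{v} p} :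
    G.cls ∈ (bGroupClasses F).1 ↔ eSub K p G.1 ≤ F :=
  ⟨fun ⟨_, hc, hF⟩ => eSub_eq_of_cls_eq K hc ▸ hF, fun h => ⟨G, rfl, h⟩⟩

variable (p K) in
/-- The isomorphism from the lattice of subfunctors of `K B` to the lattice of closed sets of
classes of `B^Δ_p`-groups. -/
def subFunOrderIso :
    SubFun (burnside.{u, v} p K) ≃o {A : Set (BGroupClass.{v} p) // IsClosedClass A} where
  toFun := bGroupClasses
  invFun A := ⨆ (H : BGroup.{v} p) (_ : H.cls ∈ A.1), eSub K p H.1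
  left_inv F := by
    refine le_antisymm (iSup₂_le fun H hH => cls_mem_bGroupClasses.1 hH) ?_
    exact le_of_forall_eSub_le fun H hH =>
      (eSub_le_iSup_cls_iff (bGroupClasses F).2).2 (cls_mem_bGroupClasses.2 hH)
  right_inv A := by
    refine Subtype.ext (Set.ext (Quotient.forall.2 fun G => ?_))
    exact cls_mem_bGroupClasses.trans (eSub_le_iSup_cls_iff A.2)
  map_rel_iff' := by
    refine ⟨fun h => le_of_forall_eSub_le fun H hH => ?_, fun h c => ?_⟩
    · exact cls_mem_bGroupClasses.1 (h (cls_mem_bGroupClasses.2 hH))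
    · rintro ⟨H, hc, hH⟩
      exact ⟨H, hc, hH.trans h⟩

/-! ### The maximal subfunctor of `e^Δ_G` -/

theorem not_eSub_le_jSub (G : BGroup.{v} p) : ¬ eSub K p G.1 ≤ jSub K p G.1 := by
  intro h
  obtain ⟨H, h⟩ := exists_eSub_le_of_le_iSup h
  obtain ⟨hd, h⟩ := exists_eSub_le_of_le_iSup h
  obtain ⟨hn, h⟩ := exists_eSub_le_of_le_iSup h
  exact hn (hd.nonempty_mulEquiv (dominates_of_eSub_le K h).card_le)

theorem le_jSub_of_lt {G : BGroup.{v} p} {F : SubFun (burnside.{u, v} p K)}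
    (hF : F < eSub K p G.1) : F ≤ jSub K p G.1 := by
  refine le_of_forall_eSub_le fun H hH => ?_
  refine le_iSup_of_le H (le_iSup₂_of_le (dominates_of_eSub_le K (hH.trans hF.le)) ?_ le_rfl)
  rintro ⟨e⟩
  exact hF.not_ge ((eSub_eq_of_mulEquiv K e).symm.le.trans hH)

theorem jSub_covBy_eSub (G : BGroup.{v} p) : jSub K p G.1 ⋖ eSub K p G.1 := by
  refine ⟨lt_of_le_not_ge (jSub_le_iff.2 fun _ h _ => eSub_le_of_dominates h)
    (not_eSub_le_jSub G), fun F hj he => ?_⟩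
  exact hj.not_ge (le_jSub_of_lt he)

theorem eSub_inf_eq_jSub {G : BGroup.{v} p} {F : SubFun (burnside.{u, v} p K)}
    (hG : ¬ eSub K p G.1 ≤ F) (hj : jSub K p G.1 ≤ F) : eSub K p G.1 ⊓ F = jSub K p G.1 :=
  le_antisymm (le_jSub_of_lt (inf_lt_left.2 hG)) (le_inf (jSub_covBy_eSub G).le hj)

section CovBy

theorem sup_eq_of_covBy {α : Type*} [SemilatticeSup α] {a b c : α} (h : a ⋖ b) (hc : c ≤ b)
    (hca : ¬ c ≤ a) : c ⊔ a = b :=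
  (h.eq_or_eq le_sup_right (sup_le hc h.le)).resolve_left fun h => hca (sup_eq_right.1 h)

variable {F F' : SubFun (burnside.{u, v} p K)} {G H : BGroup.{v} p}

theorem exists_eSub_le_of_lt (h : F < F') :
    ∃ G : BGroup.{v} p, eSub K p G.1 ≤ F' ∧ ¬ eSub K p G.1 ≤ F := by
  contrapose! h
  exact fun hF => hF.not_ge (le_of_forall_eSub_le h)

theorem dominates_of_covBy (h : F ⋖ F') (hG : eSub K p G.1 ≤ F') (hG' : ¬ eSub K p G.1 ≤ F)
    (hH : eSub K p H.1 ≤ F') (hH' : ¬ eSub K p H.1 ≤ F) : Dominates p H.1 G.1 := by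
  rw [← sup_eq_of_covBy h hG hG'] at hH
  exact dominates_of_eSub_le K ((eSub_le_sup hH).resolve_right hH')

theorem nonempty_mulEquiv_of_covBy (h : F ⋖ F') (hG : eSub K p G.1 ≤ F')
    (hG' : ¬ eSub K p G.1 ≤ F) (hH : eSub K p H.1 ≤ F') (hH' : ¬ eSub K p H.1 ≤ F) :
    Nonempty (H.1 ≃* G.1) :=
  (dominates_of_covBy h hG hG' hH hH').nonempty_mulEquiv
    (dominates_of_covBy h hH hH' hG hG').card_le

theorem eSub_inf_eq_jSub_of_covBy (h : F ⋖ F') (hG : eSub K p G.1 ≤ F')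
    (hG' : ¬ eSub K p G.1 ≤ F) : eSub K p G.1 ⊓ F = jSub K p G.1 := by
  refine eSub_inf_eq_jSub hG' (jSub_le_iff.2 fun H hd hn => ?_)
  by_contra hH
  exact hn (nonempty_mulEquiv_of_covBy h hG hG' ((eSub_le_of_dominates hd).trans hG) hH)

end CovBy

end ESub

/-! ### The endomorphisms of `G` modulo those that factor through smaller groups -/

namespace FinBiset

variable {M H G : Type v} [Group M] [Group H] [Group G]

/-- The isomorphism `W ×_M Y ≅ X` induced by an `M`-balanced map `W × Y → X` compatible with the
outer actions, when that map is onto and has the `M`-orbits as its fibres. -/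
def isoOfBalanced {W : FinBiset H M} {Y : FinBiset M G} {X : FinBiset H G} (f : W → Y → X)
    (hf : ∀ w (m : M) y, f (op m • w) y = f w (m • y))
    (hl : ∀ (h : H) w y, f (h • w) y = h • f w y)
    (hr : ∀ (g : G) w y, f w (op g • y) = op g • f w y)
    (hinj : ∀ w w' y y', f w y = f w' y' → ∃ m : M, w' = op m • w ∧ y = m • y')
    (hsurj : ∀ x, ∃ w y, f w y = x) : Iso (tensor W Y) X where
  toEquiv := Equiv.ofBijective (tlift f hf) <| by
    refine ⟨fun s t hst => ?_, fun x => ?_⟩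
    · obtain ⟨w, y, rfl⟩ := tmk_surj s
      obtain ⟨w', y', rfl⟩ := tmk_surj t
      exact tmk_eq_iff.2 (hinj _ _ _ _ hst)
    · obtain ⟨w, y, rfl⟩ := hsurj x
      exact ⟨tmk w y, rfl⟩
  map_left h t := by
    obtain ⟨w, y, rfl⟩ := tmk_surj t
    exact hl h w y
  map_right g t := by
    obtain ⟨w, y, rfl⟩ := tmk_surj t
    exact hr g w y

section RightOrbit

variable {X : FinBiset H G}

/-- The right orbit of `x`, with the left action of `leftLink x`. -/
def rightOrbit (x : X) : FinBiset (leftLink x) G :=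
  letI : SMulCommClass (leftLink x) Gᵐᵒᵖ X := ⟨fun a b y => smul_comm a.1 b y⟩
  sub ⟨X⟩ {y : X | ∃ g : G, y = op g • x}
    (by
      rintro ⟨h, hh⟩ _ ⟨g, rfl⟩
      obtain ⟨k, hk⟩ := mem_leftLink.1 hh
      exact ⟨k * g, by change h • op g • x = _; rw [smul_comm, hk, op_mul, mul_smul]⟩)
    (by
      rintro k _ ⟨g, rfl⟩
      exact ⟨g * k.unop, by rw [op_mul, mul_smul, op_unop]⟩)

/-- A transitive biset is induced from the right orbit of any of its points. -/
def tensorRightOrbit [Finite H] {x : X} (hx : X.IsOrbitOf x) :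
    Iso (tensor (viaHom (leftLink x).subtype) (rightOrbit x)) X :=
  isoOfBalanced (fun (h : H) y => h • y.1) (fun (h : H) m y => mul_smul h m.1 y.1)
    (fun h (k : H) y => mul_smul h k y.1) (fun g (k : H) y => smul_comm k (op g) y.1)
    (by
      rintro (h : H) (h' : H) ⟨y, g, rfl⟩ ⟨y', g', rfl⟩ (e : h • op g • x = h' • op g' • x)
      have mem_link : h⁻¹ * h' ∈ leftLink x := mem_leftLink.2 ⟨g * g'⁻¹, by
        rw [mul_smul, op_mul, mul_smul, MulOpposite.op_inv, inv_smul_eq_iff, smul_comm h,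
          eq_inv_smul_iff, ← smul_comm h', ← e]⟩
      refine ⟨⟨h⁻¹ * h', mem_link⟩, (mul_inv_cancel_left h h').symm, Subtype.ext ?_⟩
      change op g • x = (h⁻¹ * h') • op g' • x
      rw [mul_smul, ← e, inv_smul_smul])
    (by
      intro y
      obtain ⟨h, g, rfl⟩ := hx y
      exact ⟨(h : H), ⟨op g • x, g, rfl⟩, rfl⟩)

theorem isBifree_rightOrbit [Finite H] {p : ℕ} (hX : X.IsBifree p) (x : X) :
    (rightOrbit x).IsBifree p := by
  intro y
  have right_eq : MulAction.stabilizer Gᵐᵒᵖ y = MulAction.stabilizer Gᵐᵒᵖ (y.1 : X) :=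
    Subgroup.ext fun _ => Subtype.ext_iff
  let f : MulAction.stabilizer (leftLink x) y →* MulAction.stabilizer H (y.1 : X) :=
    ((leftLink x).subtype.comp (Subgroup.subtype _)).codRestrict _
      fun m => congrArg Subtype.val m.2
  refine ⟨(hX y.1).1.of_injective f ?_, right_eq ▸ (hX y.1).2⟩
  intro a b hab
  have val_eq : (f a).1 = (f b).1 := congrArg Subtype.val hab
  exact Subtype.ext (Subtype.ext val_eq)

end RightOrbit

section QuotLeft

/-- A biset on which a normal subgroup `A` of `H` acts trivially, as an `(H ⧸ A, G)`-biset. -/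
def quotLeft (X : FinBiset H G) (A : Subgroup H) [A.Normal] (hA : ∀ a ∈ A, ∀ x : X, a • x = x) :
    FinBiset (H ⧸ A) G :=
  letI : MulAction (H ⧸ A) X := MulAction.compHom X
    (QuotientGroup.lift A (MulAction.toPermHom H X) fun a ha => Equiv.ext (hA a ha))
  { carrier := X
    comm := ⟨by
      intro c g x
      obtain ⟨h, rfl⟩ := QuotientGroup.mk_surjective c
      exact smul_comm h g x⟩ }

/-- A biset on which a normal subgroup of `H` acts trivially is inflated from the quotient. -/
def tensorQuotLeft [Finite H] (X : FinBiset H G) (A : Subgroup H) [A.Normal]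
    (hA : ∀ a ∈ A, ∀ x : X, a • x = x) :
    Iso (tensor (twist (QuotientGroup.mk' A) (ofGSet H PUnit.{v + 1})) (X.quotLeft A hA)) X :=
  isoOfBalanced (fun (c : PUnit.{v + 1} × (H ⧸ A)) (y : X.quotLeft A hA) => c.2 • y)
    (fun c m y => mul_smul (α := H ⧸ A) c.2 m y)
    (fun h c y => mul_smul (α := H ⧸ A) (h : H ⧸ A) c.2 y)
    (fun g c y => smul_comm (M := H ⧸ A) (N := Gᵐᵒᵖ) (α := X.quotLeft A hA) c.2 (op g) y)
    (by
      rintro ⟨⟨⟩, c⟩ ⟨⟨⟩, c'⟩ y y' e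
      refine ⟨c⁻¹ * c', Prod.ext rfl (mul_inv_cancel_left c c').symm, ?_⟩
      rw [mul_smul, eq_inv_smul_iff]
      exact e)
    (fun x => ⟨(⟨⟩, 1), x, one_smul (H ⧸ A) (α := X.quotLeft A hA) x⟩)

theorem isBifree_quotLeft {p : ℕ} [Fact p.Prime] {X : FinBiset H G} (hX : X.IsBifree p)
    (A : Subgroup H) [A.Normal] (hA : ∀ a ∈ A, ∀ x : X, a • x = x)
    (hA' : ∀ x : X, MulAction.stabilizer H x ≤ A) : (X.quotLeft A hA).IsBifree p := by
  refine fun x => ⟨isPPrimeGroup_of_eq_bot (eq_bot_iff.2 fun c hc => ?_), (hX x).2⟩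
  obtain ⟨h, rfl⟩ := QuotientGroup.mk_surjective c
  exact (QuotientGroup.eq_one_iff h).2 (hA' x hc)

end QuotLeft

theorem IsBifree.of_injective {p : ℕ} {X Y : FinBiset H G} (hY : Y.IsBifree p) {f : X → Y}
    (hf : Function.Injective f) (hl : ∀ (h : H) x, f (h • x) = h • f x)
    (hr : ∀ (g : Gᵐᵒᵖ) x, f (g • x) = g • f x) : X.IsBifree p := by
  intro x
  have left_eq : MulAction.stabilizer H (f x) = MulAction.stabilizer H x := by
    ext h
    rw [MulAction.mem_stabilizer_iff, ← hl, hf.eq_iff, MulAction.mem_stabilizer_iff]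
  have right_eq : MulAction.stabilizer Gᵐᵒᵖ (f x) = MulAction.stabilizer Gᵐᵒᵖ x := by
    ext g
    rw [MulAction.mem_stabilizer_iff, ← hr, hf.eq_iff, MulAction.mem_stabilizer_iff]
  exact left_eq ▸ right_eq ▸ hY (f x)

theorem IsBifree.of_sum {p : ℕ} {X Y Z : FinBiset H G} (e : Iso Z (X.sum Y)) (hZ : Z.IsBifree p) :
    X.IsBifree p ∧ Y.IsBifree p :=
  ⟨hZ.of_injective (f := fun x => e.symm.toEquiv (inl x))
      (e.symm.toEquiv.injective.comp Sum.inl_injective)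
      (fun h x => e.symm.map_left h (inl x)) fun g x => e.symm.map_right g.unop (inl x),
    hZ.of_injective (f := fun y => e.symm.toEquiv (inr y))
      (e.symm.toEquiv.injective.comp Sum.inr_injective)
      (fun h y => e.symm.map_left h (inr y)) fun g y => e.symm.map_right g.unop (inr y)⟩

theorem injective_smul_of_stabilizer_eq_bot {A Y : Type*} [Group A] [MulAction A Y] {y : Y}
    (hy : MulAction.stabilizer A y = ⊥) : Function.Injective fun a : A => a • y := by
  intro a b hab
  have mem_stabilizer : b⁻¹ * a ∈ MulAction.stabilizer A y := by
    rw [MulAction.mem_stabilizer_iff, mul_smul, inv_smul_eq_iff]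
    exact hab
  rw [hy, Subgroup.mem_bot] at mem_stabilizer
  exact (inv_mul_eq_one.1 mem_stabilizer).symm

namespace IsOrbitOf

variable {X : FinBiset H G} {x : X}

theorem exists_eq_op_smul (hx : X.IsOrbitOf x) (hl : leftLink x = ⊤) (y : X) :
    ∃ g : G, y = op g • x := by
  obtain ⟨h, g, rfl⟩ := hx y
  obtain ⟨k, hk⟩ := exists_of_leftLink_eq_top hl h
  exact ⟨k * g, by rw [smul_comm, hk, op_mul, mul_smul]⟩

theorem stabilizer_eq (hx : X.IsOrbitOf x) (hl : leftLink x = ⊤) (y : X) :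
    MulAction.stabilizer H y = MulAction.stabilizer H x := by
  obtain ⟨g, rfl⟩ := hx.exists_eq_op_smul hl y
  ext h
  rw [MulAction.mem_stabilizer_iff, MulAction.mem_stabilizer_iff, smul_comm, smul_left_cancel_iff]

theorem stabilizer_normal (hx : X.IsOrbitOf x) (hl : leftLink x = ⊤) :
    (MulAction.stabilizer H x).Normal := by
  refine ⟨fun a ha h => ?_⟩
  rw [← hx.stabilizer_eq hl (h⁻¹ • x), MulAction.mem_stabilizer_iff] at ha
  rw [MulAction.mem_stabilizer_iff, mul_smul, mul_smul, ha, smul_inv_smul]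

theorem rightStab_eq_bot {X : FinBiset G G} {x : X} [Finite G] (hx : X.IsOrbitOf x)
    (hl : leftLink x = ⊤) (hs : MulAction.stabilizer G x = ⊥) : rightStab x = ⊥ := by
  have surjective : Function.Surjective fun g : G => op g • x := fun y =>
    (hx.exists_eq_op_smul hl y).imp fun _ => Eq.symm
  have injective : Function.Injective fun g : G => g • x :=
    injective_smul_of_stabilizer_eq_bot hs
  have bijective := (Nat.bijective_iff_surjective_and_card _).2 ⟨surjective,
    (Nat.card_le_card_of_injective _ injective).antisymm
      (Nat.card_le_card_of_surjective _ surjective)⟩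
  exact (Subgroup.eq_bot_iff_forall _).2 fun g hg =>
    bijective.1 (hg.trans (one_smul Gᵐᵒᵖ x).symm)

theorem exists_iso_ofAut {X : FinBiset G G} {x : X} [Finite G] (hx : X.IsOrbitOf x)
    (hl : leftLink x = ⊤) (hs : MulAction.stabilizer G x = ⊥) :
    ∃ θ : MulAut G, Nonempty (Iso (ofAut θ) X) := by
  obtain ⟨φ, hφ⟩ := exists_hom_of_rightStab_eq_bot hl (hx.rightStab_eq_bot hl hs)
  have smul_injective : Function.Injective fun g : G => g • x :=
    injective_smul_of_stabilizer_eq_bot hs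
  have injective : Function.Injective φ := fun a b hab => smul_injective <| by
    change a • x = b • x
    rw [hφ, hφ, hab]
  let e : G ≃* G := MulEquiv.ofBijective φ (Finite.injective_iff_bijective.1 injective)
  have symm_smul (g : G) : e.symm g • x = op g • x :=
    (hφ _).trans (congrArg (fun g => op g • x) (e.apply_symm_apply g))
  have smul_surjective : Function.Surjective fun g : G => g • x := fun y => by
    obtain ⟨g, rfl⟩ := hx.exists_eq_op_smul hl y
    exact ⟨e.symm g, symm_smul g⟩
  refine ⟨e.symm, ⟨Equiv.ofBijective _ ⟨smul_injective, smul_surjective⟩, ?_, ?_⟩⟩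
  · exact fun h k => mul_smul h (k : G) x
  · intro g (k : G)
    change (k * e.symm g) • x = op g • k • x
    rw [mul_smul, symm_smul, smul_comm]

end IsOrbitOf

end FinBiset

section SmallIdeal

variable {p : ℕ} [Fact p.Prime] {R : Type u} [CommRing R] {G : BifreeCat.{u, v} p R}

theorem mk_mem_smallIdeal {M : Type v} [Group M] [Finite M] (hM : Nat.card M < Nat.card G.grp)
    {X : FinBiset G.grp G.grp} (hX : X.IsBifree p) {W : FinBiset G.grp M} (hW : W.IsBifree p)
    {Y : FinBiset M G.grp} (hY : Y.IsBifree p) (e : FinBiset.Iso (W.tensor Y) X) :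
    (Groth.mk R X hX : G ⟶ G) ∈ G.smallIdeal := by
  refine Submodule.subset_span
    ⟨BifreeCat.of (FiniteGrp.of M), Groth.mk R Y hY, Groth.mk R W hW, hM, ?_⟩
  exact (Groth.mk_iso (isBifree_empty _ _ _) hX (hW.tensor hY) e.symm).trans
    (Groth.comp_mk _ _ _ _ _).symm

variable {X : FinBiset G.grp G.grp} {x : X}

theorem mk_mem_smallIdeal_of_leftLink_ne_top (hX : X.IsBifree p) (hx : X.IsOrbitOf x)
    (hl : FinBiset.leftLink x ≠ ⊤) : (Groth.mk R X hX : G ⟶ G) ∈ G.smallIdeal := by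
  have card_lt : Nat.card (FinBiset.leftLink x) < Nat.card G.grp :=
    lt_of_le_of_ne (Subgroup.card_le_card_group _) fun h => hl (Subgroup.eq_top_of_card_eq _ h)
  exact mk_mem_smallIdeal card_lt hX
    (FinBiset.isBifree_viaHom (isPPrimeGroup_ker_of_injective (Subgroup.subtype_injective _)))
    (FinBiset.isBifree_rightOrbit hX x) (FinBiset.tensorRightOrbit hx)

theorem mk_mem_smallIdeal_of_stabilizer_ne_bot (hX : X.IsBifree p) (hx : X.IsOrbitOf x)
    (hl : FinBiset.leftLink x = ⊤) (hs : MulAction.stabilizer G.grp x ≠ ⊥) :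
    (Groth.mk R X hX : G ⟶ G) ∈ G.smallIdeal := by
  have := hx.stabilizer_normal hl
  set A := MulAction.stabilizer G.grp x
  have smul_eq (a : G.grp) (ha : a ∈ A) (y : X) : a • y = y :=
    MulAction.mem_stabilizer_iff.1 (hx.stabilizer_eq hl y ▸ ha)
  have card_lt : Nat.card (G.grp ⧸ A) < Nat.card G.grp := by
    rw [Subgroup.card_eq_card_quotient_mul_card_subgroup A]
    exact lt_mul_of_one_lt_right Nat.card_pos (A.one_lt_card_iff_ne_bot.2 hs)
  refine mk_mem_smallIdeal card_lt hX (FinBiset.isBifree_twist ?_ _)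
    (FinBiset.isBifree_quotLeft hX A smul_eq fun y => (hx.stabilizer_eq hl y).le)
    (X.tensorQuotLeft A smul_eq)
  rw [QuotientGroup.ker_mk']
  exact (hX x).1

theorem span_isoAut_sup_smallIdeal (G : BifreeCat.{u, v} p R) :
    Submodule.span R (Set.range (BifreeCat.isoAut (G := G))) ⊔ G.smallIdeal = ⊤ := by
  refine Groth.eq_top_of_orbits_mem (fun _ _ _ e hZ => hZ.of_sum e) fun X x hX hx => ?_
  by_cases hl : FinBiset.leftLink x = ⊤
  · by_cases hs : MulAction.stabilizer G.grp x = ⊥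
    · obtain ⟨θ, ⟨e⟩⟩ := hx.exists_iso_ofAut hl hs
      exact Submodule.mem_sup_left
        (Submodule.subset_span ⟨θ, Groth.mk_iso (isBifree_empty _ _ _) _ _ e⟩)
    · exact Submodule.mem_sup_right (mk_mem_smallIdeal_of_stabilizer_ne_bot hX hx hl hs)
  · exact Submodule.mem_sup_right (mk_mem_smallIdeal_of_leftLink_ne_top hX hx hl)

end SmallIdeal

/-! ### Subquotients -/

namespace SubFun

variable {p : ℕ} [Fact p.Prime] {R : Type u} [CommRing R]
variable {F F' F'' : BifreeCat.{u, v} p R ⥤ ModuleCat.{w} R}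

theorem naturality_apply (η : F ⟶ F') {G H : BifreeCat.{u, v} p R} (f : G ⟶ H) (x : F.obj G) :
    (η.app H).hom ((F.map f).hom x) = (F'.map f).hom ((η.app G).hom x) :=
  congrArg (fun l => l.hom x) (η.naturality f)

/-- The preimage of a subfunctor under a natural transformation. -/
def comap (η : F ⟶ F') (A : SubFun F') : SubFun F where
  obj G := (A.obj G).comap (η.app G).hom
  map_mem f x hx := by
    rw [Submodule.mem_comap, naturality_apply]
    exact A.map_mem f _ hx

/-- The image of a subfunctor under a natural transformation. -/
def map (η : F ⟶ F') (A : SubFun F) : SubFun F' where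
  obj G := (A.obj G).map (η.app G).hom
  map_mem := by
    rintro G H f _ ⟨x, hx, rfl⟩
    exact ⟨_, A.map_mem f x hx, naturality_apply η f x⟩

theorem comap_mono (η : F ⟶ F') : Monotone (comap η) :=
  fun _ _ h G => Submodule.comap_mono (h G)

theorem map_mono (η : F ⟶ F') : Monotone (map η) :=
  fun _ _ h G => Submodule.map_mono (h G)

theorem comap_comap_eq_self {η : F ⟶ F'} {θ : F' ⟶ F} (h : η ≫ θ = 𝟙 F) (A : SubFun F) :
    comap η (comap θ A) = A :=
  congrArg (fun ζ => comap ζ A) h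

/-- Isomorphic functors have isomorphic lattices of subfunctors. -/
def orderIsoOfIso (e : F ≅ F') : SubFun F ≃o SubFun F' :=
  Equiv.toOrderIso
    ⟨comap e.inv, comap e.hom, comap_comap_eq_self e.hom_inv_id, comap_comap_eq_self e.inv_hom_id⟩
    (comap_mono e.inv) (comap_mono e.hom)

/-- The inclusion of a subfunctor. -/
def incl (B : SubFun F) : B.toFunctor ⟶ F where
  app G := ModuleCat.ofHom (B.obj G).subtype

/-- The projection onto a quotient functor. -/
def proj (A : SubFun F) : F ⟶ A.quotient where
  app G := ModuleCat.ofHom (A.obj G).mkQ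

/-- The subfunctors of a subfunctor `B` of `F` are the subfunctors of `F` contained in `B`. -/
def orderIsoIic (B : SubFun F) : SubFun B.toFunctor ≃o Set.Iic B :=
  Equiv.toOrderIso
    { toFun := fun C => ⟨map B.incl C, fun G => Submodule.map_subtype_le _ (C.obj G)⟩
      invFun := fun A => A.1.restrict B
      left_inv := fun C => SubFun.ext <| funext fun G =>
        Submodule.comap_map_eq_of_injective (Submodule.subtype_injective _) (C.obj G)
      right_inv := fun A => Subtype.ext <| SubFun.ext <| funext fun G =>
        (Submodule.map_comap_subtype _ _).trans (inf_eq_right.2 (A.2 G)) }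
    (map_mono B.incl) fun _ _ h => comap_mono B.incl h

/-- The subfunctors of a quotient `F / A` are the subfunctors of `F` that contain `A`. -/
def orderIsoIci (A : SubFun F) : SubFun A.quotient ≃o Set.Ici A :=
  Equiv.toOrderIso
    { toFun := fun D => ⟨comap A.proj D, fun G => Submodule.le_comap_mkQ _ (D.obj G)⟩
      invFun := fun C => map A.proj C.1
      left_inv := fun D => SubFun.ext <| funext fun G =>
        Submodule.map_comap_eq_of_surjective (Submodule.mkQ_surjective _) (D.obj G)
      right_inv := fun C => Subtype.ext <| SubFun.ext <| funext fun G =>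
        (Submodule.comap_map_mkQ _ _).trans (sup_eq_right.2 (C.2 G)) }
    (comap_mono A.proj) fun _ _ h => map_mono A.proj h

theorem isSimpleFunctor_congr (e : F ≅ F') : IsSimpleFunctor F ↔ IsSimpleFunctor F' :=
  (orderIsoOfIso e).isSimpleOrder_iff

theorem isSimpleFunctor_subquotient_iff {A B : SubFun F} (h : A ≤ B) :
    IsSimpleFunctor (A.subquotient B) ↔ A ⋖ B := by
  rw [covBy_iff_coatom_Iic h, ← (orderIsoIic B).symm.isCoatom_iff,
    ← Set.isSimpleOrder_Ici_iff_isCoatom]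
  exact (orderIsoIci (A.restrict B)).isSimpleOrder_iff

/-- The first isomorphism theorem. -/
def quotientIso (A : SubFun F) (η : F ⟶ F') (hs : ∀ G, Function.Surjective (η.app G).hom)
    (h : comap η ⊥ = A) : A.quotient ≅ F' :=
  NatIso.ofComponents
    (fun G => LinearEquiv.toModuleIso (X₁ := F.obj G ⧸ A.obj G)
      ((Submodule.quotEquivOfEq _ _ (congrFun (congrArg obj h.symm) G)).trans
        ((η.app G).hom.quotKerEquivOfSurjective (hs G))))
    fun f => ModuleCat.hom_ext <| Submodule.linearMap_qext _ <|
      LinearMap.ext fun x => naturality_apply η f x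

/-- The inclusion of a subfunctor `C` of `B` into `B`. -/
def inclusion {B C : SubFun F} (h : C ≤ B) : C.toFunctor ⟶ B.toFunctor where
  app G := ModuleCat.ofHom (Submodule.inclusion (h G))

/-- The second isomorphism theorem. -/
def supQuotientIso (A C : SubFun F) : (C ⊓ A).subquotient C ≅ A.subquotient (C ⊔ A) :=
  quotientIso _ (inclusion le_sup_left ≫ (A.restrict (C ⊔ A)).proj)
    (by
      intro G q
      obtain ⟨⟨_, hx⟩, rfl⟩ := Submodule.mkQ_surjective ((A.restrict (C ⊔ A)).obj G) q
      obtain ⟨c, hc, a, ha, rfl⟩ := Submodule.mem_sup.1 hx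
      refine ⟨⟨c, hc⟩, (Submodule.Quotient.eq ((A.restrict (C ⊔ A)).obj G)).2 ?_⟩
      change c - (c + a) ∈ A.obj G
      rwa [sub_add_cancel_left, neg_mem_iff])
    (by
      refine SubFun.ext <| funext fun G => Submodule.ext fun x => ?_
      refine (Submodule.Quotient.mk_eq_zero ((A.restrict (C ⊔ A)).obj G)).trans ?_
      exact (and_iff_right x.2).symm)

end SubFun

/-! ### The simple functors with trivial coefficients -/

namespace SubFun

variable {p : ℕ} [Fact p.Prime] {R : Type u} [CommRing R]
variable {F F' : BifreeCat.{u, v} p R ⥤ ModuleCat.{w} R}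

/-- The natural transformation from a quotient of `F` induced by a natural transformation from `F`
that vanishes on `A`. -/
def quotientLift (A : SubFun F) (η : F ⟶ F') (h : A ≤ comap η ⊥) : A.quotient ⟶ F' where
  app G := ModuleCat.ofHom ((A.obj G).liftQ (η.app G).hom (h G))
  naturality _ _ f :=
    ModuleCat.hom_ext <| Submodule.linearMap_qext _ <| LinearMap.ext fun x => naturality_apply η f x

instance [F.Additive] (A B : SubFun F) : (A.subquotient B).Additive :=
  inferInstanceAs (A.restrict B).quotient.Additive

instance [F.Linear R] (A B : SubFun F) : (A.subquotient B).Linear R :=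
  inferInstanceAs ((A.restrict B).quotient.Linear R)

/-- The projection of `B(G)` onto `(B / A)(G)`. -/
def subquotientMk (A B : SubFun F) (G : BifreeCat.{u, v} p R) :
    B.obj G →ₗ[R] (A.subquotient B).obj G :=
  ((A.restrict B).obj G).mkQ

theorem subquotientMk_surjective (A B : SubFun F) (G : BifreeCat.{u, v} p R) :
    Function.Surjective (subquotientMk A B G) :=
  Submodule.mkQ_surjective ((A.restrict B).obj G)

theorem subquotientMk_eq_zero_iff {A B : SubFun F} {G : BifreeCat.{u, v} p R} {x : B.obj G} :
    subquotientMk A B G x = 0 ↔ x.1 ∈ A.obj G :=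
  Submodule.Quotient.mk_eq_zero ((A.restrict B).obj G)

end SubFun

section TrivialVector

variable {p : ℕ} [Fact p.Prime] {R : Type u} [CommRing R] {G H : BifreeCat.{u, v} p R}

variable (G) in
/-- The functor `L_{G,R}` for the trivial module `R` of `Out(G)`. -/
abbrev functorLTriv : BifreeCat.{u, v} p R ⥤ ModuleCat.{max u (v + 1)} R :=
  functorL G (Representation.trivial R (Out G.grp) R)

/-- The class of `f ⊗ 1` in `L_{G,R}(H)`, as a linear function of `f`. -/
def functorLTrivMk (H : BifreeCat.{u, v} p R) : (G ⟶ H) →ₗ[R] (functorLTriv G).obj H :=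
  ((tensorRel G (Representation.trivial R (Out G.grp) R)).obj H).mkQ ∘ₗ
    (TensorProduct.rid R (G ⟶ H)).symm.toLinearMap

theorem functorLTrivMk_surjective : Function.Surjective (functorLTrivMk (G := G) H) :=
  (Submodule.mkQ_surjective
    ((tensorRel G (Representation.trivial R (Out G.grp) R)).obj H)).comp
    (TensorProduct.rid R (G ⟶ H)).symm.surjective

theorem functorLTrivMk_isoAut (θ : MulAut G.grp) :
    functorLTrivMk G (BifreeCat.isoAut θ) = functorLTrivMk G (𝟙 G) := by
  rw [← sub_eq_zero, ← map_sub]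
  refine (Submodule.Quotient.mk_eq_zero _).2 (Submodule.subset_span (Or.inl ⟨𝟙 G, θ, 1, ?_⟩))
  rw [Category.comp_id]
  exact TensorProduct.sub_tmul _ _ _

theorem functorLTrivMk_eq_zero {a : G ⟶ G} (ha : a ∈ G.smallIdeal) : functorLTrivMk G a = 0 := by
  refine (Submodule.Quotient.mk_eq_zero _).2 (Submodule.subset_span (Or.inr ⟨𝟙 G, a, 1, ha, ?_⟩))
  rw [Category.comp_id]
  rfl

theorem functorLTrivMk_mem_span (f : G ⟶ G) :
    functorLTrivMk G f ∈ Submodule.span R {functorLTrivMk G (𝟙 G)} := by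
  suffices h : ⊤ ≤ (Submodule.span R {functorLTrivMk G (𝟙 G)}).comap (functorLTrivMk G) from
    h Submodule.mem_top
  rw [← span_isoAut_sup_smallIdeal]
  refine sup_le (Submodule.span_le.2 ?_) fun a ha => ?_
  · rintro _ ⟨θ, rfl⟩
    exact Submodule.mem_span_singleton.2 ⟨1, by rw [one_smul, functorLTrivMk_isoAut]⟩
  · rw [Submodule.mem_comap, functorLTrivMk_eq_zero ha]
    exact zero_mem _

theorem exists_eq_smul_functorLTrivMk (s : (functorLTriv G).obj G) :
    ∃ r : R, s = r • functorLTrivMk G (𝟙 G) := by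
  obtain ⟨f, rfl⟩ := functorLTrivMk_surjective s
  obtain ⟨r, hr⟩ := Submodule.mem_span_singleton.1 (functorLTrivMk_mem_span f)
  exact ⟨r, hr.symm⟩

variable {F : BifreeCat.{u, v} p R ⥤ ModuleCat.{max u (v + 1)} R}

/-- An element `x` of `F(G)` that is fixed by the automorphisms of `G` and is sent to `0` by every
morphism from `G` to a group of smaller order, so that `r ↦ r x` is a morphism of `End(G)`-modules
from the trivial module. -/
structure IsTrivialVector (x : F.obj G) : Prop where
  map_isoAut : ∀ θ : MulAut G.grp, (F.map (BifreeCat.isoAut θ)).hom x = x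
  map_eq_zero : ∀ {H : BifreeCat.{u, v} p R} (f : G ⟶ H), Nat.card H.grp < Nat.card G.grp →
    (F.map f).hom x = 0

variable [F.Additive] [F.Linear R] {x : F.obj G}

theorem IsTrivialVector.evalAt_eq_zero (hx : IsTrivialVector x) {a : G ⟶ G}
    (ha : a ∈ G.smallIdeal) : evalAt x G a = 0 := by
  refine (Submodule.span_le (p := LinearMap.ker (evalAt x G))).2 ?_ ha
  rintro _ ⟨H, b, c, hlt, rfl⟩
  rw [SetLike.mem_coe, LinearMap.mem_ker, evalAt_comp, evalAt_apply, hx.map_eq_zero b hlt, map_zero]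

/-- The natural transformation `f ⊗ r ↦ r • F(f)(x)`. -/
def homTensorEval (x : F.obj G) : homTensor G R ⟶ F where
  app H := ModuleCat.ofHom (evalAt x H ∘ₗ (TensorProduct.rid R (G ⟶ H)).toLinearMap)
  naturality H H' g := by
    refine ModuleCat.hom_ext (TensorProduct.ext' fun f r => ?_)
    change evalAt x H' (r • (f ≫ g)) = (F.map g).hom (evalAt x H (r • f))
    rw [← Linear.smul_comp, evalAt_comp]

theorem IsTrivialVector.tensorRel_le (hx : IsTrivialVector x) :
    tensorRel G (Representation.trivial R (Out G.grp) R) ≤ SubFun.comap (homTensorEval x) ⊥ := by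
  refine fun H => Submodule.span_le.2 ?_
  rintro _ (⟨f, θ, r, rfl⟩ | ⟨f, a, r, ha, rfl⟩)
  · refine (map_sub ((homTensorEval x).app H).hom _ _).trans (sub_eq_zero.2 ?_)
    change evalAt x H (r • (BifreeCat.isoAut θ ≫ f)) = evalAt x H (r • f)
    rw [map_smul, map_smul, evalAt_comp, evalAt_apply, hx.map_isoAut, evalAt_apply]
  · change evalAt x H (r • (a ≫ f)) = 0
    rw [map_smul, evalAt_comp, hx.evalAt_eq_zero ha, map_zero, smul_zero]

/-- The natural transformation from `L_{G,R}` to `F` that sends the class of `1 ⊗ 1` to `x`. -/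
def IsTrivialVector.lift (hx : IsTrivialVector x) : functorLTriv G ⟶ F :=
  SubFun.quotientLift _ (homTensorEval x) hx.tensorRel_le

theorem IsTrivialVector.lift_mk (hx : IsTrivialVector x) (f : G ⟶ H) :
    (hx.lift.app H).hom (functorLTrivMk H f) = evalAt x H f :=
  congrArg (evalAt x H) ((TensorProduct.rid R (G ⟶ H)).apply_symm_apply f)

theorem mem_functorJ_iff {t : (functorLTriv G).obj H} :
    t ∈ (functorJ G (Representation.trivial R (Out G.grp) R)).obj H ↔
      ∀ y : H ⟶ G, ((functorLTriv G).map y).hom t = 0 := by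
  change t ∈ (⨅ y : H ⟶ G, LinearMap.ker ((functorLTriv G).map y).hom) ↔ _
  simp only [Submodule.mem_iInf, LinearMap.mem_ker]

theorem eq_zero_of_mem_functorJ {t : (functorLTriv G).obj G}
    (ht : t ∈ (functorJ G (Representation.trivial R (Out G.grp) R)).obj G) : t = 0 := by
  have := mem_functorJ_iff.1 ht (𝟙 G)
  rwa [CategoryTheory.Functor.map_id, ModuleCat.hom_id, LinearMap.id_apply] at this

end TrivialVector

section SimpleFunctor

variable {p : ℕ} [Fact p.Prime] {K : Type u} [Field K] {G : BifreeCat.{u, v} p K}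
  {F : BifreeCat.{u, v} p K ⥤ ModuleCat.{max u (v + 1)} K} [F.Additive] [F.Linear K] {x : F.obj G}

theorem IsTrivialVector.lift_app_injective (hx : IsTrivialVector x) (h0 : x ≠ 0) :
    Function.Injective (hx.lift.app G).hom := by
  refine (injective_iff_map_eq_zero _).2 fun s hs => ?_
  obtain ⟨c, rfl⟩ := exists_eq_smul_functorLTrivMk s
  rw [map_smul, hx.lift_mk, evalAt_id] at hs
  rw [(smul_eq_zero.1 hs).resolve_right h0, zero_smul]

theorem IsTrivialVector.lift_surjective (hx : IsTrivialVector x) (h0 : x ≠ 0)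
    (hF : IsSimpleFunctor F) (H : BifreeCat.{u, v} p K) :
    Function.Surjective (hx.lift.app H).hom := by
  have x_mem : x ∈ (SubFun.map hx.lift ⊤).obj G :=
    ⟨functorLTrivMk G (𝟙 G), trivial, (hx.lift_mk _).trans (evalAt_id x)⟩
  have map_eq_top : SubFun.map hx.lift ⊤ = ⊤ :=
    (hF.eq_bot_or_eq_top _).resolve_left fun h => h0 <| by
      rwa [h] at x_mem
  intro y
  obtain ⟨t, -, rfl⟩ := (map_eq_top ▸ trivial : y ∈ (SubFun.map hx.lift ⊤).obj H)
  exact ⟨t, rfl⟩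

theorem IsTrivialVector.comap_lift_bot (hx : IsTrivialVector x) (h0 : x ≠ 0)
    (hF : IsSimpleFunctor F) :
    SubFun.comap hx.lift ⊥ = functorJ G (Representation.trivial K (Out G.grp) K) := by
  refine le_antisymm (fun H t ht => mem_functorJ_iff.2 fun y => ?_) ?_
  · refine hx.lift_app_injective h0 ?_
    rw [SubFun.naturality_apply, LinearMap.mem_ker.1 ht, map_zero, map_zero]
  · have map_eq_bot : SubFun.map hx.lift (functorJ G _) = ⊥ := by
      refine (hF.eq_bot_or_eq_top _).resolve_right fun h => h0 ?_
      obtain ⟨t, ht, hxt⟩ := (h ▸ trivial : x ∈ (SubFun.map hx.lift (functorJ G _)).obj G)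
      rw [← hxt, eq_zero_of_mem_functorJ ht, map_zero]
    intro H t ht
    exact (map_eq_bot ▸ ⟨t, ht, rfl⟩ : (hx.lift.app H).hom t ∈ (⊥ : SubFun F).obj H)

/-- A simple functor with a nonzero trivial vector at `G` is isomorphic to `S^Δ_{G,K}`. -/
def IsTrivialVector.functorSTrivIso (hx : IsTrivialVector x) (h0 : x ≠ 0)
    (hF : IsSimpleFunctor F) : functorSTriv G ≅ F :=
  SubFun.quotientIso _ hx.lift (hx.lift_surjective h0 hF) (hx.comap_lift_bot h0 hF)

end SimpleFunctor

/-! ### Composition factors of the Burnside functor -/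

/-- `Iso(θ)` is the twist of the one-point set by `θ⁻¹`. -/
def FinBiset.ofAutIsoTwist {G : Type v} [Group G] [Finite G] (θ : MulAut G) :
    Iso (ofAut θ) (twist θ.symm.toMonoidHom (ofGSet G PUnit.{v + 1})) where
  toEquiv := θ.symm.toEquiv.trans (Equiv.punitProd G).symm
  map_left h x := Prod.ext rfl (map_mul θ.symm h x)
  map_right g x := Prod.ext rfl ((map_mul θ.symm (show G from x) (θ g)).trans
    (congrArg _ (θ.symm_apply_apply g)))

section BurnsideFactors

variable {p : ℕ} [Fact p.Prime] {K : Type u} [Field K] [CharZero K]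

theorem Burn.act_ofAut_idem {G : Type v} [Group G] [Finite G] (θ : MulAut G) :
    Burn.act (Groth.mk K (FinBiset.ofAut θ) (FinBiset.isBifree_ofAut (p := p) θ)) (Burn.idem K G) =
      Burn.idem K G := by
  classical
  let pt := FinBiset.ofGSet G PUnit.{v + 1}
  have ker_isPPrime : IsPPrimeGroup p θ.symm.toMonoidHom.ker :=
    isPPrimeGroup_ker_of_injective θ.symm.injective
  have mk_ofAut : Groth.mk K (FinBiset.ofAut θ) (FinBiset.isBifree_ofAut (p := p) θ) =
      Burn.twist ker_isPPrime (Groth.mk K pt trivial) := by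
    rw [Burn.twist, Groth.lift_mk]
    exact Groth.mk_iso (isBifree_empty _ _ _) _ _ (FinBiset.ofAutIsoTwist θ)
  have mark_pt (T : Subgroup G) : Burn.mark K T (Groth.mk K pt trivial) = 1 := by
    have : Nat.card {u : pt // ∀ l ∈ T, l • u = u} = 1 :=
      Nat.card_eq_one_iff_unique.2 ⟨⟨fun _ _ => Subtype.ext rfl⟩, ⟨⟨⟨⟩, fun _ _ => rfl⟩⟩⟩
    rw [Burn.mark_mk, this, Nat.cast_one]
  have map_eq_top_iff (T : Subgroup G) : T.map θ.symm.toMonoidHom = ⊤ ↔ T = ⊤ := by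
    rw [← (Subgroup.map_injective (f := θ.symm.toMonoidHom) θ.symm.injective).eq_iff (a := T),
      Subgroup.map_top_of_surjective _ θ.symm.surjective]
  refine Burn.ext_mark fun T => ?_
  rw [mk_ofAut, Burn.mark_act_twist, mark_pt, one_mul, mark_idem, mark_idem]
  exact if_congr (map_eq_top_iff T) rfl rfl

variable (K) in
/-- The class of `e^G_G` in `e^Δ_G / j_G`. -/
def idemClass (G : FiniteGrp.{v}) :
    ((jSub K p G).subquotient (eSub K p G)).obj (BifreeCat.of G) :=
  SubFun.subquotientMk _ _ (BifreeCat.of G) ⟨Burn.idem K G, idem_mem_eSub G⟩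

theorem idemClass_ne_zero (G : BGroup.{v} p) : idemClass (p := p) K G.1 ≠ 0 := fun h =>
  not_eSub_le_jSub G (eSub_le_iff.2 (SubFun.subquotientMk_eq_zero_iff.1 h))

theorem isTrivialVector_idemClass (G : BGroup.{v} p) :
    IsTrivialVector (idemClass (p := p) K G.1) where
  map_isoAut θ := congrArg (SubFun.subquotientMk _ _ _) (Subtype.ext (Burn.act_ofAut_idem θ))
  map_eq_zero {H} f hlt := by
    have act_mem := (eSub K p G.1).act_mem f (idem_mem_eSub G.1)
    have act_eq_zero : Burn.act f (Burn.idem K G.1) = 0 := by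
      by_contra h0
      exact hlt.not_ge (card_le_of_mem_eSub (G := H.grp) act_mem h0)
    refine SubFun.subquotientMk_eq_zero_iff.2 ?_
    change Burn.act f (Burn.idem K G.1) ∈ _
    rw [act_eq_zero]
    exact zero_mem _

theorem isSimpleFunctor_eSub_quotient (G : BGroup.{v} p) :
    IsSimpleFunctor ((jSub K p G.1).subquotient (eSub K p G.1)) :=
  (SubFun.isSimpleFunctor_subquotient_iff (jSub_covBy_eSub G).le).2 (jSub_covBy_eSub G)

variable (K) in
/-- The isomorphism `e^Δ_G / j_G ≅ S^Δ_{G,K}`. -/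
def eSubQuotientIso (G : BGroup.{v} p) :
    (jSub K p G.1).subquotient (eSub K p G.1) ≅ functorSTriv (BifreeCat.of G.1) :=
  ((isTrivialVector_idemClass G).functorSTrivIso (idemClass_ne_zero G)
    (isSimpleFunctor_eSub_quotient G)).symm

theorem exists_bGroup_of_covBy {F F' : SubFun (burnside.{u, v} p K)} (h : F ⋖ F') :
    ∃ G : BGroup.{v} p, (eSub K p G.1 ≤ F' ∧ ¬ eSub K p G.1 ≤ F) ∧
      (∀ G' : BGroup.{v} p, eSub K p G'.1 ≤ F' → ¬ eSub K p G'.1 ≤ F →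
        Nonempty (G'.1 ≃* G.1)) ∧
      eSub K p G.1 ⊔ F = F' ∧ eSub K p G.1 ⊓ F = jSub K p G.1 ∧
      Nonempty (F.subquotient F' ≅ functorSTriv (BifreeCat.of G.1)) := by
  obtain ⟨G, hG, hG'⟩ := exists_eSub_le_of_lt h.lt
  have sup_eq := sup_eq_of_covBy h hG hG'
  have inf_eq := eSub_inf_eq_jSub_of_covBy h hG hG'
  have e := SubFun.supQuotientIso F (eSub K p G.1)
  rw [sup_eq, inf_eq] at e
  exact ⟨G, ⟨hG, hG'⟩, fun _ => nonempty_mulEquiv_of_covBy h hG hG', sup_eq, inf_eq,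
    ⟨e.symm ≪≫ eSubQuotientIso K G⟩⟩

theorem isCompositionFactor_burnside_iff (S : BifreeCat.{u, v} p K ⥤ ModuleCat.{max u (v + 1)} K) :
    IsCompositionFactor S (burnside.{u, v} p K) ↔
      ∃ G : BGroup.{v} p, Nonempty (S ≅ functorSTriv (BifreeCat.of G.1)) := by
  constructor
  · rintro ⟨hS, A, B, hAB, ⟨e⟩⟩
    have covBy := (SubFun.isSimpleFunctor_subquotient_iff hAB).1
      ((SubFun.isSimpleFunctor_congr e).2 hS)
    obtain ⟨G, -, -, -, -, ⟨e'⟩⟩ := exists_bGroup_of_covBy covBy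
    exact ⟨G, ⟨e.symm ≪≫ e'⟩⟩
  · rintro ⟨G, ⟨e⟩⟩
    have e' := eSubQuotientIso K G ≪≫ e.symm
    exact ⟨(SubFun.isSimpleFunctor_congr e').1 (isSimpleFunctor_eSub_quotient G), _, _,
      (jSub_covBy_eSub G).le, ⟨e'⟩⟩

theorem exists_dominates_of_iso {G H : BGroup.{v} p}
    (e : (functorSTriv (BifreeCat.of G.1) : BifreeCat.{u, v} p K ⥤ ModuleCat K) ≅
      functorSTriv (BifreeCat.of H.1)) : ∃ L : Subgroup G.1, Dominates p L H.1 := by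
  let i := eSubQuotientIso K G ≪≫ e ≪≫ (eSubQuotientIso K H).symm
  let j := (i.app (BifreeCat.of G.1)).toLinearEquiv
  obtain ⟨y, hy⟩ := SubFun.subquotientMk_surjective _ _ _ (j (idemClass K G.1))
  have y_ne_zero : y.1 ≠ 0 := fun h0 =>
    idemClass_ne_zero G <| j.map_eq_zero_iff.1 <|
      hy.symm.trans (SubFun.subquotientMk_eq_zero_iff.2 (h0 ▸ zero_mem _))
  obtain ⟨L, hL⟩ := exists_eSub_le_of_mem (G := G.1) y.2 y_ne_zero
  exact ⟨L, dominates_of_eSub_le K hL⟩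

theorem nonempty_mulEquiv_of_iso {G H : BGroup.{v} p}
    (e : (functorSTriv (BifreeCat.of G.1) : BifreeCat.{u, v} p K ⥤ ModuleCat K) ≅
      functorSTriv (BifreeCat.of H.1)) : Nonempty (G.1 ≃* H.1) := by
  obtain ⟨L, hL⟩ := exists_dominates_of_iso e
  obtain ⟨M, hM⟩ := exists_dominates_of_iso e.symm
  have card_le : Nat.card G.1 ≤ Nat.card H.1 := hM.card_le.trans (Subgroup.card_le_card_group M)
  have card_eq : Nat.card L = Nat.card G.1 :=
    le_antisymm (Subgroup.card_le_card_group L) (card_le.trans hL.card_le)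
  obtain ⟨f⟩ := hL.nonempty_mulEquiv (card_eq.le.trans card_le)
  have eq_top := Subgroup.eq_top_of_card_eq L card_eq
  exact ⟨(Subgroup.topEquiv.symm.trans (MulEquiv.subgroupCongr eq_top.symm)).trans f⟩

end BurnsideFactors

end BifreeBiset

end

theorem mainTheorem1 (p : ℕ) [Fact p.Prime] (K : Type u) [Field K] [CharZero K] :
    -- the lattice of subfunctors of `K B`
    (∃ Θ : SubFun (burnside.{u, v} p K) ≃o {A : Set (BGroupClass.{v} p) // IsClosedClass A},
      (∀ F : SubFun (burnside.{u, v} p K),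
        (Θ F).1 = {c | ∃ H : BGroup.{v} p, H.cls = c ∧ eSub K p H.1 ≤ F}) ∧
      (∀ A : {A : Set (BGroupClass.{v} p) // IsClosedClass A},
        Θ.symm A = ⨆ (H : BGroup.{v} p) (_ : H.cls ∈ A.1), eSub K p H.1)) ∧
    -- the unique maximal subfunctor of `e^Δ_G` and the simple quotient
    (∀ G : BGroup.{v} p,
      jSub K p G.1 < eSub K p G.1 ∧
      (∀ F : SubFun (burnside.{u, v} p K), F < eSub K p G.1 → F ≤ jSub K p G.1) ∧
      Nonempty ((jSub K p G.1).subquotient (eSub K p G.1) ≅ functorSTriv (BifreeCat.of G.1))) ∧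
    -- the simple subquotients of `K B`
    (∀ F F' : SubFun (burnside.{u, v} p K), F < F' → IsSimpleFunctor (F.subquotient F') →
      ∃ G : BGroup.{v} p,
        (eSub K p G.1 ≤ F' ∧ ¬ eSub K p G.1 ≤ F) ∧
        (∀ G' : BGroup.{v} p, eSub K p G'.1 ≤ F' → ¬ eSub K p G'.1 ≤ F →
          Nonempty (G'.1 ≃* G.1)) ∧
        eSub K p G.1 ⊔ F = F' ∧
        eSub K p G.1 ⊓ F = jSub K p G.1 ∧
        Nonempty (F.subquotient F' ≅ functorSTriv (BifreeCat.of G.1))) ∧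
    -- the composition factors of `K B`
    (∀ (S : BifreeCat.{u, v} p K ⥤ ModuleCat.{max u (v + 1)} K) [S.Additive] [S.Linear K],
      IsCompositionFactor S (burnside.{u, v} p K) ↔
        ∃ G : BGroup.{v} p, Nonempty (S ≅ functorSTriv (BifreeCat.of G.1))) ∧
    -- non-isomorphic groups give non-isomorphic composition factors
    (∀ G H : BGroup.{v} p,
      Nonempty ((functorSTriv (BifreeCat.of G.1) : BifreeCat.{u, v} p K ⥤ ModuleCat K) ≅
        functorSTriv (BifreeCat.of H.1)) → Nonempty (G.1 ≃* H.1)) := by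
  refine ⟨⟨subFunOrderIso p K, fun _ => rfl, fun _ => rfl⟩,
    fun G => ⟨(jSub_covBy_eSub G).lt, fun _ => le_jSub_of_lt, ⟨eSubQuotientIso K G⟩⟩,
    fun _ _ hlt hs => exists_bGroup_of_covBy ((SubFun.isSimpleFunctor_subquotient_iff hlt.le).1 hs),
    fun S _ _ => isCompositionFactor_burnside_iff S, fun _ _ ⟨e⟩ => nonempty_mulEquiv_of_iso e⟩
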